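/- **Setting.** Write $\|x\|$ for the distance from $x\in\mathbb R$ to $\mathbb Z$, and identify $\mathbb T=\mathbb R/\mathbb Z$ with $[0,1)\subset\mathbb C$, with Lebesgue measure $\mathrm{mes}$; for $x\in\mathbb T$ the point $x+k\omega$ is taken modulo $1$. A real number $\omega$ is a *Brjuno–Rüssmann number* with function $\Delta$ and constant $C_\omega>0$ if $\Delta:[1,\infty)\to[1,\infty)$ is monotone increasing and continuous with $\Delta(1)=1$, $$\|k\omega\|>\frac{C_\omega}{\Delta(k)}\quad\text{for every integer }k>0,\qquad\text{and}\qquad \int_1^\infty\frac{\log\Delta(t)}{t^2}\,dt<\infty .$$ Consider the hypotheses: * **H.1**: $\Delta$ is differentiable, $\Delta(t)>t(\log t+1)$ for all $t>1$, and $t\Delta'(t)\ge\Delta(t)$ for all $t\ge1$; * **H.2**: H.1 holds and $\Delta(t)<\exp\left(\frac{t}{\log t}\right)$ for all $t>1$; * **H.3**: H.1 holds and $\frac{\log\Delta(t)}{t}$ is non-increasing on $[t_0,\infty)$ for some $t_0\ge1$. Under H.1, $\Delta$ is a bijection of $[1,\infty)$ onto itself; $\Delta^{-1}$ denotes its inverse.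 For $\breve C>0$ and $0<\varepsilon<1$ put $$\delta_{H.1}(n)=\frac{\breve C\log\Delta(n)}{\left(\Delta^{-1}(C_\omega n)\right)^{1-\varepsilon}},\qquad \delta_{H.2}(n)=\frac{\breve C}{\left[\log\left(\Delta^{-1}(C_\omega n)\right)\right]^{1-\varepsilon}},\qquad \delta_{H.3}(n)=\frac{\breve C\log(C_\omega n)}{\left[\Delta^{-1}(C_\omega n)\right]^{1-\varepsilon}} .$$ **Theorem 1.4 (strong Birkhoff ergodic theorem).** Let $\Omega\subset\mathbb C$ be a domain (its boundary may be arbitrary; in particular it may consist of finitely many piecewise $C^1$ curves), and let $\Omega'$ be an open set with $\mathbb T\subset\Omega'\Subset\Omega$. Let $u:\Omega\to[-\infty,\infty)$ be subharmonic and not identically $-\infty$ (for instance real-valued). Then $u$ is integrable on $\mathbb T$; put $\langle u\rangle=\int_0^1u(x)\,dx$. For every $\varepsilon\in(0,1)$ there is a constant $\breve C>0$, depending only on $\Omega$, $u$ and $\varepsilon$, such that for every Brjuno–Rüssmann number $\omega$ with function $\Delta$ and constant $C_\omega$ there is a constant $c>0$, depending only on $\omega$ (with its $\Delta$ and $C_\omega$),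 $u$ and $\varepsilon$, with the following property. Let $j\in\{1,2,3\}$ be such that hypothesis H.$j$ holds, and let $n$ be a positive integer with $C_\omega n\ge1$ if $j=1$, and $C_\omega n>1$ if $j\in\{2,3\}$ (so that $\delta_{H.j}(n)$ is defined and positive). Then for every $\delta>\delta_{H.j}(n)$, $$\mathrm{mes}\left(\left\{x\in\mathbb T:\ \left|\sum_{k=1}^nu(x+k\omega)-n\langle u\rangle\right|>\delta n\right\}\right)\le\exp(-c\,\delta\,n).$$ -/

import Mathlib

open Set MeasureTheory

noncomputable section

/-- The mean value of `u` over the circle of centre `z` and radius `r`, as the integral of the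
positive part minus the integral of the negative part (with respect to normalized arc length).
It is a well-defined element of `[-∞, ∞)` as soon as `u` is measurable and bounded above on the
circle, which upper semicontinuous functions with values in `[-∞, ∞)` are. -/
def circleMean (u : ℂ → EReal) (z : ℂ) (r : ℝ) : EReal :=
  ((∫⁻ t in Ioc (0 : ℝ) 1,
      (u (z + r * Complex.exp (2 * Real.pi * Complex.I * t))).toENNReal : ENNReal) : EReal) -
  ((∫⁻ t in Ioc (0 : ℝ) 1,
      (-u (z + r * Complex.exp (2 * Real.pi * Complex.I * t))).toENNReal : ENNReal) : EReal)

/-- Subharmonic functions on `Ω`, with values in `[-∞, ∞)`: upper semicontinuous, not identically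
`-∞`, and satisfying the sub-mean value inequality on every closed disc contained in `Ω`. -/
structure IsSubharmonicOn (u : ℂ → EReal) (Ω : Set ℂ) : Prop where
  upperSemicontinuousOn : UpperSemicontinuousOn u Ω
  ne_top : ∀ z ∈ Ω, u z ≠ ⊤
  exists_ne_bot : ∃ z ∈ Ω, u z ≠ ⊥
  le_circleMean : ∀ (z : ℂ) (r : ℝ), 0 < r → Metric.closedBall z r ⊆ Ω → u z ≤ circleMean u z r

/-- `ω` is a Brjuno–Rüssmann number, with function `Δ : [1, ∞) → [1, ∞)` and constant `Cω`.
Only the values of `Δ` on `[1, ∞)` matter; `|x - round x|` is the distance from `x` to `ℤ`. -/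
structure IsBrjunoRussmann (ω : ℝ) (Δ : ℝ → ℝ) (Cω : ℝ) : Prop where
  const_pos : 0 < Cω
  monotoneOn : MonotoneOn Δ (Ici 1)
  continuousOn : ContinuousOn Δ (Ici 1)
  map_one : Δ 1 = 1
  lt_dist : ∀ k : ℕ, 0 < k → Cω / Δ k < |(k : ℝ) * ω - round ((k : ℝ) * ω)|
  integrableOn : IntegrableOn (fun t : ℝ => Real.log (Δ t) / t ^ 2) (Ici 1)

/-- Hypothesis H.1. The first inequality is required for `t > 1` only, since `Δ 1 = 1`; the
derivative at the left end point `1` is the one-sided one. -/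
structure HypothesisH1 (Δ : ℝ → ℝ) : Prop where
  lt_map : ∀ t : ℝ, 1 < t → t * (Real.log t + 1) < Δ t
  differentiableOn : DifferentiableOn ℝ Δ (Ici 1)
  le_mul_deriv : ∀ t : ℝ, 1 ≤ t → Δ t ≤ t * derivWithin Δ (Ici 1) t

/-- Hypothesis H.2 (the upper bound is `+∞` at `t = 1`). -/
structure HypothesisH2 (Δ : ℝ → ℝ) : Prop extends HypothesisH1 Δ where
  map_lt : ∀ t : ℝ, 1 < t → Δ t < Real.exp (t / Real.log t)

/-- Hypothesis H.3: `log (Δ t) / t` is non-increasing for all large `t`. (It vanishes at `t = 1`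
and is positive afterwards, so it is never non-increasing on the whole of `[1, ∞)`.) -/
structure HypothesisH3 (Δ : ℝ → ℝ) : Prop extends HypothesisH1 Δ where
  antitoneOn : ∃ t₀ : ℝ, 1 ≤ t₀ ∧ AntitoneOn (fun t : ℝ => Real.log (Δ t) / t) (Ici t₀)

/-- The inverse function `Δ⁻¹ : [1, ∞) → [1, ∞)`. -/
def deltaInv (Δ : ℝ → ℝ) : ℝ → ℝ := Function.invFunOn Δ (Ici 1)

/-- Under H.1, `deltaInv Δ` really is a right inverse on `[1, ∞)`, with values in `[1, ∞)`. -/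
theorem deltaInv_spec {ω Cω : ℝ} {Δ : ℝ → ℝ} (h : IsBrjunoRussmann ω Δ Cω) (h1 : HypothesisH1 Δ)
    {s : ℝ} (hs : 1 ≤ s) : 1 ≤ deltaInv Δ s ∧ Δ (deltaInv Δ s) = s := by
  have hex : ∃ t ∈ Ici (1 : ℝ), Δ t = s := by
    rcases eq_or_lt_of_le hs with rfl | hs'
    · exact ⟨1, self_mem_Ici, h.map_one⟩
    · have hle : s ≤ Δ s := by
        have h2 := h1.lt_map s hs'
        have h3 := Real.log_nonneg hs
        nlinarith
      obtain ⟨t, ht, hts⟩ := intermediate_value_Icc hs (h.continuousOn.mono Icc_subset_Ici_self)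
        (show s ∈ Icc (Δ 1) (Δ s) from ⟨h.map_one.symm ▸ hs, hle⟩)
      exact ⟨t, ht.1, hts⟩
  exact ⟨Function.invFunOn_mem hex, Function.invFunOn_eq hex⟩

/-- The smallest deviations; `B` is the constant in front and `A ^ (1 - ε)` stands for `A ^ {1-}`. -/
def deltaH1 (Δ : ℝ → ℝ) (Cω ε B : ℝ) (n : ℕ) : ℝ :=
  B * Real.log (Δ n) / (deltaInv Δ (Cω * n)) ^ (1 - ε)

def deltaH2 (Δ : ℝ → ℝ) (Cω ε B : ℝ) (n : ℕ) : ℝ :=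
  B / (Real.log (deltaInv Δ (Cω * n))) ^ (1 - ε)

def deltaH3 (Δ : ℝ → ℝ) (Cω ε B : ℝ) (n : ℕ) : ℝ :=
  B * Real.log (Cω * n) / (deltaInv Δ (Cω * n)) ^ (1 - ε)

/-- The mean `⟨u⟩` over the torus `𝕋 = ℝ / ℤ`, which is identified with `[0, 1) ⊆ ℂ`. -/
def torusMean (u : ℂ → EReal) : ℝ := ∫ x in Ico (0 : ℝ) 1, (u (x : ℂ)).toReal

/-- The set of `x ∈ 𝕋` with `|∑_{k=1}^n u (x + k ω) - n ⟨u⟩| > δ n`, where `x + k ω` is taken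
modulo `1`, in `[0, 1)`. -/
def deviationSet (u : ℂ → EReal) (ω : ℝ) (n : ℕ) (δ : ℝ) : Set ℝ :=
  {x : ℝ | x ∈ Ico (0 : ℝ) 1 ∧ ((δ * n : ℝ) : EReal) <
    (((∑ k ∈ Finset.Icc 1 n, u ((Int.fract (x + k * ω) : ℝ) : ℂ)) -
      ((n * torusMean u : ℝ) : EReal)).abs : EReal)}

end

/-! The heart of the matter is an exponential moment of orbit sums of one logarithm `log |y - ζ|`.
Cut it off at height `η`. The truncated function has intervals as sublevel sets, so its orbit sum
differs from the mean by at most the discrepancy `D` times its oscillation, about `D log (1/η)`. The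
correction lives within `η` of `Re ζ`; if the orbit points are `2 η`-separated, only one of them can
meet it at a time. Hence the exponential of half the correction is at most one plus a sum of
integrable square-root singularities, of integral at most `4 N η ≤ 4`
(`lintegral_exp_abs_sum_log_le`).

To pass to `u`, write `M - u` on the unit segment as a limit from below of functions `H - ∫ log |x -
ζ| dμ(ζ)`, with one constant `A` bounding the mass and support of `μ` and the size and Lipschitz
constant of `H` (`IsSubharmonicOn.exists_isLogPotentialLimit`). This replaces the Riesz
decomposition: average `M - u` at scale `ε`, and take as density of `μ` the normalised difference
between the average and its circular mean, a discrete negative Laplacian. Jensen's inequality over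
`μ`, Fatou's lemma and Markov's inequality then yield a large deviation bound depending only on `A`,
`D` and `η`.

The arithmetic of `ω` supplies `D` and `η`. Put `T = Δ⁻¹(Cω n)`. Dirichlet's theorem gives `T < q ≤
n` with `q ω` almost an integer, and the orbit is split as `n = b q + r`. The `b` blocks have
discrepancy `6 b` and separation exponent `O(log Δ(q))`; the remainder is shorter than `q`, so its
separation is about `q⁻²`, while a greedy expansion of `r` in denominators bounds its discrepancy.
Deviations beyond a multiple of `log Δ(q) / q + (log n + log² T) / T` are therefore exponentially
rare (`IsLogPotentialLimit.exists_volume_le_of_large`). Each of H.1, H.2, H.3 bounds this quantity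
by the corresponding threshold, with a constant depending on `A` and `ε` alone.

All this needs `T` large in terms of `ω`. For the finitely many other `n` the rate may depend on
`n`, but a positive rate exists only if the deviation set does not have full measure. This is not
automatic, since `u` need be neither continuous on the segment nor equal at its two ends. It follows
from semicontinuity together with one-sided mean value bounds for logarithmic potentials
(`Function.Periodic.not_ae_far_from_mean`). -/

/-! ### Discrepancy of orbit segments. -/

/-- The orbit segments `x, x + ω, …, x + (N - 1) ω` modulo one have, uniformly in `x`, discrepancy
(not divided by `N`) at most `D` with respect to intervals. -/
def HasDiscrepancy (ω : ℝ) (N : ℕ) (D : ℝ) : Prop :=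
  ∀ (x : ℝ) (J : Set ℝ), J ⊆ Ico 0 1 → J.OrdConnected →
    |∑ k ∈ Finset.range N, J.indicator (fun _ => (1 : ℝ)) (Int.fract (x + k * ω)) -
      N * volume.real J| ≤ D

theorem volume_real_le_one {J : Set ℝ} (hJ : J ⊆ Ico 0 1) : volume.real J ≤ 1 := by
  have := measureReal_mono (μ := (volume : Measure ℝ)) hJ (by simp)
  simpa using this

theorem HasDiscrepancy.mono {ω : ℝ} {N : ℕ} {D D' : ℝ} (h : HasDiscrepancy ω N D) (hD : D ≤ D') :
    HasDiscrepancy ω N D' := fun x J hJ hc => (h x J hJ hc).trans hD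

theorem HasDiscrepancy.zero (ω : ℝ) : HasDiscrepancy ω 0 0 := fun x J _ _ => by simp

theorem HasDiscrepancy.self (ω : ℝ) (N : ℕ) : HasDiscrepancy ω N N := by
  intro x J hJ _
  have h1 : (0 : ℝ) ≤ ∑ k ∈ Finset.range N, J.indicator (fun _ => (1 : ℝ)) (Int.fract (x + k * ω)) :=
    Finset.sum_nonneg fun k _ => indicator_nonneg (fun _ _ => zero_le_one) _
  have h2 : ∑ k ∈ Finset.range N, J.indicator (fun _ => (1 : ℝ)) (Int.fract (x + k * ω)) ≤ N := by
    calc _ ≤ ∑ k ∈ Finset.range N, (1 : ℝ) :=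
          Finset.sum_le_sum fun k _ => indicator_le_self' (fun _ _ => zero_le_one) _
      _ = N := by simp
  have h3 := volume_real_le_one hJ
  have h4 : 0 ≤ volume.real J := measureReal_nonneg
  have h5 : (0 : ℝ) ≤ N := Nat.cast_nonneg N
  rw [abs_le]
  constructor <;> nlinarith

theorem HasDiscrepancy.add {ω : ℝ} {N N' : ℕ} {D D' : ℝ} (h : HasDiscrepancy ω N D)
    (h' : HasDiscrepancy ω N' D') : HasDiscrepancy ω (N + N') (D + D') := by
  intro x J hJ hc
  have h1 := h x J hJ hc
  have h2 := h' (x + N * ω) J hJ hc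
  rw [Finset.sum_range_add]
  have : ∀ k : ℕ, x + N * ω + k * ω = x + ((N + k : ℕ) : ℝ) * ω := fun k => by push_cast; ring
  simp only [this] at h2
  refine le_trans (le_of_eq ?_) ((abs_add_le _ _).trans (add_le_add h1 h2))
  congr 1
  push_cast
  ring

theorem HasDiscrepancy.mul {ω : ℝ} {N : ℕ} {D : ℝ} (h : HasDiscrepancy ω N D) (b : ℕ) :
    HasDiscrepancy ω (b * N) (b * D) := by
  induction b with
  | zero => simpa using HasDiscrepancy.zero ω
  | succ b ih => 
    have := ih.add h
    rw [show (b + 1) * N = b * N + N by ring]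
    exact this.mono (le_of_eq (by push_cast; ring))

/-- Replacing `ω` by `p / q` moves `q (x + k ω)` by at most one for `k < q`. So the integer `k p -
⌊x + k ω⌋ q` lies within one of `q (J - x)`, and it determines `k` because `p` is invertible modulo
`q`. An interval of length `q |J| + 2` contains at most `q |J| + 3` integers. -/
theorem sum_indicator_fract_le {ω : ℝ} {q : ℕ} {p : ℤ} (hq : 0 < q) (hpq : IsCoprime p q)
    (h : |ω - p / q| ≤ 1 / (q : ℝ) ^ 2) (x : ℝ) {J : Set ℝ} (hJ : J ⊆ Ico 0 1)
    (hc : J.OrdConnected) :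
    ∑ k ∈ Finset.range q, J.indicator (fun _ => (1 : ℝ)) (Int.fract (x + k * ω)) ≤
      q * volume.real J + 3 := by
  classical
  have hq' : (0 : ℝ) < q := Nat.cast_pos.2 hq
  rcases J.eq_empty_or_nonempty with rfl | hne
  · simp
  have hbb : BddBelow J := bddBelow_Ico.mono hJ
  have hba : BddAbove J := bddAbove_Ico.mono hJ
  set a := sInf J
  set b := sSup J
  have hvol : b - a ≤ volume.real J := by
    have h1 := measureReal_mono (μ := (volume : Measure ℝ))
      (IsConnected.Ioo_csInf_csSup_subset ⟨hne, hc.isPreconnected⟩ hbb hba)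
      (ne_top_of_le_ne_top (by simp) (measure_mono hJ))
    have h2 : a ≤ b := csInf_le_csSup hne hbb hba
    simpa [Real.volume_real_Ioo_of_le h2] using h1
  simp only [indicator_apply]
  rw [Finset.sum_boole]
  set α : ℝ := q * (a - x) - 1
  set β : ℝ := q * (b - x) + 1
  have hαβ : α + 2 ≤ β := by
    have h2 : a ≤ b := csInf_le_csSup hne hbb hba
    simp only [α, β]; nlinarith
  have hcard : (Finset.filter (fun k : ℕ => Int.fract (x + k * ω) ∈ J) (Finset.range q)).card ≤
      (Finset.Icc ⌈α⌉ ⌊β⌋).card := by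
    apply Finset.card_le_card_of_injOn (fun k : ℕ => (k : ℤ) * p - ⌊x + k * ω⌋ * q)
    · intro k hk
      simp only [Finset.coe_filter, Finset.mem_range, mem_ofPred_eq] at hk
      obtain ⟨hkq, hkJ⟩ := hk
      have h1 := csInf_le hbb hkJ
      have h2 := le_csSup hba hkJ
      have h3 : |(k : ℝ) * (ω * q - p)| ≤ 1 := by
        have : ω * q - p = q * (ω - p / q) := by field_simp
        rw [this, abs_mul, abs_mul, Nat.abs_cast, Nat.abs_cast]
        have hk' : (k : ℝ) ≤ q := by exact_mod_cast hkq.le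
        calc (k : ℝ) * (q * |ω - p / q|) ≤ q * (q * (1 / (q : ℝ) ^ 2)) := by gcongr
          _ = 1 := by field_simp
      rw [abs_le] at h3
      rw [Int.fract] at h1 h2
      simp only [Finset.coe_Icc, mem_Icc, Int.ceil_le, Int.le_floor]
      push_cast
      constructor
      · have : q * a ≤ q * (x + k * ω - ⌊x + k * ω⌋) := by gcongr
        simp only [α]; nlinarith
      · have : q * (x + k * ω - ⌊x + k * ω⌋) ≤ q * b := by gcongr
        simp only [β]; nlinarith
    · intro k hk k' hk' hkk
      simp only [Finset.coe_filter, Finset.mem_range, mem_ofPred_eq] at hk hk' hkk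
      have h1 : (q : ℤ) ∣ ((k : ℤ) - k') * p := 
        ⟨⌊x + k * ω⌋ - ⌊x + k' * ω⌋, by linear_combination hkk⟩
      have h2 : (q : ℤ) ∣ (k : ℤ) - k' := hpq.symm.dvd_of_dvd_mul_right h1
      have h3 := Int.eq_zero_of_abs_lt_dvd h2 (by rw [abs_lt]; omega)
      omega
  have h4 : ((Finset.Icc ⌈α⌉ ⌊β⌋).card : ℝ) ≤ β - α + 1 := by
    rw [Int.card_Icc]
    have h5 : (⌊β⌋ : ℝ) ≤ β := Int.floor_le β
    have h6 : α ≤ ⌈α⌉ := Int.le_ceil α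
    have h7 : (((⌊β⌋ + 1 - ⌈α⌉).toNat : ℤ) : ℝ) = max ((⌊β⌋ : ℝ) + 1 - ⌈α⌉) 0 := by
      rw [Int.toNat_eq_max]; push_cast; rfl
    rw [← Int.cast_natCast, h7]
    apply max_le <;> linarith
  calc _ ≤ ((Finset.Icc ⌈α⌉ ⌊β⌋).card : ℝ) := by exact_mod_cast hcard
    _ ≤ β - α + 1 := h4
    _ = q * (b - a) + 3 := by simp only [α, β]; ring
    _ ≤ _ := by gcongr

/-- The lower bound comes from the upper bound on the two intervals that make up the complement of
`J`, at a cost of three each. -/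
theorem HasDiscrepancy.of_rat {ω : ℝ} {q : ℕ} {p : ℤ} (hq : 0 < q) (hpq : IsCoprime p q)
    (h : |ω - p / q| ≤ 1 / (q : ℝ) ^ 2) : HasDiscrepancy ω q 6 := by
  intro x J hJ hc
  have hup := fun {J : Set ℝ} => sum_indicator_fract_le hq hpq h x (J := J)
  rcases J.eq_empty_or_nonempty with rfl | ⟨y₀, hy₀⟩
  · simp
  set I₁ : Set ℝ := {y ∈ Ico (0 : ℝ) 1 | ∀ z ∈ J, y < z}
  set I₂ : Set ℝ := {y ∈ Ico (0 : ℝ) 1 | ∀ z ∈ J, z < y}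
  have hI₁ : I₁.OrdConnected := ⟨fun y hy z hz w hw =>
    ⟨⟨hy.1.1.trans hw.1, hw.2.trans_lt hz.1.2⟩, fun t ht => hw.2.trans_lt (hz.2 t ht)⟩⟩
  have hI₂ : I₂.OrdConnected := ⟨fun y hy z hz w hw =>
    ⟨⟨hy.1.1.trans hw.1, hw.2.trans_lt hz.1.2⟩, fun t ht => (hy.2 t ht).trans_le hw.1⟩⟩
  have hun : Ico (0 : ℝ) 1 = I₁ ∪ (J ∪ I₂) := by
    apply Subset.antisymm
    · intro y hy
      by_cases h1 : y ∈ I₁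
      · exact Or.inl h1
      by_cases h2 : y ∈ I₂
      · exact Or.inr (Or.inr h2)
      right; left
      simp only [I₁, I₂, mem_ofPred_eq, hy, true_and, not_forall, not_lt] at h1 h2
      obtain ⟨z, hz, hzy⟩ := h1
      obtain ⟨w, hw, hyw⟩ := h2
      exact hc.out hz hw ⟨hzy, hyw⟩
    · rintro y (hy | hy | hy)
      exacts [hy.1, hJ hy, hy.1]
  have hd₂ : Disjoint J I₂ := disjoint_left.2 fun y hy hy' => lt_irrefl _ (hy'.2 y hy)
  have hd₁ : Disjoint I₁ (J ∪ I₂) := by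
    refine disjoint_left.2 fun y hy hy' => ?_
    rcases hy' with hy' | hy'
    · exact lt_irrefl _ (hy.2 y hy')
    · exact lt_asymm (hy.2 y₀ hy₀) (hy'.2 y₀ hy₀)
  have hfin : ∀ {K : Set ℝ}, K ⊆ Ico (0 : ℝ) 1 → volume K ≠ ⊤ := fun hK =>
    ne_top_of_le_ne_top (by simp) (measure_mono hK)
  have hJI : J ∪ I₂ ⊆ Ico (0 : ℝ) 1 := union_subset hJ fun y hy => hy.1
  have hvol : volume.real I₁ + (volume.real J + volume.real I₂) = 1 := by
    rw [← measureReal_union hd₂ hI₂.measurableSet (hfin hJ) (hfin fun y hy => hy.1),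
      ← measureReal_union hd₁ (hc.measurableSet.union hI₂.measurableSet)
        (hfin fun y hy => hy.1) (hfin hJI), ← hun]
    simp
  have hsum : ∑ k ∈ Finset.range q, I₁.indicator (fun _ => (1 : ℝ)) (Int.fract (x + k * ω)) +
      (∑ k ∈ Finset.range q, J.indicator (fun _ => (1 : ℝ)) (Int.fract (x + k * ω)) +
      ∑ k ∈ Finset.range q, I₂.indicator (fun _ => (1 : ℝ)) (Int.fract (x + k * ω))) = q := by
    rw [← Finset.sum_add_distrib, ← Finset.sum_add_distrib]
    have : ∀ y ∈ Ico (0 : ℝ) 1, I₁.indicator (fun _ => (1 : ℝ)) y +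
        (J.indicator (fun _ => (1 : ℝ)) y + I₂.indicator (fun _ => (1 : ℝ)) y) = 1 := by
      intro y hy
      have h1 := congrFun (indicator_union_of_disjoint hd₁ (fun _ => (1 : ℝ))) y
      have h2 := congrFun (indicator_union_of_disjoint hd₂ (fun _ => (1 : ℝ))) y
      rw [← h2, ← h1, ← hun, indicator_of_mem hy]
    rw [Finset.sum_congr rfl fun k _ => this _ ⟨Int.fract_nonneg _, Int.fract_lt_one _⟩]
    simp
  have h0 := hup hJ hc
  have h1 := hup (J := I₁) (fun y hy => hy.1) hI₁
  have h2 := hup (J := I₂) (fun y hy => hy.1) hI₂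
  have hvq : (q : ℝ) * volume.real I₁ + (q * volume.real J + q * volume.real I₂) = q := by
    rw [← mul_add, ← mul_add, hvol, mul_one]
  rw [abs_le]
  constructor <;> linarith

/-- Dirichlet's theorem, together with `Cω / Δ(q) < ‖q ω‖ ≤ 1 / (N + 1)`: an approximation of this
quality forces its denominator to be large. -/
theorem IsBrjunoRussmann.exists_approx {ω Cω : ℝ} {Δ : ℝ → ℝ} (h : IsBrjunoRussmann ω Δ Cω)
    {N : ℕ} (hN : 0 < N) : ∃ (q : ℕ) (p : ℤ), 0 < q ∧ q ≤ N ∧ IsCoprime p q ∧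
      |ω - p / q| ≤ 1 / ((N + 1) * q) ∧ Cω * (N + 1) < Δ q := by
  obtain ⟨r, hr, hrN⟩ := Real.exists_rat_abs_sub_le_and_den_le ω hN
  have hq : (0 : ℝ) < r.den := Nat.cast_pos.2 r.pos
  have hr' : |ω - r.num / r.den| ≤ 1 / ((N + 1) * r.den) := by
    rwa [← Rat.cast_def]
  refine ⟨r.den, r.num, r.pos, hrN, ?_, hr', ?_⟩
  · rw [Int.isCoprime_iff_gcd_eq_one]
    exact r.reduced
  · have h1 := h.lt_dist r.den r.pos
    have h2 := (h1.trans_le (round_le _ r.num))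
    have h3 : |(r.den : ℝ) * ω - r.num| ≤ 1 / (N + 1) := by
      have : (r.den : ℝ) * ω - r.num = r.den * (ω - r.num / r.den) := by field_simp
      rw [this, abs_mul, Nat.abs_cast]
      calc (r.den : ℝ) * |ω - r.num / r.den| ≤ r.den * (1 / ((N + 1) * r.den)) := by gcongr
        _ = 1 / (N + 1) := by field_simp
    have h4 : 0 < Δ r.den := by
      have := h.monotoneOn (self_mem_Ici) (mem_Ici.2 (Nat.one_le_cast.2 r.pos))
        (Nat.one_le_cast.2 r.pos)
      rw [h.map_one] at this
      linarith
    have h5 := h2.trans_le h3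
    rw [div_lt_div_iff₀ h4 (by positivity)] at h5
    linarith

theorem hasDiscrepancy_of_approx {ω : ℝ} {N q : ℕ} {p : ℤ} (hq : 0 < q) (hqN : q ≤ N)
    (hpq : IsCoprime p q) (h : |ω - p / q| ≤ 1 / ((N + 1) * q)) : HasDiscrepancy ω q 6 := by
  refine HasDiscrepancy.of_rat hq hpq (h.trans ?_)
  have hq' : (0 : ℝ) < q := Nat.cast_pos.2 hq
  have hqN' : (q : ℝ) ≤ N := Nat.cast_le.2 hqN
  rw [pow_two]
  gcongr
  linarith

/-- Greedy division `N = b q + r`: the blocks cost `6 b ≤ 6 M`, and `r < q ≤ N` gives `2 r ≤ N`, so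
there are at most `1 + log₂ N` rounds. -/
theorem HasDiscrepancy.of_steps_log {ω M : ℝ} {n : ℕ} (hM : 0 ≤ M)
    (hstep : ∀ N : ℕ, 0 < N → N ≤ n →
      ∃ q : ℕ, 0 < q ∧ q ≤ N ∧ HasDiscrepancy ω q 6 ∧ (N : ℝ) ≤ M * q) (N : ℕ) (hN : 0 < N)
    (hNn : N ≤ n) : HasDiscrepancy ω N (6 * (M * (1 + Nat.log 2 N))) := by
  induction N using Nat.strong_induction_on with
  | _ N ih =>
    obtain ⟨q, hq, hqN, hD, hMq⟩ := hstep N hN hNn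
    have hq' : (0 : ℝ) < q := Nat.cast_pos.2 hq
    have hb : ((N / q : ℕ) : ℝ) ≤ M := by
      refine Nat.cast_div_le.trans ?_
      rwa [div_le_iff₀ hq']
    have h1 := hD.mul (N / q)
    have hNe : N / q * q + N % q = N := Nat.div_add_mod' N q
    rcases Nat.eq_zero_or_pos (N % q) with h0 | h0
    · rw [h0, add_zero] at hNe
      rw [hNe] at h1
      refine h1.mono ?_
      have : (0 : ℝ) ≤ Nat.log 2 N := Nat.cast_nonneg _
      nlinarith
    · have hlt : 2 * (N % q) ≤ N := by
        have : N % q < q := Nat.mod_lt _ hq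
        have : 1 ≤ N / q := Nat.div_pos hqN hq
        nlinarith
      have h2 := h1.add (ih (N % q) (by omega) h0 (by omega))
      rw [hNe] at h2
      refine h2.mono ?_
      have hlog : Nat.log 2 (N % q) + 1 ≤ Nat.log 2 N := by
        rw [← Nat.log_mul_base one_lt_two h0.ne', mul_comm]
        exact Nat.log_mono_right hlt
      have hlog' : (Nat.log 2 (N % q) : ℝ) + 1 ≤ Nat.log 2 N := by exact_mod_cast hlog
      nlinarith

/-- As long as the denominators are at least `T`, the digits of the greedy expansion add up to at
most `N / T`. The first denominator below `T` contributes one digit, at most `M`, and leaves a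
remainder below `T`, paid for by `X`. -/
theorem HasDiscrepancy.of_steps {ω M T X : ℝ} {n : ℕ} (hM : 0 ≤ M) (hT : 0 < T)
    (hstep : ∀ N : ℕ, 0 < N → N ≤ n →
      ∃ q : ℕ, 0 < q ∧ q ≤ N ∧ HasDiscrepancy ω q 6 ∧ (N : ℝ) ≤ M * q)
    (hsmall : ∀ N : ℕ, (N : ℝ) < T → N ≤ n → HasDiscrepancy ω N (6 * X)) (N : ℕ)
    (hNn : N ≤ n) : HasDiscrepancy ω N (6 * (N / T + M + X)) := by
  induction N using Nat.strong_induction_on with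
  | _ N ih =>
    rcases lt_or_ge (N : ℝ) T with hNT | hNT
    · refine (hsmall N hNT hNn).mono ?_
      have : (0 : ℝ) ≤ N / T := by positivity
      linarith
    have hN : 0 < N := Nat.cast_pos.1 (hT.trans_le hNT)
    obtain ⟨q, hq, hqN, hD, hMq⟩ := hstep N hN hNn
    have hq' : (0 : ℝ) < q := Nat.cast_pos.2 hq
    have hb : ((N / q : ℕ) : ℝ) ≤ M := by
      refine Nat.cast_div_le.trans ?_
      rwa [div_le_iff₀ hq']
    have h1 := hD.mul (N / q)
    have hNe : N / q * q + N % q = N := Nat.div_add_mod' N q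
    have hlt : N % q < q := Nat.mod_lt _ hq
    have hrn : N % q ≤ n := (hlt.le.trans hqN).trans hNn
    have hNe' : ((N / q : ℕ) : ℝ) * q + (N % q : ℕ) = N := by exact_mod_cast hNe
    rcases lt_or_ge (q : ℝ) T with hqT | hqT
    · have h2 := h1.add (hsmall (N % q) (lt_trans (Nat.cast_lt.2 hlt) hqT) hrn)
      rw [hNe] at h2
      refine h2.mono ?_
      have : (0 : ℝ) ≤ N / T := by positivity
      nlinarith
    · have h2 := h1.add (ih (N % q) (lt_of_lt_of_le hlt hqN) hrn)
      rw [hNe] at h2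
      refine h2.mono ?_
      have : ((N / q : ℕ) : ℝ) + (N % q : ℕ) / T ≤ N / T := by
        rw [← hNe', add_div]
        gcongr
        rw [le_div_iff₀ hT]
        gcongr
      nlinarith

/-- The product with `log n` is what matters, since the remainder has separation exponent `O(log
n)`. If `T² ≤ n`, the trivial discrepancy of a remainder below `T` is at most `n / T`. Otherwise
`log n ≤ 2 log T`, and the logarithmic bound of `HasDiscrepancy.of_steps_log` for that remainder
costs only a further factor `log T`. -/
theorem exists_hasDiscrepancy_mul_log_le {ω T : ℝ} {n : ℕ} (hT : 1 ≤ T) (hTn : T ≤ n)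
    (hstep : ∀ N : ℕ, 0 < N → N ≤ n →
      ∃ q : ℕ, 0 < q ∧ q ≤ N ∧ HasDiscrepancy ω q 6 ∧ (N : ℝ) ≤ n / T * q) (N : ℕ)
    (hNn : N ≤ n) : ∃ D : ℝ, 0 ≤ D ∧ HasDiscrepancy ω N D ∧
      D * Real.log n ≤ n / T * (18 * Real.log n + 24 * Real.log T ^ 2) := by
  have hT0 : 0 < T := by linarith
  have hM : 0 ≤ (n : ℝ) / T := by positivity
  have hn1 : (1 : ℝ) ≤ n := hT.trans hTn
  have hlogn : 0 ≤ Real.log n := Real.log_nonneg hn1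
  have hlogT : 0 ≤ Real.log T := Real.log_nonneg hT
  have hNT : (N : ℝ) / T ≤ n / T := by gcongr
  rcases le_or_gt (T ^ 2) n with h | h
  · have hTM : T ≤ n / T := by rw [le_div_iff₀ hT0]; nlinarith
    refine ⟨18 * (n / T), by positivity, ?_, ?_⟩
    · refine (HasDiscrepancy.of_steps (X := T) hM hT0 hstep (fun N' h1 _ =>
        (HasDiscrepancy.self ω N').mono ?_) N hNn).mono ?_
      · linarith
      · linarith
    · have : 0 ≤ (n : ℝ) / T * (24 * Real.log T ^ 2) := by positivity
      nlinarith
  · have hlog : Real.log n ≤ 2 * Real.log T := by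
      have := Real.log_le_log (by linarith) h.le
      rwa [Real.log_pow] at this
    refine ⟨6 * (n / T + n / T + n / T * (1 + 2 * Real.log T)), by positivity, ?_, ?_⟩
    · refine (HasDiscrepancy.of_steps (X := n / T * (1 + 2 * Real.log T)) hM hT0
        hstep (fun N' h1 h2 => ?_) N hNn).mono ?_
      · rcases Nat.eq_zero_or_pos N' with rfl | h0
        · exact (HasDiscrepancy.zero ω).mono (by positivity)
        refine (HasDiscrepancy.of_steps_log hM hstep N' h0 h2).mono ?_
        gcongr
        have h3 : (Nat.log 2 N' : ℝ) ≤ Real.logb 2 N' := Real.natLog_le_logb N' 2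
        have h4 : Real.log N' ≤ Real.log T := Real.log_le_log (Nat.cast_pos.2 h0) h1.le
        have h5 : Real.logb 2 N' * Real.log 2 = Real.log N' := by
          rw [Real.logb, div_mul_cancel₀ _ (Real.log_pos one_lt_two).ne']
        have h6 := Real.log_two_gt_d9
        have h7 : (0 : ℝ) ≤ Nat.log 2 N' := Nat.cast_nonneg _
        nlinarith
      · gcongr
    · have : 0 ≤ (n : ℝ) / T * (Real.log T * (2 * Real.log T - Real.log n)) := by
        apply mul_nonneg hM (mul_nonneg hlogT (by linarith))
      nlinarith

/-! ### Small divisors and separation. -/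

/-- If `k p = l q`, then `(k, l)` is a multiple of `(q, p)` and the distance is at least `‖q ω‖`.
Otherwise `k p / q` is at least `1 / q` away from `l`, and replacing `p / q` by `ω` loses at most `n
/ ((n + 1) q)`. -/
theorem le_abs_mul_sub_of_approx {ω : ℝ} {n q : ℕ} {p : ℤ} (hq : 0 < q)
    (h : |ω - p / q| ≤ 1 / ((n + 1) * q)) {k : ℕ} (hk : 0 < k) (hkn : k ≤ n) (hpq : IsCoprime p q)
    (l : ℤ) :
    min (1 / (((n : ℝ) + 1) * q)) |(q : ℝ) * ω - round ((q : ℝ) * ω)| ≤ |k * ω - l| := by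
  have hq' : (0 : ℝ) < q := Nat.cast_pos.2 hq
  by_cases hl : (k : ℤ) * p = l * q
  · refine (min_le_right _ _).trans ((round_le _ p).trans ?_)
    have h1 : (q : ℤ) ∣ k := hpq.symm.dvd_of_dvd_mul_right ⟨l, by rw [hl, mul_comm]⟩
    obtain ⟨m, rfl⟩ := Int.natCast_dvd_natCast.1 h1
    have hm : 0 < m := Nat.pos_of_mul_pos_left hk
    have hl' : m * p = l := by
      have : (q : ℤ) ≠ 0 := by exact_mod_cast hq.ne'
      apply mul_right_cancel₀ this
      rw [← hl]; push_cast; ring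
    have : ((q * m : ℕ) : ℝ) * ω - l = m * (q * ω - p) := by
      rw [← hl']; push_cast; ring
    rw [this, abs_mul, Nat.abs_cast]
    have hm' : (1 : ℝ) ≤ m := by exact_mod_cast hm
    nlinarith [abs_nonneg ((q : ℝ) * ω - p)]
  · refine (min_le_left _ _).trans ?_
    have h1 : (1 : ℝ) ≤ |(k : ℝ) * p - l * q| := by
      have := Int.one_le_abs (sub_ne_zero.2 hl)
      exact_mod_cast this
    have h2 : (k : ℝ) * ω - l = k * (ω - p / q) + (k * p - l * q) / q := by field_simp; ring
    have h3 : |(k : ℝ) * (ω - p / q)| ≤ n / ((n + 1) * q) := by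
      rw [abs_mul, Nat.abs_cast]
      have : (k : ℝ) ≤ n := Nat.cast_le.2 hkn
      calc (k : ℝ) * |ω - p / q| ≤ n * (1 / ((n + 1) * q)) := by gcongr
        _ = _ := by ring
    have h4 : 1 / (q : ℝ) ≤ |((k : ℝ) * p - l * q) / q| := by
      rw [abs_div, Nat.abs_cast]; gcongr
    have h5 := abs_sub_abs_le_abs_sub (((k : ℝ) * p - l * q) / q) (-(k * (ω - p / q)))
    rw [abs_neg, sub_neg_eq_add, add_comm (((k : ℝ) * p - l * q) / q), ← h2] at h5
    have h6 : 1 / (q : ℝ) - n / ((n + 1) * q) = 1 / ((n + 1) * q) := by field_simp; ring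
    linarith

/-- Below `q` the resonance `k p = l q` cannot occur, so no Diophantine input is needed; `k ≤ q - 1`
leaves `1 / q - (q - 1) / q² = 1 / q²`. -/
theorem le_abs_mul_sub_of_lt {ω : ℝ} {n q : ℕ} {p : ℤ} (hqn : q ≤ n)
    (h : |ω - p / q| ≤ 1 / ((n + 1) * q)) {k : ℕ} (hk : 0 < k) (hkq : k < q) (hpq : IsCoprime p q)
    (l : ℤ) : 1 / (q : ℝ) ^ 2 ≤ |k * ω - l| := by
  have hq : 0 < q := hk.trans hkq
  have hq' : (0 : ℝ) < q := Nat.cast_pos.2 hq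
  have hqn' : (q : ℝ) ≤ n := Nat.cast_le.2 hqn
  have hl : (k : ℤ) * p ≠ l * q := by
    intro hl
    have h1 : (q : ℤ) ∣ k := hpq.symm.dvd_of_dvd_mul_right ⟨l, by rw [hl, mul_comm]⟩
    exact absurd (Nat.le_of_dvd hk (Int.natCast_dvd_natCast.1 h1)) (by omega)
  have h1 : (1 : ℝ) ≤ |(k : ℝ) * p - l * q| := by
    have := Int.one_le_abs (sub_ne_zero.2 hl)
    exact_mod_cast this
  have h2 : (k : ℝ) * ω - l = k * (ω - p / q) + (k * p - l * q) / q := by field_simp; ring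
  have h3 : |(k : ℝ) * (ω - p / q)| ≤ (q - 1) / (q * q) := by
    rw [abs_mul, Nat.abs_cast]
    have : (k : ℝ) + 1 ≤ q := by exact_mod_cast hkq
    calc (k : ℝ) * |ω - p / q| ≤ (q - 1) * (1 / ((n + 1) * q)) := by
          gcongr
          · linarith
          · linarith
      _ ≤ (q - 1) * (1 / (q * q)) := by
          gcongr
          · linarith [(Nat.one_le_cast (α := ℝ)).2 hq]
          · linarith
      _ = _ := by ring
  have h4 : 1 / (q : ℝ) ≤ |((k : ℝ) * p - l * q) / q| := by
    rw [abs_div, Nat.abs_cast]; gcongr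
  have h5 := abs_sub_abs_le_abs_sub (((k : ℝ) * p - l * q) / q) (-(k * (ω - p / q)))
  rw [abs_neg, sub_neg_eq_add, add_comm (((k : ℝ) * p - l * q) / q), ← h2] at h5
  have h6 : 1 / (q : ℝ) - (q - 1) / (q * q) = 1 / (q : ℝ) ^ 2 := by field_simp; ring
  linarith

/-! ### From discrepancy to orbit sums, and exponential moments of one logarithm. -/

/-- A Koksma inequality by the layer-cake formula `M - f(y) = ∫ₘᴹ 1[f(y) ≤ s] ds`: the discrepancy
bound is applied to each sublevel set and integrated in `s`. Requiring intervals as sublevel sets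
replaces bounded variation and suits both monotone functions and `log |y - ζ|`. -/
theorem HasDiscrepancy.abs_sum_sub_le {ω : ℝ} {N : ℕ} {D : ℝ} (hD : HasDiscrepancy ω N D)
    {f : ℝ → ℝ} {m M : ℝ} (hf : Measurable f)
    (hconv : ∀ s, {y | y ∈ Ico (0 : ℝ) 1 ∧ f y ≤ s}.OrdConnected)
    (hfm : ∀ y ∈ Ico (0 : ℝ) 1, m ≤ f y) (hfM : ∀ y ∈ Ico (0 : ℝ) 1, f y ≤ M) (x : ℝ) :
    |∑ k ∈ Finset.range N, f (Int.fract (x + k * ω)) - N * ∫ y in Ico (0 : ℝ) 1, f y| ≤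
      D * (M - m) := by
  set J : ℝ → Set ℝ := fun s => {y | y ∈ Ico (0 : ℝ) 1 ∧ f y ≤ s}
  have hmM : m ≤ M := (hfm 0 (by simp)).trans (hfM 0 (by simp))
  have hJ : ∀ s, J s ⊆ Ico 0 1 := fun s y hy => hy.1
  have hJmeas : MeasurableSet {z : ℝ × ℝ | z.1 ∈ Ico (0 : ℝ) 1 ∧ f z.1 ≤ z.2} :=
    (measurable_fst measurableSet_Ico).inter
      (measurableSet_le (hf.comp measurable_fst) measurable_snd)
  set G : ℝ → ℝ → ℝ := fun y s => (J s).indicator (fun _ => (1 : ℝ)) y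
  have hGmeas : Measurable (Function.uncurry G) :=
    (measurable_const (a := (1 : ℝ))).indicator hJmeas
  have hG1 : ∀ y s, ‖G y s‖ ≤ 1 := by
    intro y s
    simp only [G, indicator_apply]
    split_ifs <;> simp
  have hlayer : ∀ y ∈ Ico (0 : ℝ) 1, ∫ s in Ioc m M, G y s = M - f y := by
    intro y hy
    have h1 : G y = (Ici (f y)).indicator (fun _ => (1 : ℝ)) := by
      ext s
      simp only [G, indicator_apply, J, mem_ofPred_eq, hy, true_and, mem_Ici]
    rw [h1, setIntegral_indicator measurableSet_Ici]
    simp only [integral_const, MeasurableSet.univ, measureReal_restrict_apply, univ_inter,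
      smul_eq_mul, mul_one]
    have h2 : (Ioc m M ∩ Ici (f y) : Set ℝ) =ᵐ[volume] Icc (f y) M := by
      have h3 : (Ioc m M : Set ℝ) =ᵐ[volume] Icc m M := Ioc_ae_eq_Icc
      refine (h3.inter (ae_eq_refl (Ici (f y)))).trans (ae_eq_of_subset_of_measure_ge ?_ ?_ ?_ ?_)
      · rintro s ⟨h4, h5⟩
        exact ⟨h5, h4.2⟩
      · exact measure_mono fun s hs => ⟨⟨(hfm y hy).trans hs.1, hs.2⟩, hs.1⟩
      · exact (measurableSet_Icc.inter measurableSet_Ici).nullMeasurableSet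
      · simp
    rw [measureReal_congr h2, Real.volume_real_Icc_of_le (hfM y hy)]
  have hint2 : Integrable (Function.uncurry G)
      ((volume.restrict (Ico (0 : ℝ) 1)).prod (volume.restrict (Ioc m M))) :=
    Integrable.of_bound hGmeas.aestronglyMeasurable 1 (ae_of_all _ fun z => hG1 z.1 z.2)
  have hGint : ∀ y, IntegrableOn (G y) (Ioc m M) := fun y =>
    Integrable.of_bound (hGmeas.comp measurable_prodMk_left).aestronglyMeasurable 1
      (ae_of_all _ fun z => hG1 y z)
  have hvol : ∀ s, ∫ y in Ico (0 : ℝ) 1, G y s = volume.real (J s) := by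
    intro s
    have hms : MeasurableSet (J s) := (hconv s).measurableSet
    have h1 : (fun y => G y s) = (J s).indicator (fun _ => (1 : ℝ)) := rfl
    rw [h1, setIntegral_indicator hms, inter_eq_self_of_subset_right (hJ s)]
    simp
  have hvolint : IntegrableOn (fun s => volume.real (J s)) (Ioc m M) := by
    have := hint2.integral_prod_right
    simp only [Function.uncurry_apply_pair, hvol] at this
    exact this
  have hI : ∫ y in Ico (0 : ℝ) 1, f y = M - ∫ s in Ioc m M, volume.real (J s) := by
    have h1 : ∫ y in Ico (0 : ℝ) 1, f y = ∫ y in Ico (0 : ℝ) 1, (M - ∫ s in Ioc m M, G y s) := by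
      refine setIntegral_congr_fun measurableSet_Ico fun y hy => ?_
      simp only [hlayer y hy]; ring
    have h2 : Integrable (fun y => ∫ s in Ioc m M, G y s) (volume.restrict (Ico (0 : ℝ) 1)) :=
      hint2.integral_prod_left
    rw [h1, integral_sub (integrable_const _) h2,
      integral_integral_swap hint2]
    simp only [hvol]
    simp
  have hS : ∑ k ∈ Finset.range N, f (Int.fract (x + k * ω)) =
      N * M - ∫ s in Ioc m M, ∑ k ∈ Finset.range N, G (Int.fract (x + k * ω)) s := by
    rw [integral_finsetSum _ fun k _ => hGint _]
    rw [Finset.sum_congr rfl fun k _ => hlayer _ ⟨Int.fract_nonneg _, Int.fract_lt_one _⟩]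
    simp
  have hfinal : ∑ k ∈ Finset.range N, f (Int.fract (x + k * ω)) - N * ∫ y in Ico (0 : ℝ) 1, f y =
      - ∫ s in Ioc m M, (∑ k ∈ Finset.range N, G (Int.fract (x + k * ω)) s -
        N * volume.real (J s)) := by
    rw [integral_sub (integrable_finsetSum _ fun k _ => hGint _) (hvolint.const_mul _), hS, hI,
      integral_const_mul]
    ring
  rw [hfinal, abs_neg]
  have := norm_setIntegral_le_of_norm_le_const (μ := (volume : Measure ℝ)) (s := Ioc m M) (C := D)
    (f := fun s => ∑ k ∈ Finset.range N, G (Int.fract (x + k * ω)) s - N * volume.real (J s))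
    (by simp) (fun s _ => hD x (J s) (hJ s) (hconv s))
  rwa [Real.norm_eq_abs, Real.volume_real_Ioc_of_le hmM] at this

theorem setLIntegral_fract_add (F : ℝ → ENNReal) (c : ℝ) :
    ∫⁻ x in Ico (0 : ℝ) 1, F (Int.fract (x + c)) = ∫⁻ x in Ico (0 : ℝ) 1, F x := by
  have h1 : ∫⁻ x in Ico (0 : ℝ) 1, F x = ∫⁻ x in Ioc (0 : ℝ) (0 + 1), F (Int.fract x) := by
    rw [zero_add, setLIntegral_congr Ico_ae_eq_Ioc.symm]
    exact setLIntegral_congr_fun measurableSet_Ico fun x hx => by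
      simp only [Int.fract_eq_self.2 hx]
  have h2 : ∫⁻ x in Ico (0 : ℝ) 1, F (Int.fract (x + c)) =
      ∫⁻ x in Ioc c (c + 1), F (Int.fract x) := by
    have h3 : (fun x : ℝ => x + c) ⁻¹' (Ioc c (c + 1)) = Ioc 0 1 := by
      ext x; simp [add_comm]
    rw [setLIntegral_congr Ico_ae_eq_Ioc, ← h3]
    exact (measurePreserving_add_right volume c).setLIntegral_comp_preimage_emb
      (measurableEmbedding_addRight c) (fun x => F (Int.fract x)) (Ioc c (c + 1))
  rw [h1, h2]
  refine (isAddFundamentalDomain_Ioc zero_lt_one c).setLIntegral_eq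
    (isAddFundamentalDomain_Ioc zero_lt_one 0) _ ?_
  rintro ⟨g, hg⟩ x
  obtain ⟨k, rfl⟩ := AddSubgroup.mem_zmultiples_iff.1 hg
  congr 1
  simp [AddSubgroup.mk_vadd]

theorem measurable_orbit (ω c : ℝ) (k : ℕ) : Measurable fun x : ℝ => Int.fract (x + c + k * ω) :=
  measurable_fract.comp ((measurable_id.add_const c).add_const _)

theorem setLIntegral_orbit (F : ℝ → ENNReal) (ω c : ℝ) (k : ℕ) :
    ∫⁻ x in Ico (0 : ℝ) 1, F (Int.fract (x + c + k * ω)) = ∫⁻ x in Ico (0 : ℝ) 1, F x := by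
  simp only [add_assoc]
  exact setLIntegral_fract_add F _

/-- Halving the exponent turns the singularity `η / |y - a|`, which is not integrable, into its
square root. This is why all exponential moments below carry a factor one half. -/
theorem lintegral_sqrt_div_le {η : ℝ} (hη : 0 < η) (a : ℝ) :
    ∫⁻ y in Ioo (a - η) (a + η), ENNReal.ofReal (Real.sqrt (η / |y - a|)) ≤
      ENNReal.ofReal (4 * η) := by
  have hhalf : ∫⁻ y in Ioc 0 η, ENNReal.ofReal (Real.sqrt (η / |y|)) = ENNReal.ofReal (2 * η) := by
    have h1 : ∫ y in (0 : ℝ)..η, y ^ (-(1 / 2) : ℝ) = 2 * Real.sqrt η := by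
      rw [integral_rpow (Or.inl (by norm_num)), Real.sqrt_eq_rpow]
      rw [Real.zero_rpow (by norm_num)]
      norm_num
      ring
    have h2 : IntervalIntegrable (fun y : ℝ => y ^ (-(1 / 2) : ℝ)) volume 0 η :=
      intervalIntegral.intervalIntegrable_rpow' (by norm_num)
    have h3 : ∀ y ∈ Ioc 0 η, Real.sqrt (η / |y|) = Real.sqrt η * y ^ (-(1 / 2) : ℝ) := by
      intro y hy
      rw [abs_of_pos hy.1, Real.sqrt_div hη.le, Real.rpow_neg hy.1.le, ← Real.sqrt_eq_rpow]
      rfl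
    rw [setLIntegral_congr_fun measurableSet_Ioc fun y hy => by rw [h3 y hy]]
    rw [← ofReal_integral_eq_lintegral_ofReal]
    · rw [← intervalIntegral.integral_of_le hη.le, intervalIntegral.integral_const_mul, h1]
      congr 1
      have := Real.mul_self_sqrt hη.le
      linarith
    · exact ((intervalIntegrable_iff_integrableOn_Ioc_of_le hη.le).1 h2).const_mul _
    · refine (ae_restrict_iff' measurableSet_Ioc).2 (ae_of_all _ fun y hy => ?_)
      have := hy.1
      positivity
  have htr : ∫⁻ y in Ioo (a - η) (a + η), ENNReal.ofReal (Real.sqrt (η / |y - a|)) =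
      ∫⁻ y in Ioo (-η) η, ENNReal.ofReal (Real.sqrt (η / |y|)) := by
    have h3 : (fun x : ℝ => x - a) ⁻¹' (Ioo (-η) η) = Ioo (a - η) (a + η) := by
      ext x; simp only [mem_preimage, mem_Ioo]; constructor <;> rintro ⟨h, h'⟩ <;> constructor <;> linarith
    rw [← h3]
    exact (measurePreserving_sub_right volume a).setLIntegral_comp_preimage_emb
      (measurableEmbedding_subRight a) (fun x => ENNReal.ofReal (Real.sqrt (η / |x|))) _
  have hneg : ∫⁻ y in Ico (-η) 0, ENNReal.ofReal (Real.sqrt (η / |y|)) = ENNReal.ofReal (2 * η) := by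
    rw [← hhalf]
    have h3 : (fun x : ℝ => -x) ⁻¹' (Ioc 0 η) = Ico (-η) 0 := by
      ext x; simp only [mem_preimage, mem_Ioc, mem_Ico]; constructor <;> rintro ⟨h, h'⟩ <;> constructor <;> linarith
    have h4 := (Measure.measurePreserving_neg (volume : Measure ℝ)).setLIntegral_comp_preimage_emb
      (MeasurableEquiv.neg ℝ).measurableEmbedding (fun x => ENNReal.ofReal (Real.sqrt (η / |x|)))
      (Ioc 0 η)
    simp only [abs_neg] at h4
    rw [← h3, ← h4]
  rw [htr]
  calc _ ≤ ∫⁻ y in Ico (-η) 0 ∪ ({0} ∪ Ioc 0 η), ENNReal.ofReal (Real.sqrt (η / |y|)) := by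
        refine lintegral_mono_set fun y hy => ?_
        rcases lt_trichotomy y 0 with h | h | h
        · exact Or.inl ⟨hy.1.le, h⟩
        · exact Or.inr (Or.inl h)
        · exact Or.inr (Or.inr ⟨h, hy.2.le⟩)
    _ ≤ ENNReal.ofReal (2 * η) + (0 + ENNReal.ofReal (2 * η)) := by
        refine (lintegral_union_le _ _ _).trans (add_le_add hneg.le ?_)
        refine (lintegral_union_le _ _ _).trans (add_le_add (by simp) hhalf.le)
    _ = ENNReal.ofReal (4 * η) := by
        rw [zero_add, ← ENNReal.ofReal_add (by linarith) (by linarith)]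
        congr 1; ring

/-- The first `N` points of every orbit of the rotation by `ω` are `2 η`-separated in `[0, 1)`. -/
def IsOrbitSeparated (ω : ℝ) (N : ℕ) (η : ℝ) : Prop :=
  ∀ x : ℝ, ∀ i < N, ∀ j < N, i ≠ j → 2 * η ≤ |Int.fract (x + i * ω) - Int.fract (x + j * ω)|

theorem norm_ofReal_sub_pos {ζ : ℂ} (hζ : ζ.im ≠ 0) (y : ℝ) : 0 < ‖(y : ℂ) - ζ‖ := by
  rw [norm_pos_iff, sub_ne_zero]
  rintro rfl
  simp at hζ

theorem abs_sub_re_le_norm (ζ : ℂ) (y : ℝ) : |y - ζ.re| ≤ ‖(y : ℂ) - ζ‖ := by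
  simpa using Complex.abs_re_le_norm ((y : ℂ) - ζ)

theorem continuous_log_norm_sub {ζ : ℂ} (hζ : ζ.im ≠ 0) :
    Continuous fun y : ℝ => Real.log ‖(y : ℂ) - ζ‖ :=
  Continuous.log (by fun_prop) fun y => (norm_ofReal_sub_pos hζ y).ne'

theorem _root_.Continuous.integrableOn_Ico_zero_one {f : ℝ → ℝ} (hf : Continuous f) :
    IntegrableOn f (Ico (0 : ℝ) 1) :=
  (hf.continuousOn.integrableOn_compact isCompact_Icc).mono_set Ico_subset_Icc_self

/-- At most one `d i` is nonzero, so the exponential of the sum is a single term and can be bounded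
by a sum, which integrates termwise. -/
theorem exp_half_sum_le {ι : Type*} (s : Finset ι) (d : ι → ℝ) (h : ∀ i ∈ s, 0 ≤ d i)
    (h1 : ∀ i ∈ s, ∀ j ∈ s, i ≠ j → d i = 0 ∨ d j = 0) :
    Real.exp ((∑ i ∈ s, d i) / 2) ≤ 1 + ∑ i ∈ s, (Real.exp (d i / 2) - 1) := by
  have hW : ∀ i ∈ s, 0 ≤ Real.exp (d i / 2) - 1 := fun i hi => by
    have := Real.one_le_exp (show 0 ≤ d i / 2 by linarith [h i hi])
    linarith
  by_cases h0 : ∀ i ∈ s, d i = 0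
  · rw [Finset.sum_eq_zero h0]
    have := Finset.sum_nonneg hW
    simpa using this
  · push Not at h0
    obtain ⟨i, hi, hdi⟩ := h0
    have hsum : ∑ j ∈ s, d j = d i :=
      Finset.sum_eq_single_of_mem i hi fun j hj hji => (h1 i hi j hj hji.symm).resolve_left hdi
    rw [hsum]
    have := Finset.single_le_sum hW hi
    linarith

/-- Here `d` is the excess of the logarithm truncated at `η`. The truncated part gives `D (log (A +
1) - log η)`. The mean of `d` is at most `8 η`, which contributes the `4` in the exponent after
halving. Separation leaves at most one nonzero `d` along an orbit, whence the factor `1 + 4 N η ≤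
5`. -/
theorem lintegral_exp_abs_sum_log_le {ω D η A : ℝ} {N : ℕ} {ζ : ℂ} (hD : HasDiscrepancy ω N D)
    (hsep : IsOrbitSeparated ω N η) (hη : 0 < η) (hη1 : η ≤ 1) (hN : N * η ≤ 1) (hζ : ζ.im ≠ 0)
    (hA : ‖ζ‖ ≤ A) (c : ℝ) :
    ∫⁻ x in Ico (0 : ℝ) 1, ENNReal.ofReal (Real.exp
      (|∑ k ∈ Finset.range N, Real.log ‖((Int.fract (x + c + k * ω) : ℝ) : ℂ) - ζ‖ -
        N * ∫ y in Ico (0 : ℝ) 1, Real.log ‖(y : ℂ) - ζ‖| / 2)) ≤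
      ENNReal.ofReal (5 * Real.exp (D * (Real.log (A + 1) - Real.log η) / 2 + 4)) := by
  have hA0 : 0 ≤ A := (norm_nonneg _).trans hA
  have hpos := norm_ofReal_sub_pos hζ
  set d : ℝ → ℝ := fun y => Real.log (max ‖(y : ℂ) - ζ‖ η) - Real.log ‖(y : ℂ) - ζ‖ with hd
  have hLcont : Continuous fun y : ℝ => Real.log (max ‖(y : ℂ) - ζ‖ η) :=
    Continuous.log (by fun_prop) fun y => (lt_max_of_lt_left (hpos y)).ne'
  have hdcont : Continuous d := hLcont.sub (continuous_log_norm_sub hζ)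
  have hd0 : ∀ y, 0 ≤ d y := fun y =>
    sub_nonneg.2 (Real.log_le_log (hpos y) (le_max_left _ _))
  have hdz : ∀ y : ℝ, η ≤ ‖(y : ℂ) - ζ‖ → d y = 0 := fun y hy => by
    simp only [d, max_eq_left hy, sub_self]
  have hWle : ∀ y : ℝ, y ≠ ζ.re → Real.exp (d y / 2) - 1 ≤
      (Ioo (ζ.re - η) (ζ.re + η)).indicator (fun y => Real.sqrt (η / |y - ζ.re|)) y := by
    intro y hy
    rcases le_or_gt η ‖(y : ℂ) - ζ‖ with h | h
    · rw [hdz y h, zero_div, Real.exp_zero, sub_self]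
      exact indicator_nonneg (fun _ _ => Real.sqrt_nonneg _) y
    · have h1 := (abs_sub_re_le_norm ζ y).trans_lt h
      have h2 : y ∈ Ioo (ζ.re - η) (ζ.re + η) := by
        rw [abs_lt] at h1
        constructor <;> linarith
      rw [indicator_of_mem h2]
      have h3 : 0 < |y - ζ.re| := abs_pos.2 (sub_ne_zero.2 hy)
      have h4 : Real.exp (d y / 2) = Real.sqrt (η / ‖(y : ℂ) - ζ‖) := by
        rw [Real.exp_half]
        simp only [d, max_eq_right h.le]
        rw [← Real.log_div hη.ne' (hpos y).ne', Real.exp_log (div_pos hη (hpos y))]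
      rw [h4]
      have h5 : Real.sqrt (η / ‖(y : ℂ) - ζ‖) ≤ Real.sqrt (η / |y - ζ.re|) :=
        Real.sqrt_le_sqrt (div_le_div_of_nonneg_left hη.le h3 (abs_sub_re_le_norm ζ y))
      linarith
  have hWint : ∫⁻ y in Ico (0 : ℝ) 1, ENNReal.ofReal (Real.exp (d y / 2) - 1) ≤
      ENNReal.ofReal (4 * η) := by
    calc _ ≤ ∫⁻ y, ENNReal.ofReal (Real.exp (d y / 2) - 1) := setLIntegral_le_lintegral _ _
      _ ≤ ∫⁻ y, (Ioo (ζ.re - η) (ζ.re + η)).indicator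
          (fun y => ENNReal.ofReal (Real.sqrt (η / |y - ζ.re|))) y := by
          refine lintegral_mono_ae ?_
          filter_upwards [(measure_eq_zero_iff_ae_notMem.1 (Real.volume_singleton (a := ζ.re)))]
            with y hy
          refine (ENNReal.ofReal_le_ofReal (hWle y hy)).trans ?_
          by_cases h : y ∈ Ioo (ζ.re - η) (ζ.re + η)
          · simp only [indicator_of_mem h, le_refl]
          · simp only [indicator_of_notMem h, ENNReal.ofReal_zero, le_refl]
      _ = _ := lintegral_indicator measurableSet_Ioo _
      _ ≤ _ := lintegral_sqrt_div_le hη _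
  -- From `d ≤ 2 (exp (d / 2) - 1)` and the bound on the right-hand side just obtained.
  have hdint : ∫ y in Ico (0 : ℝ) 1, d y ≤ 8 * η := by
    rw [integral_eq_lintegral_of_nonneg_ae (ae_of_all _ hd0) hdcont.aestronglyMeasurable]
    refine ENNReal.toReal_le_of_le_ofReal (by linarith) ?_
    calc _ ≤ ∫⁻ y in Ico (0 : ℝ) 1, ENNReal.ofReal 2 * ENNReal.ofReal (Real.exp (d y / 2) - 1) := by
          refine lintegral_mono fun y => ?_
          rw [← ENNReal.ofReal_mul (by norm_num)]
          refine ENNReal.ofReal_le_ofReal ?_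
          have := Real.add_one_le_exp (d y / 2)
          linarith
      _ = ENNReal.ofReal 2 * ∫⁻ y in Ico (0 : ℝ) 1, ENNReal.ofReal (Real.exp (d y / 2) - 1) :=
          lintegral_const_mul _ (by fun_prop)
      _ ≤ ENNReal.ofReal 2 * ENNReal.ofReal (4 * η) := by gcongr
      _ = _ := by
          rw [← ENNReal.ofReal_mul (by norm_num)]
          congr 1; ring
  -- Sublevel sets of the truncated logarithm are intervals because `y ↦ max |y - ζ| η` is convex.
  have hL : ∀ x, |∑ k ∈ Finset.range N, Real.log (max ‖((Int.fract (x + k * ω) : ℝ) : ℂ) - ζ‖ η) -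
      N * ∫ y in Ico (0 : ℝ) 1, Real.log (max ‖(y : ℂ) - ζ‖ η)| ≤
      D * (Real.log (A + 1) - Real.log η) := by
    refine hD.abs_sum_sub_le hLcont.measurable (fun s => ?_) (fun y hy => ?_) (fun y hy => ?_)
    · have : {y : ℝ | y ∈ Ico (0 : ℝ) 1 ∧ Real.log (max ‖(y : ℂ) - ζ‖ η) ≤ s} =
          Ico (0 : ℝ) 1 ∩ {y | max ‖(y : ℂ) - ζ‖ η ≤ Real.exp s} := by
        ext y
        simp only [mem_ofPred_eq, mem_inter_iff]
        rw [Real.log_le_iff_le_exp (lt_max_of_lt_left (hpos y))]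
      rw [this]
      refine ordConnected_Ico.inter (Convex.ordConnected ?_)
      have h1 : ConvexOn ℝ univ fun y : ℝ => ‖(y : ℂ) - ζ‖ := by
        have h2 := (convexOn_univ_norm (E := ℂ)).comp_affineMap
          (Complex.ofRealLI.toLinearMap.toAffineMap - AffineMap.const ℝ ℝ ζ)
        exact h2
      have h2 := (h1.sup (convexOn_const η convex_univ)).convex_le (Real.exp s)
      have h3 : {y : ℝ | max ‖(y : ℂ) - ζ‖ η ≤ Real.exp s} =
          {x : ℝ | x ∈ univ ∧ ((fun y : ℝ => ‖(y : ℂ) - ζ‖) ⊔ fun _ => η) x ≤ Real.exp s} := by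
        ext y
        simp only [mem_ofPred_eq, mem_univ, true_and, Pi.sup_apply]
      rw [h3]
      exact h2
    · exact Real.log_le_log hη (le_max_right _ _)
    · refine Real.log_le_log (lt_max_of_lt_left (hpos y)) (max_le ?_ (by linarith))
      calc ‖(y : ℂ) - ζ‖ ≤ ‖(y : ℂ)‖ + ‖ζ‖ := norm_sub_le _ _
        _ ≤ A + 1 := by
          rw [Complex.norm_real, Real.norm_of_nonneg hy.1]
          linarith [hy.2]
  have hIlog : ∫ y in Ico (0 : ℝ) 1, Real.log ‖(y : ℂ) - ζ‖ =
      (∫ y in Ico (0 : ℝ) 1, Real.log (max ‖(y : ℂ) - ζ‖ η)) - ∫ y in Ico (0 : ℝ) 1, d y := by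
    rw [← integral_sub hLcont.integrableOn_Ico_zero_one hdcont.integrableOn_Ico_zero_one]
    simp only [hd, sub_sub_cancel]
  set C := Real.exp (D * (Real.log (A + 1) - Real.log η) / 2 + 4)
  have hpt : ∀ x, Real.exp
      (|∑ k ∈ Finset.range N, Real.log ‖((Int.fract (x + c + k * ω) : ℝ) : ℂ) - ζ‖ -
        N * ∫ y in Ico (0 : ℝ) 1, Real.log ‖(y : ℂ) - ζ‖| / 2) ≤
      C * (1 + ∑ k ∈ Finset.range N, (Real.exp (d (Int.fract (x + c + k * ω)) / 2) - 1)) := by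
    intro x
    refine le_trans ?_ (mul_le_mul_of_nonneg_left (exp_half_sum_le _ _ (fun k _ => hd0 _) ?_)
      (Real.exp_nonneg _))
    · rw [← Real.exp_add, Real.exp_le_exp]
      have h1 := hL (x + c)
      have h2 : ∑ k ∈ Finset.range N, Real.log ‖((Int.fract (x + c + k * ω) : ℝ) : ℂ) - ζ‖ =
        ∑ k ∈ Finset.range N, Real.log (max ‖((Int.fract (x + c + k * ω) : ℝ) : ℂ) - ζ‖ η) -
          ∑ k ∈ Finset.range N, d (Int.fract (x + c + k * ω)) := by
        rw [← Finset.sum_sub_distrib]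
        simp only [hd, sub_sub_cancel]
      have h3 : 0 ≤ ∑ k ∈ Finset.range N, d (Int.fract (x + c + k * ω)) :=
        Finset.sum_nonneg fun k _ => hd0 _
      have h4 : 0 ≤ ∫ y in Ico (0 : ℝ) 1, d y := integral_nonneg hd0
      have h5 : N * ∫ y in Ico (0 : ℝ) 1, d y ≤ 8 := by
        have := mul_le_mul_of_nonneg_left hdint (Nat.cast_nonneg (α := ℝ) N)
        nlinarith
      have h6 : 0 ≤ N * ∫ y in Ico (0 : ℝ) 1, d y := mul_nonneg (Nat.cast_nonneg _) h4
      rw [hIlog, h2]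
      rw [abs_le] at h1
      have h7 : |∑ k ∈ Finset.range N, Real.log (max ‖((Int.fract (x + c + k * ω) : ℝ) : ℂ) - ζ‖ η) -
          ∑ k ∈ Finset.range N, d (Int.fract (x + c + k * ω)) -
          N * ((∫ y in Ico (0 : ℝ) 1, Real.log (max ‖(y : ℂ) - ζ‖ η)) -
            ∫ y in Ico (0 : ℝ) 1, d y)| ≤ D * (Real.log (A + 1) - Real.log η) + 8 +
          ∑ k ∈ Finset.range N, d (Int.fract (x + c + k * ω)) := by
        rw [abs_le]
        constructor <;> linarith
      linarith
    · intro i hi j hj hij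
      by_contra hcon
      push Not at hcon
      have h1 : ∀ y, d y ≠ 0 → |y - ζ.re| < η := fun y hy =>
        (abs_sub_re_le_norm ζ y).trans_lt (lt_of_not_ge fun h => hy (hdz y h))
      have h2 := h1 _ hcon.1
      have h3 := h1 _ hcon.2
      have h4 := hsep (x + c) i (Finset.mem_range.1 hi) j (Finset.mem_range.1 hj) hij
      have h5 := abs_sub_le (Int.fract (x + c + i * ω)) ζ.re (Int.fract (x + c + j * ω))
      rw [abs_sub_comm ζ.re] at h5
      linarith
  have hW0 : ∀ y, 0 ≤ Real.exp (d y / 2) - 1 := fun y => by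
    have := Real.one_le_exp (show 0 ≤ d y / 2 by linarith [hd0 y])
    linarith
  have hWmeas : Measurable fun y => ENNReal.ofReal (Real.exp (d y / 2) - 1) :=
    (Real.continuous_exp.comp (hdcont.div_const 2) |>.sub continuous_const).measurable.ennreal_ofReal
  calc _ ≤ ∫⁻ x in Ico (0 : ℝ) 1, ENNReal.ofReal C * (1 + ∑ k ∈ Finset.range N,
        ENNReal.ofReal (Real.exp (d (Int.fract (x + c + k * ω)) / 2) - 1)) := by
        refine lintegral_mono fun x => (ENNReal.ofReal_le_ofReal (hpt x)).trans ?_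
        rw [ENNReal.ofReal_mul (Real.exp_nonneg _), ENNReal.ofReal_add zero_le_one
          (Finset.sum_nonneg fun k _ => hW0 _), ENNReal.ofReal_one,
          ENNReal.ofReal_sum_of_nonneg fun k _ => hW0 _]
    _ = ENNReal.ofReal C * (1 + ∑ k ∈ Finset.range N, ∫⁻ x in Ico (0 : ℝ) 1,
        ENNReal.ofReal (Real.exp (d (Int.fract (x + c + k * ω)) / 2) - 1)) := by
        have hm : ∀ k ∈ Finset.range N, Measurable fun x : ℝ =>
            ENNReal.ofReal (Real.exp (d (Int.fract (x + c + k * ω)) / 2) - 1) :=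
          fun k _ => hWmeas.comp (measurable_orbit ω c k)
        have hm' : Measurable fun x : ℝ => 1 + ∑ k ∈ Finset.range N,
            ENNReal.ofReal (Real.exp (d (Int.fract (x + c + k * ω)) / 2) - 1) :=
          measurable_const.add (Finset.measurable_fun_sum _ hm)
        rw [lintegral_const_mul _ hm',
          lintegral_add_left measurable_const, lintegral_finsetSum _ hm]
        simp
    _ ≤ ENNReal.ofReal C * (1 + ∑ k ∈ Finset.range N, ENNReal.ofReal (4 * η)) := by
        gcongr with k _
        rw [setLIntegral_orbit (fun y => ENNReal.ofReal (Real.exp (d y / 2) - 1)) ω c k]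
        exact hWint
    _ ≤ _ := by
        rw [Finset.sum_const, Finset.card_range, nsmul_eq_mul, ← ENNReal.ofReal_natCast,
          ← ENNReal.ofReal_mul (Nat.cast_nonneg _), ← ENNReal.ofReal_one,
          ← ENNReal.ofReal_add zero_le_one (by positivity),
          ← ENNReal.ofReal_mul (Real.exp_nonneg _)]
        refine ENNReal.ofReal_le_ofReal ?_
        rw [mul_comm]
        gcongr
        nlinarith

/-! ### Exponential moments for logarithmic potentials. -/

/-- On `[0, 1]`, the function `p` is the sum of the logarithmic potential of a measure and of a
Lipschitz function, with all data bounded by `A`. The measure does not charge the real axis. -/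
def IsLogPotential (A : ℝ) (p : ℝ → ℝ) : Prop :=
  ∃ (μ : Measure ℂ) (H : ℝ → ℝ), μ univ ≤ ENNReal.ofReal A ∧ (∀ᵐ ζ ∂μ, ζ.im ≠ 0 ∧ ‖ζ‖ ≤ A) ∧
    (∀ x y, |H x - H y| ≤ A * |x - y|) ∧ (∀ x ∈ Icc (0 : ℝ) 1, |H x| ≤ A) ∧
    ∀ x ∈ Icc (0 : ℝ) 1, Integrable (fun ζ : ℂ => Real.log ‖(x : ℂ) - ζ‖) μ ∧
      p x = H x - ∫ ζ, Real.log ‖(x : ℂ) - ζ‖ ∂μ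

theorem neg_log_le_two_mul_sqrt {t : ℝ} (ht : 0 < t) : -Real.log t ≤ 2 * Real.sqrt (1 / t) := by
  have h1 : 0 < Real.sqrt (1 / t) := Real.sqrt_pos.2 (by positivity)
  have h2 : Real.log (Real.sqrt (1 / t)) = -Real.log t / 2 := by
    rw [Real.log_sqrt (by positivity), one_div, Real.log_inv]
  have h3 := Real.log_le_sub_one_of_pos h1
  linarith

/-- The bound is uniform in `ζ`; this justifies every exchange of the integrals over the segment and
over `μ`. -/
theorem lintegral_abs_log_norm_sub_le {A : ℝ} {ζ : ℂ} (hζ : ζ.im ≠ 0) (hA : ‖ζ‖ ≤ A) :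
    ∫⁻ y in Ico (0 : ℝ) 1, ENNReal.ofReal |Real.log ‖(y : ℂ) - ζ‖| ≤
      ENNReal.ofReal (Real.log (A + 1) + 8) := by
  have hA0 : 0 ≤ A := (norm_nonneg _).trans hA
  have hlog : 0 ≤ Real.log (A + 1) := Real.log_nonneg (by linarith)
  have hpos := norm_ofReal_sub_pos hζ
  set g : ℝ → ENNReal := (Ioo (ζ.re - 1) (ζ.re + 1)).indicator
    fun y => ENNReal.ofReal (Real.sqrt (1 / |y - ζ.re|)) with hg
  have hgm : Measurable g := Measurable.indicator (by fun_prop) measurableSet_Ioo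
  calc _ ≤ ∫⁻ y in Ico (0 : ℝ) 1, (ENNReal.ofReal (Real.log (A + 1)) + 2 * g y) := by
        refine lintegral_mono_ae ?_
        filter_upwards [ae_restrict_mem measurableSet_Ico,
          ae_restrict_of_ae (measure_eq_zero_iff_ae_notMem.1 (Real.volume_singleton (a := ζ.re)))]
          with y hy hyζ
        have hyζ' : 0 < |y - ζ.re| := abs_pos.2 (sub_ne_zero.2 hyζ)
        rcases le_or_gt 1 ‖(y : ℂ) - ζ‖ with h | h
        · rw [abs_of_nonneg (Real.log_nonneg h)]
          refine le_add_right (ENNReal.ofReal_le_ofReal (Real.log_le_log (hpos y) ?_))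
          calc ‖(y : ℂ) - ζ‖ ≤ ‖(y : ℂ)‖ + ‖ζ‖ := norm_sub_le _ _
            _ ≤ A + 1 := by
              rw [Complex.norm_real, Real.norm_of_nonneg hy.1]
              linarith [hy.2]
        · rw [abs_of_nonpos (Real.log_nonpos (norm_nonneg _) h.le)]
          refine le_add_left ?_
          have h1 := (abs_sub_re_le_norm ζ y).trans_lt h
          have h2 : y ∈ Ioo (ζ.re - 1) (ζ.re + 1) := by
            rw [abs_lt] at h1
            constructor <;> linarith
          rw [hg, indicator_of_mem h2]
          have h3 : (2 : ENNReal) = ENNReal.ofReal 2 := by simp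
          rw [h3, ← ENNReal.ofReal_mul (by norm_num)]
          refine ENNReal.ofReal_le_ofReal ((neg_log_le_two_mul_sqrt (hpos y)).trans ?_)
          gcongr
          exact abs_sub_re_le_norm ζ y
    _ = ENNReal.ofReal (Real.log (A + 1)) + 2 * ∫⁻ y in Ico (0 : ℝ) 1, g y := by
        rw [lintegral_add_left measurable_const, lintegral_const_mul _ hgm]
        simp
    _ ≤ ENNReal.ofReal (Real.log (A + 1)) + 2 * ENNReal.ofReal (4 * 1) := by
        gcongr
        refine (setLIntegral_le_lintegral _ _).trans ?_
        rw [hg, lintegral_indicator measurableSet_Ioo]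
        exact lintegral_sqrt_div_le one_pos _
    _ = _ := by
        have h3 : (2 : ENNReal) = ENNReal.ofReal 2 := by simp
        rw [h3, ← ENNReal.ofReal_mul (by norm_num), ← ENNReal.ofReal_add hlog (by norm_num)]
        norm_num

theorem integrable_log_norm_sub_prod {A : ℝ} {μ : Measure ℂ} [IsFiniteMeasure μ]
    (hμ : ∀ᵐ ζ ∂μ, ζ.im ≠ 0 ∧ ‖ζ‖ ≤ A) :
    Integrable (fun z : ℝ × ℂ => Real.log ‖(z.1 : ℂ) - z.2‖)
      ((volume.restrict (Ico (0 : ℝ) 1)).prod μ) := by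
  have hm : Measurable fun z : ℝ × ℂ => Real.log ‖(z.1 : ℂ) - z.2‖ := by fun_prop
  refine ⟨hm.aestronglyMeasurable, ?_⟩
  rw [HasFiniteIntegral, lintegral_prod_symm _ hm.enorm.aemeasurable]
  calc _ ≤ ∫⁻ ζ, ENNReal.ofReal (Real.log (A + 1) + 8) ∂μ := by
        refine lintegral_mono_ae ?_
        filter_upwards [hμ] with ζ hζ
        refine le_trans (le_of_eq ?_) (lintegral_abs_log_norm_sub_le hζ.1 hζ.2)
        refine lintegral_congr fun y => ?_
        rw [← ofReal_norm, Real.norm_eq_abs]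
    _ < ⊤ := by
        rw [lintegral_const]
        exact ENNReal.mul_lt_top ENNReal.ofReal_lt_top (measure_lt_top _ _)

theorem HasDiscrepancy.nonneg {ω D : ℝ} {N : ℕ} (h : HasDiscrepancy ω N D) : 0 ≤ D :=
  (abs_nonneg _).trans (h 0 ∅ (empty_subset _) ordConnected_empty)

/-- `H` is the difference of the increasing functions `H + A y` and `A y`, whose oscillations on
`[0, 1]` are at most `2 A` and `A`. -/
theorem HasDiscrepancy.abs_sum_sub_le_of_lipschitz {ω D A : ℝ} {N : ℕ}
    (hD : HasDiscrepancy ω N D) (hA : 0 ≤ A) {H : ℝ → ℝ} (hH : ∀ x y, |H x - H y| ≤ A * |x - y|)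
    (x : ℝ) :
    |∑ k ∈ Finset.range N, H (Int.fract (x + k * ω)) - N * ∫ y in Ico (0 : ℝ) 1, H y| ≤
      3 * A * D := by
  have hcont : Continuous H := by
    have : LipschitzWith (Real.toNNReal A) H := LipschitzWith.of_dist_le_mul fun x y => by
      rw [Real.dist_eq, Real.dist_eq, Real.coe_toNNReal _ hA]
      exact hH x y
    exact this.continuous
  have hc2 : Continuous fun y => A * y := by fun_prop
  have hconv : ∀ f : ℝ → ℝ, Monotone f → ∀ s, {y | y ∈ Ico (0 : ℝ) 1 ∧ f y ≤ s}.OrdConnected :=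
    fun f hf s => ⟨fun y hy z hz w hw =>
      ⟨⟨hy.1.1.trans hw.1, hw.2.trans_lt hz.1.2⟩, (hf hw.2).trans hz.2⟩⟩
  have hmono : Monotone fun y => H y + A * y := fun y z hyz => by
    have h1 := (abs_le.1 (hH y z)).2
    rw [abs_sub_comm, abs_of_nonneg (sub_nonneg.2 hyz)] at h1
    simp only
    linarith
  have h1 := hD.abs_sum_sub_le (hcont.add hc2).measurable (hconv _ hmono) (m := H 0)
    (M := H 0 + 2 * A) (fun y hy => by simpa using hmono hy.1)
    (fun y hy => by have := hmono hy.2.le; have := (abs_le.1 (hH 1 0)).2; simp at *; linarith) x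
  have h2 := hD.abs_sum_sub_le hc2.measurable (hconv _ fun y z hyz => mul_le_mul_of_nonneg_left hyz hA) (m := 0)
    (M := A) (fun y hy => mul_nonneg hA hy.1) (fun y hy => by have := hy.2; nlinarith) x
  simp only [Pi.add_apply] at h1
  rw [integral_add hcont.integrableOn_Ico_zero_one hc2.integrableOn_Ico_zero_one,
    Finset.sum_add_distrib] at h1
  rw [abs_le] at *
  constructor <;> nlinarith

theorem IsLogPotential.integrableOn {A : ℝ} {p : ℝ → ℝ} (hp : IsLogPotential A p) (hA : 0 ≤ A) :
    IntegrableOn p (Ico 0 1) ∧ ∃ (μ : Measure ℂ) (H : ℝ → ℝ), μ univ ≤ ENNReal.ofReal A ∧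
      (∀ᵐ ζ ∂μ, ζ.im ≠ 0 ∧ ‖ζ‖ ≤ A) ∧ (∀ x y, |H x - H y| ≤ A * |x - y|) ∧
      (∀ x ∈ Icc (0 : ℝ) 1, Integrable (fun ζ : ℂ => Real.log ‖(x : ℂ) - ζ‖) μ ∧
      p x = H x - ∫ ζ, Real.log ‖(x : ℂ) - ζ‖ ∂μ) ∧
      ∫ x in Ico (0 : ℝ) 1, p x = (∫ x in Ico (0 : ℝ) 1, H x) -
        ∫ ζ, (∫ x in Ico (0 : ℝ) 1, Real.log ‖(x : ℂ) - ζ‖) ∂μ := by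
  obtain ⟨μ, H, hμ, hζ, hH, -, hp⟩ := hp
  have hfin : IsFiniteMeasure μ := ⟨hμ.trans_lt ENNReal.ofReal_lt_top⟩
  have hint := integrable_log_norm_sub_prod hζ
  have hcont : Continuous H := by
    have : LipschitzWith (Real.toNNReal A) H := LipschitzWith.of_dist_le_mul fun x y => by
      rw [Real.dist_eq, Real.dist_eq, Real.coe_toNNReal _ hA]
      exact hH x y
    exact this.continuous
  have hi2 : Integrable (fun x : ℝ => ∫ ζ, Real.log ‖(x : ℂ) - ζ‖ ∂μ)
    (volume.restrict (Ico (0 : ℝ) 1)) := hint.integral_prod_left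
  have hcongr : ∀ x ∈ Ico (0 : ℝ) 1, H x - ∫ ζ, Real.log ‖(x : ℂ) - ζ‖ ∂μ = p x := fun x hx =>
    ((hp x (Ico_subset_Icc_self hx)).2).symm
  refine ⟨?_, μ, H, hμ, hζ, hH, hp, ?_⟩
  · exact IntegrableOn.congr_fun (hcont.integrableOn_Ico_zero_one.sub hi2) hcongr measurableSet_Ico
  · rw [← setIntegral_congr_fun measurableSet_Ico hcongr,
      integral_sub hcont.integrableOn_Ico_zero_one hi2]
    congr 1
    exact integral_integral_swap (f := fun (x : ℝ) (ζ : ℂ) => Real.log ‖(x : ℂ) - ζ‖) hint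

/-- Jensen's inequality with values in `ENNReal`, so that integrability of the exponential need not
be known beforehand. -/
theorem ofReal_exp_average_le {α : Type*} [MeasurableSpace α] {μ : Measure α} [IsFiniteMeasure μ]
    [NeZero μ] {g : α → ℝ} (hg : Integrable g μ) :
    ENNReal.ofReal (Real.exp (⨍ a, g a ∂μ)) ≤
      (μ univ)⁻¹ * ∫⁻ a, ENNReal.ofReal (Real.exp (g a)) ∂μ := by
  by_cases h : ∫⁻ a, ENNReal.ofReal (Real.exp (g a)) ∂μ = ⊤
  · rw [h, ENNReal.mul_top (ENNReal.inv_ne_zero.2 (measure_ne_top _ _))]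
    exact le_top
  have hm : AEStronglyMeasurable (fun a => Real.exp (g a)) μ :=
    Real.continuous_exp.comp_aestronglyMeasurable hg.1
  have hi : Integrable (fun a => Real.exp (g a)) μ := by
    refine ⟨hm, ?_⟩
    rw [hasFiniteIntegral_iff_ofReal (ae_of_all _ fun a => Real.exp_nonneg _)]
    exact lt_top_iff_ne_top.2 h
  have h1 := convexOn_exp.map_average_le Real.continuous_exp.continuousOn isClosed_univ
    (ae_of_all μ fun a => mem_univ (g a)) hg hi
  refine (ENNReal.ofReal_le_ofReal h1).trans (le_of_eq ?_)
  rw [average_eq, smul_eq_mul, ENNReal.ofReal_mul (by positivity),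
    ofReal_integral_eq_lintegral_ofReal hi (ae_of_all _ fun a => Real.exp_nonneg _)]
  congr 1
  rw [measureReal_def, ← ENNReal.toReal_inv, ENNReal.ofReal_toReal]
  exact ENNReal.inv_ne_top.2 (NeZero.ne _)

/-- After normalising `μ` to a probability measure, Jensen moves the exponential inside the integral
over `ζ`, and Fubini leaves the moment of a single logarithm. Since the mass is at most `A`,
dividing by `2 A` leaves at most half the average over `ζ`. The Lipschitz part contributes `3 A D /
(2 A)`, the extra `3` in the exponent. -/
theorem IsLogPotential.lintegral_exp_le {A ω D η : ℝ} {N : ℕ} {p : ℝ → ℝ}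
    (hp : IsLogPotential A p) (hA : 0 < A) (hD : HasDiscrepancy ω N D)
    (hsep : IsOrbitSeparated ω N η) (hη : 0 < η) (hη1 : η ≤ 1) (hN : N * η ≤ 1) (c : ℝ) :
    ∫⁻ x in Ico (0 : ℝ) 1, ENNReal.ofReal (Real.exp
      (|∑ k ∈ Finset.range N, p (Int.fract (x + c + k * ω)) - N * ∫ y in Ico (0 : ℝ) 1, p y| /
        (2 * A))) ≤
      ENNReal.ofReal (5 * Real.exp (D * (Real.log (A + 1) + 3 - Real.log η) / 2 + 4)) := by
  obtain ⟨-, μ, H, hμ, hζ, hH, hp, hpI⟩ := hp.integrableOn hA.le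
  have hfin : IsFiniteMeasure μ := ⟨hμ.trans_lt ENNReal.ofReal_lt_top⟩
  have hint := integrable_log_norm_sub_prod hζ
  set g : ℝ → ℂ → ℝ := fun x ζ =>
    |∑ k ∈ Finset.range N, Real.log ‖((Int.fract (x + c + k * ω) : ℝ) : ℂ) - ζ‖ -
        N * ∫ y in Ico (0 : ℝ) 1, Real.log ‖(y : ℂ) - ζ‖| with hg
  have hI2 : Integrable (fun ζ => ∫ y in Ico (0 : ℝ) 1, Real.log ‖(y : ℂ) - ζ‖) μ :=
    hint.integral_prod_right
  have hmem : ∀ t : ℝ, Int.fract t ∈ Icc (0 : ℝ) 1 := fun t =>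
    ⟨Int.fract_nonneg _, (Int.fract_lt_one _).le⟩
  have hgs : ∀ x, Integrable (fun ζ : ℂ => ∑ k ∈ Finset.range N,
      Real.log ‖((Int.fract (x + c + k * ω) : ℝ) : ℂ) - ζ‖) μ := fun x =>
    integrable_finsetSum _ fun k _ => (hp _ (hmem _)).1
  have hgint : ∀ x, Integrable (g x) μ := fun x => ((hgs x).sub (hI2.const_mul _)).abs
  have hgm : Measurable (Function.uncurry g) := by
    have h1 : Measurable fun ζ : ℂ => ∫ y in Ico (0 : ℝ) 1, Real.log ‖(y : ℂ) - ζ‖ := by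
      have h2 : Measurable fun z : ℂ × ℝ => Real.log ‖(z.2 : ℂ) - z.1‖ := by fun_prop
      exact (h2.stronglyMeasurable.integral_prod_right' (ν := volume.restrict (Ico (0 : ℝ) 1))).measurable
    have h3 : ∀ k ∈ Finset.range N, Measurable fun z : ℝ × ℂ =>
        Real.log ‖((Int.fract (z.1 + c + k * ω) : ℝ) : ℂ) - z.2‖ := by
      intro k _
      have h4 : Measurable fun z : ℝ × ℂ => Int.fract (z.1 + c + k * ω) :=
        (measurable_orbit ω c k).comp measurable_fst
      exact Real.measurable_log.comp
        ((Complex.measurable_ofReal.comp h4).sub measurable_snd).norm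
    have h4 := (Finset.measurable_fun_sum _ h3).sub ((h1.comp measurable_snd).const_mul (N : ℝ))
    exact h4.abs
  have hpt : ∀ x, |∑ k ∈ Finset.range N, p (Int.fract (x + c + k * ω)) -
      N * ∫ y in Ico (0 : ℝ) 1, p y| ≤ 3 * A * D + ∫ ζ, g x ζ ∂μ := by
    intro x
    have h1 := hD.abs_sum_sub_le_of_lipschitz hA.le hH (x + c)
    have h2 : ∑ k ∈ Finset.range N, p (Int.fract (x + c + k * ω)) =
        ∑ k ∈ Finset.range N, H (Int.fract (x + c + k * ω)) - ∫ ζ, ∑ k ∈ Finset.range N,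
          Real.log ‖((Int.fract (x + c + k * ω) : ℝ) : ℂ) - ζ‖ ∂μ := by
      rw [integral_finsetSum _ fun k _ => (hp _ (hmem _)).1, ← Finset.sum_sub_distrib]
      exact Finset.sum_congr rfl fun k _ => (hp _ (hmem _)).2
    have h3 : |(∫ ζ, ∑ k ∈ Finset.range N,
          Real.log ‖((Int.fract (x + c + k * ω) : ℝ) : ℂ) - ζ‖ ∂μ) -
          N * ∫ ζ, (∫ x in Ico (0 : ℝ) 1, Real.log ‖(x : ℂ) - ζ‖) ∂μ| ≤ ∫ ζ, g x ζ ∂μ := by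
      rw [← integral_const_mul, ← integral_sub (hgs x) (hI2.const_mul _)]
      exact abs_integral_le_integral_abs
    rw [hpI, h2]
    rw [abs_le] at *
    constructor <;> linarith
  have hD0 := hD.nonneg
  have hlogA : 0 ≤ Real.log (A + 1) := Real.log_nonneg (by linarith)
  have hlogη : Real.log η ≤ 0 := Real.log_nonpos hη.le hη1
  by_cases hμ0 : μ = 0
  · calc _ ≤ ∫⁻ x in Ico (0 : ℝ) 1, ENNReal.ofReal (5 * Real.exp
          (D * (Real.log (A + 1) + 3 - Real.log η) / 2 + 4)) := by
          refine lintegral_mono fun x => ENNReal.ofReal_le_ofReal ?_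
          have h1 := hpt x
          rw [hμ0, integral_zero_measure, add_zero] at h1
          have h2 : |∑ k ∈ Finset.range N, p (Int.fract (x + c + k * ω)) -
              N * ∫ y in Ico (0 : ℝ) 1, p y| / (2 * A) ≤
              D * (Real.log (A + 1) + 3 - Real.log η) / 2 + 4 := by
            rw [div_le_iff₀ (by positivity)]
            nlinarith [mul_nonneg (mul_nonneg hA.le hD0) hlogA,
              mul_nonneg (mul_nonneg hA.le hD0) (neg_nonneg.2 hlogη)]
          have h3 := Real.exp_le_exp.2 h2
          have h4 := Real.exp_nonneg (D * (Real.log (A + 1) + 3 - Real.log η) / 2 + 4)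
          linarith
      _ = _ := by simp
  have : NeZero μ := ⟨hμ0⟩
  have hm0 : 0 < μ.real univ := by
    rw [measureReal_def]
    exact ENNReal.toReal_pos (NeZero.ne _) (measure_ne_top _ _)
  have hmA : μ.real univ ≤ A := ENNReal.toReal_le_of_le_ofReal hA.le hμ
  have hpt2 : ∀ x, ENNReal.ofReal (Real.exp (|∑ k ∈ Finset.range N,
      p (Int.fract (x + c + k * ω)) - N * ∫ y in Ico (0 : ℝ) 1, p y| / (2 * A))) ≤
      ENNReal.ofReal (Real.exp (3 * D / 2)) *
        ((μ univ)⁻¹ * ∫⁻ ζ, ENNReal.ofReal (Real.exp (g x ζ / 2)) ∂μ) := by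
    intro x
    refine le_trans ?_ (mul_le_mul_right (ofReal_exp_average_le ((hgint x).div_const 2)) _)
    rw [← ENNReal.ofReal_mul (Real.exp_nonneg _), ← Real.exp_add]
    refine ENNReal.ofReal_le_ofReal (Real.exp_le_exp.2 ?_)
    rw [average_eq, smul_eq_mul, integral_div]
    have h0 : 0 ≤ ∫ ζ, g x ζ ∂μ := integral_nonneg fun ζ => abs_nonneg _
    have h1 : (∫ ζ, g x ζ ∂μ) / A ≤ (μ.real univ)⁻¹ * ∫ ζ, g x ζ ∂μ := by
      rw [div_eq_inv_mul]
      gcongr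
    rw [div_le_iff₀ (by positivity)]
    rw [div_le_iff₀ hA] at h1
    have := hpt x
    nlinarith
  have hgm2 : Measurable (Function.uncurry fun x ζ => ENNReal.ofReal (Real.exp (g x ζ / 2))) :=
    (Real.measurable_exp.comp (hgm.div_const 2)).ennreal_ofReal
  calc _ ≤ ∫⁻ x in Ico (0 : ℝ) 1, ENNReal.ofReal (Real.exp (3 * D / 2)) *
        ((μ univ)⁻¹ * ∫⁻ ζ, ENNReal.ofReal (Real.exp (g x ζ / 2)) ∂μ) := lintegral_mono hpt2
    _ = ENNReal.ofReal (Real.exp (3 * D / 2)) * ((μ univ)⁻¹ *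
        ∫⁻ ζ, (∫⁻ x in Ico (0 : ℝ) 1, ENNReal.ofReal (Real.exp (g x ζ / 2))) ∂μ) := by
        have hgm3 : Measurable fun x => ∫⁻ ζ, ENNReal.ofReal (Real.exp (g x ζ / 2)) ∂μ :=
          hgm2.lintegral_prod_right'
        rw [lintegral_const_mul _ (hgm3.const_mul _), lintegral_const_mul _ hgm3,
          lintegral_lintegral_swap hgm2.aemeasurable]
    _ ≤ ENNReal.ofReal (Real.exp (3 * D / 2)) * ((μ univ)⁻¹ * ∫⁻ ζ, 
        ENNReal.ofReal (5 * Real.exp (D * (Real.log (A + 1) - Real.log η) / 2 + 4)) ∂μ) := by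
        refine mul_le_mul_right (mul_le_mul_right (lintegral_mono_ae ?_) _) _
        filter_upwards [hζ] with ζ hζ
        exact lintegral_exp_abs_sum_log_le hD hsep hη hη1 hN hζ.1 hζ.2 c
    _ = _ := by
        rw [lintegral_const, mul_comm _ (μ univ), ← mul_assoc (μ univ)⁻¹,
          ENNReal.inv_mul_cancel (NeZero.ne _) (measure_ne_top _ _), one_mul,
          ← ENNReal.ofReal_mul (Real.exp_nonneg _)]
        congr 1
        rw [mul_left_comm, ← Real.exp_add]
        congr 2
        ring

/-! ### Polar coordinates and the super-mean value property. -/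

/-- The point `exp (2 π i t)` of the unit circle. -/
noncomputable def unitPoint (t : ℝ) : ℂ := Complex.exp (2 * Real.pi * Complex.I * t)

theorem norm_unitPoint (t : ℝ) : ‖unitPoint t‖ = 1 := by
  rw [unitPoint, show (2 * Real.pi * Complex.I * t : ℂ) = ((2 * Real.pi * t : ℝ) : ℂ) * Complex.I by
    push_cast; ring, Complex.norm_exp_ofReal_mul_I]

theorem continuous_unitPoint : Continuous unitPoint := by
  unfold unitPoint
  fun_prop

theorem norm_mul_unitPoint {r : ℝ} (hr : 0 ≤ r) (t : ℝ) : ‖(r : ℂ) * unitPoint t‖ = r := by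
  rw [norm_mul, norm_unitPoint, mul_one, Complex.norm_real, Real.norm_of_nonneg hr]

theorem lintegral_angle (G : ℝ → ENNReal) (hG : Function.Periodic G (2 * Real.pi)) :
    ∫⁻ θ in Ioo (-Real.pi) Real.pi, G θ =
      ENNReal.ofReal (2 * Real.pi) * ∫⁻ t in Ioc (0 : ℝ) 1, G (2 * Real.pi * t) := by
  have hpi := Real.two_pi_pos
  have h1 : ∫⁻ θ in Ioo (-Real.pi) Real.pi, G θ = ∫⁻ θ in Ioc (-Real.pi) (-Real.pi + 2 * Real.pi), G θ := by
    rw [setLIntegral_congr Ioo_ae_eq_Ioc]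
    congr 3
    ring
  have h2 : ∫⁻ θ in Ioc (-Real.pi) (-Real.pi + 2 * Real.pi), G θ =
      ∫⁻ θ in Ioc 0 (0 + 2 * Real.pi), G θ := by
    refine (isAddFundamentalDomain_Ioc hpi (-Real.pi)).setLIntegral_eq
      (isAddFundamentalDomain_Ioc hpi 0) _ ?_
    rintro ⟨g, hg⟩ x
    obtain ⟨k, rfl⟩ := AddSubgroup.mem_zmultiples_iff.1 hg
    have := hG.zsmul k x
    rw [add_comm] at this
    exact this
  have h3 : (volume : Measure ℝ) = ENNReal.ofReal (2 * Real.pi) • Measure.map (2 * Real.pi * ·) volume := by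
    have := Real.smul_map_volume_mul_left hpi.ne'
    rw [abs_of_pos hpi] at this
    exact this.symm
  have h4 : (fun t : ℝ => 2 * Real.pi * t) ⁻¹' (Ioc 0 (0 + 2 * Real.pi)) = Ioc 0 1 := by
    ext t
    simp only [mem_preimage, mem_Ioc, zero_add]
    constructor
    · rintro ⟨h, h'⟩
      exact ⟨pos_of_mul_pos_right h hpi.le, by nlinarith⟩
    · rintro ⟨h, h'⟩
      exact ⟨by positivity, by nlinarith⟩
  have hemb : MeasurableEmbedding fun t : ℝ => 2 * Real.pi * t :=
    (Homeomorph.mulLeft₀ (2 * Real.pi) hpi.ne').measurableEmbedding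
  rw [h1, h2]
  conv_lhs => rw [h3]
  rw [Measure.restrict_smul, lintegral_smul_measure, hemb.restrict_map, hemb.lintegral_map, h4]
  rfl

theorem lintegral_eq_lintegral_circle {F : ℂ → ENNReal} (hF : Measurable F) :
    ∫⁻ z, F z = ∫⁻ r in Ioi (0 : ℝ),
      ENNReal.ofReal (2 * Real.pi * r) * ∫⁻ t in Ioc (0 : ℝ) 1, F (r * unitPoint t) := by
  rw [← Complex.lintegral_comp_polarCoord_symm, polarCoord_target, Measure.volume_eq_prod,
    ← Measure.prod_restrict]
  have hm : Measurable fun p : ℝ × ℝ =>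
      ENNReal.ofReal p.1 • F (Complex.polarCoord.symm p) := by
    simp only [Complex.polarCoord_symm_apply, smul_eq_mul]
    have h1 : Measurable fun p : ℝ × ℝ => (p.1 : ℂ) * (Real.cos p.2 + Real.sin p.2 * Complex.I) := by
      fun_prop
    exact measurable_fst.ennreal_ofReal.mul (hF.comp h1)
  rw [lintegral_prod _ hm.aemeasurable]
  refine setLIntegral_congr_fun measurableSet_Ioi fun r hr => ?_
  have hm2 : Measurable fun θ : ℝ => F (Complex.polarCoord.symm (r, θ)) := by
    simp only [Complex.polarCoord_symm_apply]
    have h1 : Measurable fun θ : ℝ => (r : ℂ) * (Real.cos θ + Real.sin θ * Complex.I) := by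
      fun_prop
    exact hF.comp h1
  simp only [smul_eq_mul]
  rw [lintegral_const_mul _ hm2, lintegral_angle]
  · rw [← mul_assoc, ← ENNReal.ofReal_mul (mem_Ioi.1 hr).le, mul_comm r]
    congr 1
    refine lintegral_congr fun t => ?_
    rw [Complex.polarCoord_symm_apply, unitPoint,
      show (2 * Real.pi * Complex.I * t : ℂ) = ((2 * Real.pi * t : ℝ) : ℂ) * Complex.I by
      push_cast; ring, Complex.exp_mul_I]
    simp
  · intro θ
    simp only [Complex.polarCoord_symm_apply]
    rw [Real.cos_add_two_pi, Real.sin_add_two_pi]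

/-- Nonnegative functions satisfying the super-mean value inequality on closed discs in `U`. -/
structure IsSupermean (f : ℂ → ENNReal) (U : Set ℂ) : Prop where
  measurable : Measurable f
  lintegral_circle_le : ∀ (z : ℂ) (r : ℝ), 0 < r → Metric.closedBall z r ⊆ U →
    ∫⁻ t in Ioc (0 : ℝ) 1, f (z + r * unitPoint t) ≤ f z

theorem lintegral_radial {k : ℝ → ENNReal} (hk : Measurable k) :
    ∫⁻ w : ℂ, k ‖w‖ = ∫⁻ r in Ioi (0 : ℝ), ENNReal.ofReal (2 * Real.pi * r) * k r := by
  have hk' : Measurable fun w : ℂ => k ‖w‖ := hk.comp measurable_norm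
  rw [lintegral_eq_lintegral_circle hk']
  refine setLIntegral_congr_fun measurableSet_Ioi fun r hr => ?_
  simp only [norm_mul_unitPoint (mem_Ioi.1 hr).le]
  simp

/-- In polar coordinates about `z` this is the circle inequality integrated against the radial
weight. -/
theorem IsSupermean.lintegral_radial_le {f : ℂ → ENNReal} {U : Set ℂ} (hf : IsSupermean f U)
    {k : ℝ → ENNReal} (hk : Measurable k) {z : ℂ} {R : ℝ} (hR : ∀ r, R < r → k r = 0)
    (hU : Metric.closedBall z R ⊆ U) :
    ∫⁻ ζ, k ‖z - ζ‖ * f ζ ≤ (∫⁻ w : ℂ, k ‖w‖) * f z := by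
  have h1 : ∫⁻ ζ, k ‖z - ζ‖ * f ζ = ∫⁻ w, k ‖w‖ * f (z + w) := by
    rw [← lintegral_add_left_eq_self _ z]
    simp
  have hm : Measurable fun w : ℂ => k ‖w‖ * f (z + w) :=
    (hk.comp measurable_norm).mul (hf.measurable.comp (measurable_const_add z))
  have hm' : Measurable fun r : ℝ => ENNReal.ofReal (2 * Real.pi * r) * k r := by fun_prop
  rw [h1, lintegral_eq_lintegral_circle hm, lintegral_radial hk, ← lintegral_mul_const _ hm']
  refine setLIntegral_mono' measurableSet_Ioi fun r hr => ?_
  simp only [norm_mul_unitPoint (mem_Ioi.1 hr).le]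
  rw [mul_assoc (ENNReal.ofReal _)]
  have hm2 : Measurable fun t : ℝ => f (z + r * unitPoint t) :=
    hf.measurable.comp (by have := continuous_unitPoint; fun_prop)
  rw [lintegral_const_mul _ hm2]
  refine mul_le_mul_right ?_ _
  rcases lt_or_ge R r with h | h
  · rw [hR r h, zero_mul]
    exact zero_le
  · exact mul_le_mul_right
      (hf.lintegral_circle_le z r hr ((Metric.closedBall_subset_closedBall h).trans hU)) _

/-! ### Subharmonic functions: the superharmonic defect and its local integrability. -/

/-- The nonnegative part of `M - y`, for `y` in `[-∞, ∞]`. -/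
noncomputable def defect (M : ℝ) (y : EReal) : ENNReal := ((M : EReal) - y).toENNReal

theorem continuous_defect (M : ℝ) : Continuous (defect M) := by
  have h : Continuous fun y : EReal => (M : EReal) + -y := by
    rw [continuous_iff_continuousAt]
    intro y
    have h1 : ContinuousAt (fun p : EReal × EReal => p.1 + p.2) ((M : EReal), -y) :=
      EReal.continuousAt_add (Or.inl (EReal.coe_ne_top M)) (Or.inl (EReal.coe_ne_bot M))
    exact ContinuousAt.comp (f := fun y : EReal => ((M : EReal), -y)) h1 (by fun_prop)
  exact EReal.continuous_toENNReal.comp h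

theorem antitone_defect (M : ℝ) : Antitone (defect M) := fun _ _ h =>
  EReal.toENNReal_le_toENNReal (EReal.sub_le_sub le_rfl h)

theorem defect_bot (M : ℝ) : defect M ⊥ = ⊤ := by simp [defect]

theorem defect_coe (M a : ℝ) : defect M (a : EReal) = ENNReal.ofReal (M - a) := by
  rw [defect, ← EReal.coe_sub, EReal.real_coe_toENNReal]

theorem defect_add_toENNReal {M : ℝ} (hM : 0 ≤ M) {y : EReal} (hy : y ≤ M) :
    defect M y + y.toENNReal = ENNReal.ofReal M + (-y).toENNReal := by
  induction y with
  | bot => simp [defect_bot]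
  | top => exact absurd hy (by simp)
  | coe a =>
    rw [defect_coe, ← EReal.coe_neg, EReal.real_coe_toENNReal, EReal.real_coe_toENNReal]
    have ha : a ≤ M := by exact_mod_cast hy
    rcases le_total 0 a with h | h
    · rw [← ENNReal.ofReal_add (by linarith) h, ENNReal.ofReal_of_nonpos (p := -a) (by linarith)]
      simp
    · rw [ENNReal.ofReal_of_nonpos h, ← ENNReal.ofReal_add hM (by linarith)]
      simp [sub_eq_add_neg]

theorem toENNReal_neg_le_defect {M : ℝ} (hM : 0 ≤ M) (y : EReal) :
    (-y).toENNReal ≤ defect M y := by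
  refine EReal.toENNReal_le_toENNReal ?_
  rw [sub_eq_add_neg]
  have : (0 : EReal) ≤ M := by exact_mod_cast hM
  exact le_add_of_nonneg_left this

theorem defect_le_add (M : ℝ) (y : EReal) :
    defect M y ≤ ENNReal.ofReal M + (-y).toENNReal := by
  rw [defect, sub_eq_add_neg]
  exact EReal.toENNReal_add_le

/-- The circular mean is a difference of two integrals in `[0, ∞]`. The positive one is at most `M`;
if `u z ≠ -∞`, the sub-mean inequality makes the other one finite too, and `defect M u + u⁺ = M +
u⁻` can be integrated and rearranged in `ℝ`. If `u z = -∞`, the right-hand side is infinite. -/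
theorem IsSubharmonicOn.lintegral_circle_defect_le {u : ℂ → EReal} {Ω : Set ℂ}
    (hu : IsSubharmonicOn u Ω) {z : ℂ} {r M : ℝ} (hr : 0 < r) (hM : 0 ≤ M)
    (hsub : Metric.closedBall z r ⊆ Ω) (hle : ∀ w ∈ Metric.closedBall z r, u w ≤ M) :
    ∫⁻ t in Ioc (0 : ℝ) 1, defect M (u (z + r * unitPoint t)) ≤ defect M (u z) := by
  have hmem : ∀ t, z + r * unitPoint t ∈ Metric.closedBall z r := fun t => by
    rw [mem_closedBall_iff_norm, add_sub_cancel_left, norm_mul_unitPoint hr.le]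
  have husc : UpperSemicontinuous fun t : ℝ => u (z + r * unitPoint t) := by
    have h1 := hu.upperSemicontinuousOn
    intro t y hy
    have h2 := h1 _ (hsub (hmem t)) y hy
    have h3 : Continuous fun t : ℝ => z + r * unitPoint t := by
      have := continuous_unitPoint; fun_prop
    have h4 : Filter.Tendsto (fun t : ℝ => z + r * unitPoint t) (nhds t)
        (nhdsWithin (z + r * unitPoint t) Ω) :=
      tendsto_nhdsWithin_iff.2 ⟨h3.continuousAt, Filter.Eventually.of_forall fun t => hsub (hmem t)⟩
    exact h4.eventually h2
  have hmeas := husc.measurable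
  have hzM := hle z (Metric.mem_closedBall_self hr.le)
  set P := ∫⁻ t in Ioc (0 : ℝ) 1, (u (z + r * unitPoint t)).toENNReal
  set Q := ∫⁻ t in Ioc (0 : ℝ) 1, (-u (z + r * unitPoint t)).toENNReal
  set I := ∫⁻ t in Ioc (0 : ℝ) 1, defect M (u (z + r * unitPoint t))
  have hmain : u z ≤ (P : EReal) - (Q : EReal) := hu.le_circleMean z r hr hsub
  have hP : P ≤ ENNReal.ofReal M := by
    calc P ≤ ∫⁻ t in Ioc (0 : ℝ) 1, ENNReal.ofReal M := lintegral_mono fun t => by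
          have := EReal.toENNReal_le_toENNReal (hle _ (hmem t))
          rwa [EReal.real_coe_toENNReal] at this
      _ = ENNReal.ofReal M := by simp
  have hIPQ : I + P = ENNReal.ofReal M + Q := by
    simp only [I, P, Q]
    rw [← lintegral_add_right _ hmeas.ereal_toENNReal]
    rw [lintegral_congr fun t => defect_add_toENNReal hM (hle _ (hmem t)),
      lintegral_add_left measurable_const]
    simp
  rcases eq_or_ne (u z) ⊥ with h | h
  · rw [h, defect_bot]; exact le_top
  have hPtop : P ≠ ⊤ := ne_top_of_le_ne_top ENNReal.ofReal_ne_top hP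
  have hQtop : Q ≠ ⊤ := by
    intro hQ
    rw [hQ, EReal.coe_ennreal_top, EReal.sub_top, le_bot_iff] at hmain
    exact h hmain
  obtain ⟨a, ha⟩ : ∃ a : ℝ, u z = a := by
    refine ⟨(u z).toReal, (EReal.coe_toReal ?_ h).symm⟩
    exact ne_top_of_le_ne_top (EReal.coe_ne_top M) hzM
  rw [ha] at hmain hzM ⊢
  have hI : I ≠ ⊤ := by
    intro hI
    rw [hI, top_add] at hIPQ
    exact ENNReal.add_ne_top.2 ⟨ENNReal.ofReal_ne_top, hQtop⟩ hIPQ.symm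
  clear_value P Q I
  lift P to NNReal using hPtop
  lift Q to NNReal using hQtop
  lift I to NNReal using hI
  rw [defect_coe]
  have h1 : a ≤ (P : ℝ) - Q := by
    have : ((P : ENNReal) : EReal) - ((Q : ENNReal) : EReal) = (((P : ℝ) - Q : ℝ) : EReal) := by
      push_cast; rfl
    rw [this] at hmain
    exact_mod_cast hmain
  have h2 : (I : ℝ) + P = M + Q := by
    have := congrArg ENNReal.toReal hIPQ
    rw [ENNReal.toReal_add (by simp) (by simp), ENNReal.toReal_add (by simp) (by simp),
      ENNReal.toReal_ofReal hM] at this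
    simpa using this
  rw [← ENNReal.ofReal_coe_nnreal]
  exact ENNReal.ofReal_le_ofReal (by linarith)

theorem IsSubharmonicOn.exists_le_of_isCompact {u : ℂ → EReal} {Ω K : Set ℂ}
    (hu : IsSubharmonicOn u Ω) (hK : IsCompact K) (hsub : K ⊆ Ω) :
    ∃ M : ℝ, 0 ≤ M ∧ ∀ z ∈ K, u z ≤ M := by
  rcases K.eq_empty_or_nonempty with rfl | hne
  · exact ⟨0, le_rfl, by simp⟩
  obtain ⟨w, hw, hmax⟩ := (hu.upperSemicontinuousOn.mono hsub).exists_isMaxOn hne hK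
  refine ⟨max 0 (u w).toReal, le_max_left _ _, fun z hz => ?_⟩
  refine (hmax hz).trans ((EReal.le_coe_toReal (hu.ne_top w (hsub hw))).trans ?_)
  exact_mod_cast le_max_right _ _

theorem IsSubharmonicOn.measurable_indicator_defect {u : ℂ → EReal} {Ω K : Set ℂ}
    (hu : IsSubharmonicOn u Ω) (hΩ : IsOpen Ω) (hK : MeasurableSet K) (hsub : K ⊆ Ω) (M : ℝ) :
    Measurable (K.indicator fun z => defect M (u z)) := by
  classical
  have husc : UpperSemicontinuous fun z => if z ∈ Ω then u z else ⊤ := by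
    intro z y hy
    simp only at hy
    by_cases hz : z ∈ Ω
    · rw [if_pos hz] at hy
      have h1 := hu.upperSemicontinuousOn z hz y hy
      rw [hΩ.nhdsWithin_eq hz] at h1
      filter_upwards [h1, hΩ.mem_nhds hz] with w hw hwΩ
      rwa [if_pos hwΩ]
    · rw [if_neg hz] at hy
      exact absurd hy not_top_lt
  have h2 : K.indicator (fun z => defect M (u z)) =
      K.indicator fun z => defect M (if z ∈ Ω then u z else ⊤) := by
    ext z
    by_cases hz : z ∈ K
    · rw [indicator_of_mem hz, indicator_of_mem hz, if_pos (hsub hz)]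
    · rw [indicator_of_notMem hz, indicator_of_notMem hz]
  rw [h2]
  exact ((continuous_defect M).measurable.comp husc.measurable).indicator hK

theorem IsSubharmonicOn.isSupermean {u : ℂ → EReal} {Ω K : Set ℂ}
    (hu : IsSubharmonicOn u Ω) (hΩ : IsOpen Ω) (hK : IsCompact K) (hsub : K ⊆ Ω) {M : ℝ}
    (hM : 0 ≤ M) (hle : ∀ z ∈ K, u z ≤ M) :
    IsSupermean (K.indicator fun z => defect M (u z)) K := by
  refine ⟨hu.measurable_indicator_defect hΩ hK.measurableSet hsub M, fun z r hr hb => ?_⟩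
  rw [indicator_of_mem (hb (Metric.mem_closedBall_self hr.le))]
  refine le_trans (lintegral_mono fun t => ?_)
    (hu.lintegral_circle_defect_le hr hM (hb.trans hsub) fun w hw => hle w (hb hw))
  exact indicator_le_self _ _ _

theorem lintegral_indicator_closedBall_norm (R : ℝ) :
    ∫⁻ w : ℂ, (Iic R).indicator (fun _ => (1 : ENNReal)) ‖w‖ =
      volume (Metric.closedBall (0 : ℂ) R) := by
  rw [← lintegral_indicator_one Metric.isClosed_closedBall.measurableSet]
  refine lintegral_congr fun w => ?_
  by_cases h : ‖w‖ ≤ R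
  · rw [indicator_of_mem (mem_Iic.2 h), indicator_of_mem (mem_closedBall_zero_iff.2 h),
      Pi.one_apply]
  · rw [indicator_of_notMem (by simpa using h), indicator_of_notMem (by simpa using h)]

theorem IsSubharmonicOn.setLIntegral_closedBall_lt_top {u : ℂ → EReal} {Ω : Set ℂ}
    (hu : IsSubharmonicOn u Ω) (hΩ : IsOpen Ω) {z : ℂ} {r : ℝ}
    (hsub : Metric.closedBall z r ⊆ Ω) (hz : u z ≠ ⊥) (hzΩ : z ∈ Ω) (hr : 0 < r) :
    ∫⁻ w in Metric.closedBall z r, (-u w).toENNReal < ⊤ := by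
  have hK := isCompact_closedBall z r
  obtain ⟨M, hM, hle⟩ := hu.exists_le_of_isCompact hK hsub
  have hsm := hu.isSupermean hΩ hK hsub hM hle
  have h1 := hsm.lintegral_radial_le (k := (Iic r).indicator fun _ => 1)
    (measurable_const.indicator measurableSet_Iic) (R := r)
    (fun s hs => indicator_of_notMem (by simpa using hs) _) Subset.rfl
  rw [lintegral_indicator_closedBall_norm] at h1
  refine lt_of_le_of_lt ?_ (h1.trans_lt (ENNReal.mul_lt_top measure_closedBall_lt_top ?_))
  · rw [← lintegral_indicator hK.measurableSet]
    refine lintegral_mono fun w => ?_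
    by_cases hw : w ∈ Metric.closedBall z r
    · have hw' : ‖z - w‖ ∈ Iic r := by
        rw [← dist_eq_norm, dist_comm]; exact hw
      rw [indicator_of_mem hw, indicator_of_mem hw', indicator_of_mem hw, one_mul]
      exact toENNReal_neg_le_defect hM _
    · rw [indicator_of_notMem hw]; exact zero_le
  · rw [indicator_of_mem (Metric.mem_closedBall_self hr.le), lt_top_iff_ne_top, defect, Ne,
      EReal.toENNReal_eq_top_iff]
    obtain ⟨a, ha⟩ : ∃ a : ℝ, u z = a :=
      ⟨(u z).toReal, (EReal.coe_toReal (hu.ne_top z hzΩ) hz).symm⟩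
    rw [ha, ← EReal.coe_sub]
    exact EReal.coe_ne_top _

/-- Connectedness: the points near which `u⁻` is integrable form an open set that meets `Ω`. It is
also relatively closed: near a limit point there is some `w` with `u w ≠ -∞`, since otherwise `u⁻`
would be infinite on a ball where it is integrable, and a disc centred at `w` covers a neighbourhood
of the limit point. -/
theorem IsSubharmonicOn.exists_setLIntegral_closedBall_lt_top {u : ℂ → EReal} {Ω : Set ℂ}
    (hu : IsSubharmonicOn u Ω) (hΩ : IsOpen Ω) (hΩc : IsPreconnected Ω) {z : ℂ} (hz : z ∈ Ω) :
    ∃ r > 0, ∫⁻ w in Metric.closedBall z r, (-u w).toENNReal < ⊤ := by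
  set G : Set ℂ := {z | ∃ r > 0, ∫⁻ w in Metric.closedBall z r, (-u w).toENNReal < ⊤}
  have hGopen : IsOpen G := by
    rw [Metric.isOpen_iff]
    rintro x ⟨r, hr, hx⟩
    refine ⟨r / 2, by positivity, fun y hy => ⟨r / 2, by positivity, ?_⟩⟩
    refine lt_of_le_of_lt (lintegral_mono_set (Metric.closedBall_subset_closedBall' ?_)) hx
    rw [Metric.mem_ball] at hy
    linarith
  suffices Ω ⊆ G from this hz
  refine hΩc.subset_of_closure_inter_subset hGopen ?_ ?_
  · obtain ⟨w, hw, hwb⟩ := hu.exists_ne_bot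
    obtain ⟨r, hr, hb⟩ := Metric.nhds_basis_closedBall.mem_iff.1 (hΩ.mem_nhds hw)
    exact ⟨w, hw, r, hr, hu.setLIntegral_closedBall_lt_top hΩ hb hwb hw hr⟩
  · rintro x ⟨hxG, hxΩ⟩
    obtain ⟨r, hr, hb⟩ := Metric.nhds_basis_closedBall.mem_iff.1 (hΩ.mem_nhds hxΩ)
    obtain ⟨y, ⟨s, hs, hy⟩, hxy⟩ := Metric.mem_closure_iff.1 hxG (r / 4) (by positivity)
    have hmin : 0 < min s (r / 4) := lt_min hs (by positivity)
    obtain ⟨w, hw, hwb⟩ : ∃ w ∈ Metric.closedBall y (min s (r / 4)), u w ≠ ⊥ := by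
      by_contra! hcon
      have h1 : ∫⁻ w in Metric.closedBall y (min s (r / 4)), (-u w).toENNReal =
          ∫⁻ w in Metric.closedBall y (min s (r / 4)), ⊤ :=
        setLIntegral_congr_fun Metric.isClosed_closedBall.measurableSet fun w hw => by
          simp only [hcon w hw, EReal.neg_bot, EReal.toENNReal_top]
      have h2 := lt_of_le_of_lt (lintegral_mono_set (Metric.closedBall_subset_closedBall
        (min_le_left s (r / 4)))) hy
      rw [h1, lintegral_const, Measure.restrict_apply_univ, ENNReal.top_mul] at h2
      · exact lt_irrefl _ h2
      · exact (Metric.measure_closedBall_pos volume y hmin).ne'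
    have hwx : dist w x ≤ r / 2 := by
      have h1 : dist w y ≤ r / 4 := (Metric.mem_closedBall.1 hw).trans (min_le_right _ _)
      have h2 := dist_triangle w y x
      rw [dist_comm y x] at h2
      linarith
    have hwr : Metric.closedBall w (r / 2) ⊆ Ω :=
      (Metric.closedBall_subset_closedBall' (by linarith)).trans hb
    have h3 := hu.setLIntegral_closedBall_lt_top hΩ hwr hwb
      (hwr (Metric.mem_closedBall_self (by positivity))) (by positivity)
    obtain ⟨ρ, hρ, hρ'⟩ : ∃ ρ > 0, dist x w + ρ ≤ r / 2 := by
      have hlt : dist w x < r / 2 := by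
        have h1 : dist w y ≤ r / 4 := (Metric.mem_closedBall.1 hw).trans (min_le_right _ _)
        have h2 := dist_triangle w y x
        rw [dist_comm y x] at h2
        linarith
      exact ⟨r / 2 - dist w x, by linarith, by rw [dist_comm]; linarith⟩
    exact ⟨ρ, hρ, lt_of_le_of_lt (lintegral_mono_set
      (Metric.closedBall_subset_closedBall' (by linarith))) h3⟩

theorem IsSubharmonicOn.lintegral_indicator_defect_lt_top {u : ℂ → EReal} {Ω K : Set ℂ}
    (hu : IsSubharmonicOn u Ω) (hΩ : IsOpen Ω) (hΩc : IsPreconnected Ω) (hK : IsCompact K)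
    (hsub : K ⊆ Ω) (M : ℝ) :
    ∫⁻ z, K.indicator (fun z => defect M (u z)) z < ⊤ := by
  rw [lintegral_indicator hK.measurableSet]
  have h1 : ∫⁻ z in K, (-u z).toENNReal < ⊤ := by
    refine hK.induction_on (p := fun s => ∫⁻ z in s, (-u z).toENNReal < ⊤) (by simp)
      (fun s t hst ht => (lintegral_mono_set hst).trans_lt ht)
      (fun s t hs ht => (lintegral_union_le _ _ _).trans_lt (ENNReal.add_lt_top.2 ⟨hs, ht⟩)) ?_
    intro z hz
    obtain ⟨r, hr, hr'⟩ := hu.exists_setLIntegral_closedBall_lt_top hΩ hΩc (hsub hz)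
    exact ⟨Metric.closedBall z r, mem_nhdsWithin_of_mem_nhds (Metric.closedBall_mem_nhds z hr), hr'⟩
  calc _ ≤ ∫⁻ z in K, (ENNReal.ofReal M + (-u z).toENNReal) :=
        lintegral_mono fun z => defect_le_add M _
    _ = ENNReal.ofReal M * volume K + ∫⁻ z in K, (-u z).toENNReal := by
        rw [lintegral_add_left measurable_const]
        simp
    _ < ⊤ := ENNReal.add_lt_top.2
        ⟨ENNReal.mul_lt_top ENNReal.ofReal_lt_top hK.measure_lt_top, h1⟩

/-! ### Circular means, and the kernel they produce from the logarithm. -/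

/-- The mean of `F` over the circle of centre `z` and radius `ε`. -/
noncomputable def circAvg (F : ℂ → ℝ) (ε : ℝ) (z : ℂ) : ℝ :=
  ∫ t in Ioc (0 : ℝ) 1, F (z + ε * unitPoint t)

theorem integral_unitPoint : ∫ t in Ioc (0 : ℝ) 1, unitPoint t = 0 := by
  rw [← intervalIntegral.integral_of_le zero_le_one]
  have h0 : (2 * Real.pi * Complex.I : ℂ) ≠ 0 := by simp [Real.pi_ne_zero]
  have := integral_exp_mul_complex (a := 0) (b := 1) h0
  simp only [unitPoint]
  rw [this]
  simp [Complex.exp_two_pi_mul_I]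

/-- The linear term of the Taylor expansion averages to zero on the circle, so a Lipschitz
derivative makes the error quadratic in `ε`. -/
theorem abs_circAvg_sub_le {F : ℂ → ℝ} (hF : ContDiff ℝ 1 F) {L ε : ℝ} (hε : 0 ≤ ε) {z : ℂ}
    (hL0 : 0 ≤ L)
    (hL : ∀ y ∈ Metric.closedBall z ε, ‖fderiv ℝ F y - fderiv ℝ F z‖ ≤ L * ‖y - z‖) :
    |circAvg F ε z - F z| ≤ L * ε ^ 2 := by
  have hu := continuous_unitPoint
  have hc1 : Continuous fun t => F (z + ε * unitPoint t) := hF.continuous.comp (by fun_prop)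
  have hc2 : Continuous fun t => fderiv ℝ F z (ε * unitPoint t) :=
    (fderiv ℝ F z).continuous.comp (by fun_prop)
  have hlin : ∫ t in Ioc (0 : ℝ) 1, fderiv ℝ F z (ε * unitPoint t) = 0 := by
    have h1 : IntegrableOn (fun t : ℝ => (ε : ℂ) * unitPoint t) (Ioc (0 : ℝ) 1) :=
      ((by fun_prop : Continuous fun t : ℝ => (ε : ℂ) * unitPoint t).continuousOn.integrableOn_compact
        isCompact_Icc).mono_set Ioc_subset_Icc_self
    rw [ContinuousLinearMap.integral_comp_comm _ h1, integral_const_mul, integral_unitPoint]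
    simp
  have hint : ∀ {f : ℝ → ℝ}, Continuous f → IntegrableOn f (Ioc (0 : ℝ) 1) := fun hf =>
    (hf.continuousOn.integrableOn_compact isCompact_Icc).mono_set Ioc_subset_Icc_self
  have heq : circAvg F ε z - F z =
      ∫ t in Ioc (0 : ℝ) 1, (F (z + ε * unitPoint t) - F z - fderiv ℝ F z (ε * unitPoint t)) := by
    have hc3 : Continuous fun t => F (z + ε * unitPoint t) - F z := hc1.sub continuous_const
    rw [integral_sub (hint hc3) (hint hc2), hlin,
      integral_sub (hint hc1) (hint continuous_const), circAvg]
    simp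
  rw [heq]
  have := norm_setIntegral_le_of_norm_le_const (μ := (volume : Measure ℝ)) (s := Ioc (0 : ℝ) 1)
    (C := L * ε ^ 2) (f := fun t => F (z + ε * unitPoint t) - F z - fderiv ℝ F z (ε * unitPoint t))
    (by simp) (fun t _ => ?_)
  · simpa using this
  · have hmem : z + ε * unitPoint t ∈ Metric.closedBall z ε := by
      rw [mem_closedBall_iff_norm, add_sub_cancel_left, norm_mul_unitPoint hε]
    have h1 := (convex_closedBall z ε).norm_image_sub_le_of_norm_fderiv_le' (𝕜 := ℝ) (f := F)
      (φ := fderiv ℝ F z) (C := L * ε) (fun y _ => (hF.differentiable one_ne_zero) y)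
      (fun y hy => (hL y hy).trans (mul_le_mul_of_nonneg_left (mem_closedBall_iff_norm.1 hy) hL0))
      (Metric.mem_closedBall_self hε) hmem
    rw [add_sub_cancel_left, norm_mul_unitPoint hε] at h1
    calc _ ≤ L * ε * ε := h1
      _ = _ := by ring

theorem exists_lipschitz_closedBall {E : Type*} [NormedAddCommGroup E] [NormedSpace ℝ E]
    {G : ℂ → E} (hG : ContDiff ℝ 1 G) (B : ℝ) :
    ∃ L : ℝ, 0 ≤ L ∧ ∀ y ∈ Metric.closedBall (0 : ℂ) B, ∀ z ∈ Metric.closedBall (0 : ℂ) B,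
      ‖G y - G z‖ ≤ L * ‖y - z‖ := by
  obtain ⟨L, hL⟩ := (isCompact_closedBall (0 : ℂ) B).exists_bound_of_continuousOn
    (hG.continuous_fderiv one_ne_zero).continuousOn
  refine ⟨max L 0, le_max_right _ _, fun y hy z hz => ?_⟩
  exact (convex_closedBall (0 : ℂ) B).norm_image_sub_le_of_norm_fderiv_le (𝕜 := ℝ)
    (fun w _ => (hG.differentiable one_ne_zero) w)
    (fun w hw => (hL w hw).trans (le_max_left _ _)) hz hy

/-- The difference between circular mean and function, and its Lipschitz constant, are both `O(ε²)`.
They stay bounded after division by `∫ logKernel ε`, which is at least `ε² / 4`. -/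
theorem exists_circAvg_sub_bound {F : ℂ → ℝ} (hF : ContDiff ℝ 3 F) (B : ℝ) :
    ∃ L : ℝ, 0 ≤ L ∧ ∀ ε : ℝ, 0 ≤ ε → ε ≤ 1 → ∀ z ∈ Metric.closedBall (0 : ℂ) B,
      |circAvg F ε z - F z| ≤ L * ε ^ 2 ∧ ∀ w ∈ Metric.closedBall (0 : ℂ) B,
        |(circAvg F ε w - F w) - (circAvg F ε z - F z)| ≤ L * ‖w - z‖ * ε ^ 2 := by
  have hF1 : ContDiff ℝ 1 F := hF.of_le (by norm_num)
  have hF' : ContDiff ℝ 2 (fderiv ℝ F) := hF.fderiv_right (by norm_num)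
  have hF'1 : ContDiff ℝ 1 (fderiv ℝ F) := hF'.of_le (by norm_num)
  have hF'' : ContDiff ℝ 1 (fderiv ℝ (fderiv ℝ F)) := hF'.fderiv_right (by norm_num)
  obtain ⟨L₁, hL₁, h₁⟩ := exists_lipschitz_closedBall hF'1 (B + 1)
  obtain ⟨L₂, hL₂, h₂⟩ := exists_lipschitz_closedBall hF'' (B + 1)
  have hball : ∀ {ε : ℝ}, ε ≤ 1 → ∀ {z : ℂ}, z ∈ Metric.closedBall (0 : ℂ) B →
      Metric.closedBall z ε ⊆ Metric.closedBall (0 : ℂ) (B + 1) := fun hε z hz => by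
    refine Metric.closedBall_subset_closedBall' ?_
    have := Metric.mem_closedBall.1 hz
    linarith
  refine ⟨max L₁ L₂, hL₁.trans (le_max_left _ _), fun ε hε hε1 z hz => ⟨?_, fun w hw => ?_⟩⟩
  · refine abs_circAvg_sub_le hF1 hε (hL₁.trans (le_max_left _ _)) fun y hy => ?_
    refine (h₁ y (hball hε1 hz hy) z (hball hε1 hz (Metric.mem_closedBall_self hε))).trans ?_
    gcongr
    exact le_max_left _ _
  -- The Lipschitz bound is the pointwise bound for `F (· + h) - F`, whose derivative has a
  -- Lipschitz constant proportional to `‖h‖`; this is where three derivatives of `F` are used.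
  · set h := w - z with hh
    have hFh : ContDiff ℝ 1 fun y => F (y + h) - F y :=
      (hF1.comp (contDiff_id.add contDiff_const)).sub hF1
    have hder : ∀ y, fderiv ℝ (fun y => F (y + h) - F y) y = fderiv ℝ F (y + h) - fderiv ℝ F y := by
      intro y
      have hd := hF1.differentiable one_ne_zero
      have hd' : DifferentiableAt ℝ (fun y => F (y + h)) y :=
        (hd (y + h)).comp y (differentiableAt_id.add_const h)
      rw [fderiv_fun_sub hd' (hd y), fderiv_comp_add_right]
    have hder2 : ∀ y, fderiv ℝ (fun y => fderiv ℝ F (y + h) - fderiv ℝ F y) y =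
        fderiv ℝ (fderiv ℝ F) (y + h) - fderiv ℝ (fderiv ℝ F) y := by
      intro y
      have hd := hF'1.differentiable one_ne_zero
      have hd' : DifferentiableAt ℝ (fun y => fderiv ℝ F (y + h)) y :=
        (hd (y + h)).comp y (differentiableAt_id.add_const h)
      rw [fderiv_fun_sub hd' (hd y), fderiv_comp_add_right]
    have hkey := abs_circAvg_sub_le hFh hε (z := z) (L := L₂ * ‖h‖) (by positivity) (fun y hy => by
      rw [hder, hder]
      refine (convex_closedBall z ε).norm_image_sub_le_of_norm_fderiv_le (𝕜 := ℝ)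
        (f := fun y => fderiv ℝ F (y + h) - fderiv ℝ F y) (fun v _ => ?_) (fun v hv => ?_)
        (Metric.mem_closedBall_self hε) hy
      · have hd := hF'1.differentiable one_ne_zero
        exact ((hd (v + h)).comp v (differentiableAt_id.add_const h)).sub (hd v)
      · rw [hder2]
        have hvh : v + h ∈ Metric.closedBall w ε := by
          rw [mem_closedBall_iff_norm] at hv ⊢
          rwa [show v + h - w = v - z by rw [hh]; ring]
        have := h₂ _ (hball hε1 hw hvh) _ (hball hε1 hz hv)
        rwa [add_sub_cancel_left] at this)
    have hsub : circAvg (fun y => F (y + h) - F y) ε z = circAvg F ε w - circAvg F ε z := by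
      have hu := continuous_unitPoint
      have hint : ∀ {f : ℝ → ℝ}, Continuous f → IntegrableOn f (Ioc (0 : ℝ) 1) := fun hf =>
        (hf.continuousOn.integrableOn_compact isCompact_Icc).mono_set Ioc_subset_Icc_self
      have hFc := hF.continuous
      simp only [circAvg]
      rw [integral_sub (hint (by fun_prop)) (hint (by fun_prop))]
      congr 2
      ext t
      congr 1
      rw [hh]; ring
    have hzw : z + h = w := by rw [hh]; ring
    rw [hsub] at hkey
    simp only [hzw] at hkey
    rw [show circAvg F ε w - F w - (circAvg F ε z - F z) =
      circAvg F ε w - circAvg F ε z - (F w - F z) by ring]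
    refine hkey.trans ?_
    gcongr
    exact le_max_right _ _

theorem circAvg_eq_circleAverage (F : ℂ → ℝ) (ε : ℝ) (z : ℂ) :
    circAvg F ε z = Real.circleAverage F z ε := by
  rw [Real.circleAverage_def, circAvg, ← intervalIntegral.integral_of_le zero_le_one]
  have := intervalIntegral.integral_comp_mul_left (a := 0) (b := 1) (fun θ => F (circleMap z ε θ))
    Real.two_pi_pos.ne'
  rw [mul_zero, mul_one] at this
  rw [← this]
  refine intervalIntegral.integral_congr fun t _ => ?_
  simp only [circleMap, unitPoint]
  congr 4
  push_cast
  ring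

/-- Jensen's formula: the mean of `log |w|` over the circle of radius `ε` about `z` is `log (max |z|
ε)`. -/
theorem circAvg_log_sub_log {ε : ℝ} (hε : 0 < ε) {z : ℂ} (hz : z ≠ 0) :
    circAvg (fun w => Real.log ‖w‖) ε z - Real.log ‖z‖ = Real.posLog (ε / ‖z‖) := by
  have h1 := circleAverage_log_norm_sub_const_eq_log_radius_add_posLog (a := 0) (c := z) hε.ne'
  simp only [sub_zero] at h1
  have hz' : 0 < ‖z‖ := norm_pos_iff.2 hz
  rw [circAvg_eq_circleAverage, h1]
  have h2 := Real.posLog_sub_posLog_inv (x := ε⁻¹ * ‖z‖)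
  rw [Real.log_mul (by positivity) hz'.ne', Real.log_inv, mul_inv, inv_inv, ← div_eq_mul_inv] at h2
  linarith

theorem circleIntegrable_log_norm (z : ℂ) (ε : ℝ) :
    IntegrableOn (fun t => Real.log ‖z + ε * unitPoint t‖) (Ioc (0 : ℝ) 1) := by
  have h1 : CircleIntegrable (fun w => Real.log ‖w‖) z ε :=
    MeromorphicOn.circleIntegrable_log_norm (f := fun w => w) (fun _ _ => by fun_prop)
  unfold CircleIntegrable at h1
  have h2 := IntervalIntegrable.comp_mul_left h1 (c := 2 * Real.pi)
  rw [zero_div, div_self Real.two_pi_pos.ne', intervalIntegrable_iff_integrableOn_Ioc_of_le zero_le_one] at h2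
  refine h2.congr_fun (fun t _ => ?_) measurableSet_Ioc
  simp only [circleMap, unitPoint]
  congr 5
  push_cast
  ring

/-- The kernel `log⁺ (ε / |z|)`, the circular mean of the logarithm minus the logarithm. -/
noncomputable def logKernel (ε : ℝ) (z : ℂ) : ℝ := Real.posLog (ε / ‖z‖)

theorem logKernel_nonneg (ε : ℝ) (z : ℂ) : 0 ≤ logKernel ε z := Real.posLog_nonneg

theorem measurable_logKernel (ε : ℝ) : Measurable (logKernel ε) := by
  unfold logKernel Real.posLog
  fun_prop

theorem logKernel_eq_zero {ε : ℝ} (hε : 0 < ε) {z : ℂ} (hz : ε ≤ ‖z‖) : logKernel ε z = 0 := by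
  rw [logKernel, Real.posLog_eq_zero_iff, abs_of_nonneg (by positivity)]
  exact div_le_one_of_le₀ hz (norm_nonneg _)

theorem lintegral_logKernel (ε : ℝ) : ∫⁻ z, ENNReal.ofReal (logKernel ε z) =
    ∫⁻ r in Ioi (0 : ℝ), ENNReal.ofReal (2 * Real.pi * r) * ENNReal.ofReal (Real.posLog (ε / r)) :=
  lintegral_radial (k := fun r => ENNReal.ofReal (Real.posLog (ε / r)))
    (by unfold Real.posLog; fun_prop)

theorem lintegral_logKernel_lt_top {ε : ℝ} (hε : 0 < ε) :
    ∫⁻ z, ENNReal.ofReal (logKernel ε z) < ⊤ := by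
  rw [lintegral_logKernel]
  calc _ ≤ ∫⁻ r in Ioi (0 : ℝ), (Iic ε).indicator (fun _ => ENNReal.ofReal (2 * Real.pi * ε)) r := by
        refine setLIntegral_mono' measurableSet_Ioi fun r hr => ?_
        have hr' : 0 < r := hr
        rcases le_or_gt r ε with h | h
        · rw [indicator_of_mem (mem_Iic.2 h), ← ENNReal.ofReal_mul (by positivity)]
          refine ENNReal.ofReal_le_ofReal ?_
          have h1 : Real.posLog (ε / r) ≤ ε / r := by
            rw [Real.posLog_def]
            have := Real.log_le_sub_one_of_pos (show 0 < ε / r by positivity)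
            exact max_le (by positivity) (by linarith)
          calc 2 * Real.pi * r * Real.posLog (ε / r) ≤ 2 * Real.pi * r * (ε / r) := by gcongr
            _ = 2 * Real.pi * ε := by field_simp
        · have h1 : Real.posLog (ε / r) = 0 := by
            rw [Real.posLog_eq_zero_iff, abs_of_nonneg (by positivity)]
            exact div_le_one_of_le₀ h.le hr'.le
          rw [h1]; simp
    _ = ENNReal.ofReal (2 * Real.pi * ε) * volume (Iic ε ∩ Ioi 0) := by
        rw [lintegral_indicator measurableSet_Iic, lintegral_const, Measure.restrict_restrict
          measurableSet_Iic, Measure.restrict_apply_univ]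
    _ < ⊤ := by
        refine ENNReal.mul_lt_top ENNReal.ofReal_lt_top ?_
        rw [inter_comm, Ioi_inter_Iic]
        simp

theorem integrable_logKernel {ε : ℝ} (hε : 0 < ε) : Integrable (logKernel ε) :=
  ⟨(measurable_logKernel ε).aestronglyMeasurable, by
    rw [hasFiniteIntegral_iff_ofReal (ae_of_all _ (logKernel_nonneg ε))]
    exact lintegral_logKernel_lt_top hε⟩

theorem le_integral_logKernel {ε : ℝ} (hε : 0 < ε) : ε ^ 2 / 4 ≤ ∫ z, logKernel ε z := by
  have h1 : ENNReal.ofReal (ε ^ 2 / 4) ≤ ∫⁻ z, ENNReal.ofReal (logKernel ε z) := by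
    rw [lintegral_logKernel]
    calc ENNReal.ofReal (ε ^ 2 / 4) ≤ ∫⁻ r in Ioc (ε / 4) (ε / 2), ENNReal.ofReal ε := by
          rw [lintegral_const, Measure.restrict_apply_univ, Real.volume_Ioc,
            ← ENNReal.ofReal_mul hε.le]
          exact ENNReal.ofReal_le_ofReal (by nlinarith)
      _ ≤ ∫⁻ r in Ioc (ε / 4) (ε / 2), ENNReal.ofReal (2 * Real.pi * r) *
          ENNReal.ofReal (Real.posLog (ε / r)) := by
          refine setLIntegral_mono' measurableSet_Ioc fun r hr => ?_
          have hr0 : 0 < r := lt_trans (by positivity) hr.1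
          rw [← ENNReal.ofReal_mul (by positivity)]
          refine ENNReal.ofReal_le_ofReal ?_
          have h2 : Real.log 2 ≤ Real.posLog (ε / r) := by
            rw [Real.posLog_def]
            refine le_max_of_le_right (Real.log_le_log (by norm_num) ?_)
            rw [le_div_iff₀ hr0]; linarith [hr.2]
          have h3 := Real.log_two_gt_d9
          have h4 := Real.pi_gt_three
          have h5 := hr.1
          calc ε ≤ 2 * 3 * (ε / 4) * 0.6931471803 := by nlinarith
            _ ≤ 2 * Real.pi * r * Real.posLog (ε / r) := by gcongr; linarith
      _ ≤ _ := lintegral_mono_set fun r hr => lt_trans (by positivity) hr.1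
  rw [← ofReal_integral_eq_lintegral_ofReal (integrable_logKernel hε)
    (ae_of_all _ (logKernel_nonneg ε))] at h1
  exact (ENNReal.ofReal_le_ofReal_iff (integral_nonneg (logKernel_nonneg ε))).1 h1

/-! ### Averages against the kernel are logarithmic potentials with uniform data. -/

/-- The unit interval in the complex plane. -/
def unitSegment : Set ℂ := (fun x : ℝ => (x : ℂ)) '' Icc 0 1

theorem isCompact_unitSegment : IsCompact unitSegment :=
  isCompact_Icc.image Complex.continuous_ofReal

theorem mem_cthickening_unitSegment {x s : ℝ} (hx : x ∈ Icc (0 : ℝ) 1) {ζ : ℂ}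
    (h : ‖(x : ℂ) - ζ‖ ≤ s) : ζ ∈ Metric.cthickening s unitSegment := by
  refine Metric.mem_cthickening_of_dist_le ζ (x : ℂ) s _ (mem_image_of_mem _ hx) ?_
  rwa [dist_comm, dist_eq_norm]

theorem exists_of_mem_cthickening_unitSegment {s : ℝ} (hs : 0 ≤ s) {ζ : ℂ}
    (h : ζ ∈ Metric.cthickening s unitSegment) : ∃ x ∈ Icc (0 : ℝ) 1, ‖(x : ℂ) - ζ‖ ≤ s := by
  rw [isCompact_unitSegment.cthickening_eq_biUnion_closedBall hs] at h
  simp only [mem_iUnion] at h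
  obtain ⟨_, ⟨x, hx, rfl⟩, h⟩ := h
  exact ⟨x, hx, by rwa [Metric.mem_closedBall, dist_comm, dist_eq_norm] at h⟩

theorem norm_le_of_mem_cthickening {s : ℝ} (hs : 0 ≤ s) {ζ : ℂ}
    (h : ζ ∈ Metric.cthickening s unitSegment) : ‖ζ‖ ≤ 1 + s := by
  obtain ⟨x, hx, hxζ⟩ := exists_of_mem_cthickening_unitSegment hs h
  have h1 : ‖ζ‖ ≤ ‖(x : ℂ)‖ + ‖(x : ℂ) - ζ‖ := by
    have := norm_sub_le (x : ℂ) ((x : ℂ) - ζ)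
    rwa [sub_sub_cancel] at this
  rw [Complex.norm_real, Real.norm_of_nonneg hx.1] at h1
  linarith [hx.2]

/-- Cutting the logarithm with a bump equal to one near the origin puts the singularity into a
compactly supported `E` and leaves a smooth `Q`. Terms with `Q` will be absorbed into the Lipschitz
part. -/
theorem exists_log_decomposition {R : ℝ} (hR : 0 < R) : ∃ E Q : ℂ → ℝ, ContDiff ℝ 3 Q ∧
    Measurable E ∧ Integrable E ∧ (∀ z, 2 * R ≤ ‖z‖ → E z = 0) ∧
    ∀ z, Real.log ‖z‖ = E z - Q z := by
  let χ : ContDiffBump (0 : ℂ) := ⟨R, 2 * R, hR, by linarith⟩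
  have hEm : Measurable fun z : ℂ => χ z * Real.log ‖z‖ :=
    χ.continuous.measurable.mul (Real.measurable_log.comp measurable_norm)
  refine ⟨fun z => χ z * Real.log ‖z‖, fun z => (χ z - 1) * Real.log ‖z‖, ?_, hEm, ?_, ?_, ?_⟩
  · rw [contDiff_iff_contDiffAt]
    intro z
    by_cases hz : z = 0
    · subst hz
      have h1 : (fun z => (χ z - 1) * Real.log ‖z‖) =ᶠ[nhds 0] fun _ => (0 : ℝ) := by
        filter_upwards [χ.eventuallyEq_one] with w hw
        rw [hw]; simp
      exact contDiffAt_const.congr_of_eventuallyEq h1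
    · have h1 : ContDiffAt ℝ 3 (fun z : ℂ => ‖z‖) z := contDiffAt_norm ℝ hz
      exact (χ.contDiffAt.sub contDiffAt_const).mul (h1.log (norm_ne_zero_iff.2 hz))
  · have h1 : ∀ z : ℂ, χ z * Real.log ‖z‖ = χ z * Real.posLog ‖z‖ - χ z * logKernel 1 z := by
      intro z
      rw [← Real.posLog_sub_posLog_inv, logKernel, one_div]
      ring
    simp only [h1]
    refine Integrable.sub ?_ ?_
    · exact Continuous.integrable_of_hasCompactSupport
        (χ.continuous.mul (Real.continuous_posLog.comp continuous_norm))
        (χ.hasCompactSupport.mul_right)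
    · exact (integrable_logKernel one_pos).bdd_mul (c := 1) χ.continuous.aestronglyMeasurable
        (ae_of_all _ fun z => by
          rw [Real.norm_of_nonneg χ.nonneg]; exact χ.le_one)
  · intro z hz
    have : χ z = 0 := χ.zero_of_le_dist (by simpa using hz)
    simp only [this, zero_mul]
  · intro z
    ring

theorem exists_cutoff {R : ℝ} (hR : 0 < R) : ∃ ψ : ℂ → ℝ, ContDiff ℝ 3 ψ ∧ (∀ z, 0 ≤ ψ z) ∧
    (∀ z ∈ Metric.cthickening (2 * R) unitSegment, ψ z = 1) ∧
    (∀ z, z ∉ Metric.cthickening (3 * R) unitSegment → ψ z = 0) ∧ Integrable ψ := by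
  have hd : Disjoint (Metric.thickening (3 * R) unitSegment)ᶜ
      (Metric.cthickening (2 * R) unitSegment) := by
    rw [disjoint_compl_left_iff_subset]
    exact Metric.cthickening_subset_thickening' (by linarith) (by linarith) _
  obtain ⟨f, hf0, hf1, hf⟩ := exists_contMDiffMap_zero_one_of_isClosed (n := 3)
    (modelWithCornersSelf ℝ ℂ) (Metric.isOpen_thickening.isClosed_compl)
    (Metric.isClosed_cthickening) hd
  have hz : ∀ z, z ∉ Metric.cthickening (3 * R) unitSegment → f z = 0 := fun z hz =>
    hf0 fun hz' => hz (Metric.thickening_subset_cthickening _ _ hz')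
  have hsm : ContDiff ℝ 3 f := f.contMDiff.contDiff
  refine ⟨f, hsm, fun z => (hf z).1, fun z hz => hf1 hz, hz, ?_⟩
  exact hsm.continuous.integrable_of_hasCompactSupport
    (HasCompactSupport.of_support_subset_isCompact isCompact_unitSegment.cthickening
      fun z hz' => by_contra fun h => hz' (hz z h))

theorem continuous_circAvg {F : ℂ → ℝ} (hF : Continuous F) (ε : ℝ) :
    Continuous (circAvg F ε) := by
  have hu := continuous_unitPoint
  have : circAvg F ε = fun z => ∫ t in (0 : ℝ)..1, F (z + ε * unitPoint t) := by
    ext z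
    rw [intervalIntegral.integral_of_le zero_le_one, circAvg]
  rw [this]
  exact intervalIntegral.continuous_parametric_intervalIntegral_of_continuous' (by fun_prop) _ _

/-- Averaging over circles can be moved from one factor of a convolution to the other; translate by
`ε * unitPoint t` and use Fubini. -/
theorem integral_mul_circAvg {v F : ℂ → ℝ} (hv : Measurable v) {C : ℝ} (hC : ∀ z, |v z| ≤ C)
    (hFm : Measurable F) (hF : Integrable F) (ε : ℝ) (x : ℂ) :
    Integrable (fun ζ => v ζ * circAvg F ε (x - ζ)) ∧
    Integrable (fun ζ => circAvg v ε ζ * F (x - ζ)) ∧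
    ∫ ζ, v ζ * circAvg F ε (x - ζ) = ∫ ζ, circAvg v ε ζ * F (x - ζ) := by
  have hu := continuous_unitPoint
  set ν := volume.restrict (Ioc (0 : ℝ) 1)
  have hFx : ∀ t, Integrable fun ζ : ℂ => F (x - ζ + ε * unitPoint t) := fun t => by
    have := hF.comp_sub_left (x + ε * unitPoint t)
    refine this.congr (ae_of_all _ fun ζ => ?_)
    ring_nf
  have hm1 : Measurable fun p : ℂ × ℝ => v p.1 * F (x - p.1 + ε * unitPoint p.2) :=
    (hv.comp measurable_fst).mul (hFm.comp (by fun_prop))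
  have hm2 : Measurable fun p : ℂ × ℝ => v (p.1 + ε * unitPoint p.2) * F (x - p.1) :=
    (hv.comp (by fun_prop)).mul (hFm.comp (by fun_prop))
  have hF0 : Integrable (fun p : ℂ × ℝ => F (x - p.1 + ε * unitPoint p.2)) (volume.prod ν) := by
    have hm : Measurable fun p : ℂ × ℝ => F (x - p.1 + ε * unitPoint p.2) := hFm.comp (by fun_prop)
    rw [integrable_prod_iff' hm.aestronglyMeasurable]
    refine ⟨ae_of_all _ hFx, ?_⟩
    have h1 : ∀ t : ℝ, ∫ ζ : ℂ, ‖F (x - ζ + ε * unitPoint t)‖ = ∫ z, ‖F z‖ := fun t => by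
      rw [← integral_sub_left_eq_self (fun z => ‖F z‖) volume (x + ε * unitPoint t)]
      refine integral_congr_ae (ae_of_all _ fun ζ => ?_)
      simp only
      ring_nf
    simp only [h1]
    exact integrable_const _
  have hi1 : Integrable (fun p : ℂ × ℝ => v p.1 * F (x - p.1 + ε * unitPoint p.2))
      (volume.prod ν) :=
    hF0.bdd_mul (c := C) (hv.comp measurable_fst).aestronglyMeasurable (ae_of_all _ fun p => hC _)
  have hi2 : Integrable (fun p : ℂ × ℝ => v (p.1 + ε * unitPoint p.2) * F (x - p.1))
      (volume.prod ν) := by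
    have h1 : Integrable (fun p : ℂ × ℝ => F (x - p.1)) (volume.prod ν) :=
      (hF.comp_sub_left x).comp_fst ν
    exact h1.bdd_mul (c := C) (hv.comp (by fun_prop)).aestronglyMeasurable (ae_of_all _ fun p => hC _)
  have e1 : (fun ζ => v ζ * circAvg F ε (x - ζ)) =
      fun ζ => ∫ t, v ζ * F (x - ζ + ε * unitPoint t) ∂ν := by
    ext ζ
    rw [integral_const_mul, circAvg]
  have e2 : (fun ζ => circAvg v ε ζ * F (x - ζ)) =
      fun ζ => ∫ t, v (ζ + ε * unitPoint t) * F (x - ζ) ∂ν := by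
    ext ζ
    rw [integral_mul_const, circAvg]
  refine ⟨e1 ▸ hi1.integral_prod_left, e2 ▸ hi2.integral_prod_left, ?_⟩
  rw [e1, e2]
  refine (integral_integral_swap hi1).trans (Eq.trans ?_ (integral_integral_swap hi2).symm)
  refine integral_congr_ae (ae_of_all _ fun t => ?_)
  simp only
  rw [← integral_add_right_eq_self (fun ζ => v ζ * F (x - ζ + ε * unitPoint t)) (ε * unitPoint t)]
  refine integral_congr_ae (ae_of_all _ fun ζ => ?_)
  simp only
  congr 2
  ring

/-- Away from the origin `logKernel ε` is the circular mean of `log |·|` minus `log |·|`. Split the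
logarithm as `E - Q`, move the difference operator from `E` onto `v`, and leave it on the smooth
`Q`. -/
theorem integral_mul_logKernel {v E Q : ℂ → ℝ} (hv : Continuous v) (hvc : HasCompactSupport v)
    (hQ : Continuous Q) (hEm : Measurable E) (hE : Integrable E)
    (hlog : ∀ z, Real.log ‖z‖ = E z - Q z) {ε : ℝ} (hε : 0 < ε) (x : ℂ) :
    ∫ ζ, v ζ * logKernel ε (x - ζ) = (∫ ζ, (circAvg v ε ζ - v ζ) * E (x - ζ)) -
      ∫ ζ, v ζ * (circAvg Q ε (x - ζ) - Q (x - ζ)) := by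
  have hu := continuous_unitPoint
  obtain ⟨C, hC⟩ := hv.bounded_above_of_compact_support hvc
  obtain ⟨h1, h2, h3⟩ := integral_mul_circAvg hv.measurable hC hEm hE ε x
  have h4 : Integrable fun ζ => v ζ * E (x - ζ) :=
    (hE.comp_sub_left x).bdd_mul hv.aestronglyMeasurable (ae_of_all _ hC)
  have hcQ := continuous_circAvg hQ ε
  have h5 : Integrable fun ζ => v ζ * (circAvg Q ε (x - ζ) - Q (x - ζ)) :=
    Continuous.integrable_of_hasCompactSupport (by fun_prop) hvc.mul_right
  have hkey : ∀ z : ℂ, z ≠ 0 → logKernel ε z = (circAvg E ε z - E z) - (circAvg Q ε z - Q z) := by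
    intro z hz
    rw [logKernel, ← circAvg_log_sub_log hε hz, hlog]
    have hiQ : IntegrableOn (fun t => Q (z + ε * unitPoint t)) (Ioc (0 : ℝ) 1) :=
      ((by fun_prop : Continuous fun t => Q (z + ε * unitPoint t)).continuousOn.integrableOn_compact
        isCompact_Icc).mono_set Ioc_subset_Icc_self
    have hiE : IntegrableOn (fun t => E (z + ε * unitPoint t)) (Ioc (0 : ℝ) 1) := by
      refine ((circleIntegrable_log_norm z ε).add hiQ).congr (ae_of_all _ fun t => ?_)
      simp only [Pi.add_apply, hlog, sub_add_cancel]
    have : circAvg (fun w => Real.log ‖w‖) ε z = circAvg E ε z - circAvg Q ε z := by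
      simp only [circAvg]
      rw [← integral_sub hiE hiQ]
      simp only [hlog]
    rw [this]; ring
  have h6 : ∫ ζ, v ζ * logKernel ε (x - ζ) =
      ∫ ζ, ((v ζ * circAvg E ε (x - ζ) - v ζ * E (x - ζ)) -
        v ζ * (circAvg Q ε (x - ζ) - Q (x - ζ))) := by
    refine integral_congr_ae ?_
    filter_upwards [measure_eq_zero_iff_ae_notMem.1 (measure_singleton (μ := (volume : Measure ℂ)) x)]
      with ζ hζ
    rw [hkey _ (sub_ne_zero.2 fun h => hζ h.symm)]
    ring
  have h14 : Integrable fun ζ => v ζ * circAvg E ε (x - ζ) - v ζ * E (x - ζ) := h1.sub h4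
  rw [h6, integral_sub h14 h5, integral_sub h1 h4, h3, ← integral_sub h2 h4]
  simp only [sub_mul]

theorem abs_integral_mul_le {X : Type*} [MeasurableSpace X] {μ : Measure X} {w g : X → ℝ} {C : ℝ}
    (hw : Integrable w μ) (h0 : ∀ᵐ x ∂μ, 0 ≤ w x) (h : ∀ᵐ x ∂μ, w x ≠ 0 → |g x| ≤ C) :
    |∫ x, w x * g x ∂μ| ≤ (∫ x, w x ∂μ) * C := by
  rw [← integral_mul_const, ← Real.norm_eq_abs]
  refine norm_integral_le_of_norm_le (hw.mul_const C) ?_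
  filter_upwards [h0, h] with x h0 hx
  rw [norm_mul, Real.norm_of_nonneg h0, Real.norm_eq_abs]
  by_cases hwx : w x = 0
  · simp [hwx]
  · exact mul_le_mul_of_nonneg_left (hx hwx) h0

/-- The density of the measure is `ρ = (v - circAvg v ε) / ∫ logKernel ε` on the `2 R`-neighbourhood
of the segment, nonnegative by the super-mean hypothesis. The essential point is that `A` is chosen
before `ε` and `v`: only the total integral of `v` enters, and every factor `ε²` cancels against the
normalisation. -/
theorem exists_isLogPotential {R : ℝ} (hR : 0 < R) (B V : ℝ) : ∃ A : ℝ, 0 < A ∧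
    ∀ (ε : ℝ) (v : ℂ → ℝ), 0 < ε → ε ≤ 1 → Continuous v → (∀ z, 0 ≤ v z) →
      (∀ z, B < ‖z‖ → v z = 0) → ∫ z, v z ≤ V →
      (∀ ζ ∈ Metric.cthickening (3 * R) unitSegment, circAvg v ε ζ ≤ v ζ) →
      IsLogPotential A fun x => (∫ ζ, v ζ * logKernel ε (x - ζ)) / ∫ ζ, logKernel ε ζ := by
  obtain ⟨E, Q, hQ, hEm, hE, hE0, hlog⟩ := exists_log_decomposition hR
  obtain ⟨ψ, hψ, hψ0, hψ1, hψz, hψi⟩ := exists_cutoff hR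
  have hψn : ContDiff ℝ 3 fun z => ψ (-z) := hψ.comp contDiff_neg
  obtain ⟨L₁, hL₁, h₁⟩ := exists_circAvg_sub_bound hψn B
  obtain ⟨L₂, hL₂, h₂⟩ := exists_circAvg_sub_bound hQ (B + 1)
  obtain ⟨L₃, hL₃, h₃⟩ := exists_lipschitz_closedBall (hQ.of_le (by norm_num)) (2 + 2 * R)
  obtain ⟨L₄, h₄⟩ := (isCompact_closedBall (0 : ℂ) (2 + 2 * R)).exists_bound_of_continuousOn
    hQ.continuous.continuousOn
  have hL₄ : 0 ≤ L₄ := (norm_nonneg _).trans (h₄ 0 (by simp; linarith))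
  set W := max V 0
  have hW : 0 ≤ W := le_max_right _ _
  set m := 4 * L₁ * W
  have hm : 0 ≤ m := by positivity
  -- The summands cover the mass `m`, the radius `1 + 2 R` of the support, the Lipschitz constant `m
  -- L₃ + 4 L₂ W` of `H` and its bound `m L₄ + 4 L₂ W`.
  refine ⟨m + (1 + 2 * R) + m * L₃ + 4 * L₂ * W + m * L₄, by positivity,
    fun ε v hε hε1 hv hv0 hvB hvV hsup => ?_⟩
  have hu := continuous_unitPoint
  set N := ∫ ζ, logKernel ε ζ
  have hN : ε ^ 2 / 4 ≤ N := le_integral_logKernel hε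
  have hN0 : 0 < N := lt_of_lt_of_le (by positivity) hN
  have hεN : ε ^ 2 / N ≤ 4 := by
    rw [div_le_iff₀ hN0]; linarith
  have hvc : HasCompactSupport v := HasCompactSupport.of_support_subset_isCompact
    (isCompact_closedBall (0 : ℂ) B) fun z hz => by
      rw [mem_closedBall_zero_iff]
      by_contra h
      exact hz (hvB z (not_le.1 h))
  have hvi : Integrable v := hv.integrable_of_hasCompactSupport hvc
  have hvB' : ∀ z, v z ≠ 0 → ‖z‖ ≤ B := fun z hz => by
    by_contra h
    exact hz (hvB z (not_le.1 h))
  have hVW : ∫ z, v z ≤ W := hvV.trans (le_max_left _ _)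
  obtain ⟨C, hC⟩ := hv.bounded_above_of_compact_support hvc
  have hav := continuous_circAvg hv ε
  set ρ : ℂ → ℝ := fun ζ => (v ζ - circAvg v ε ζ) / N
  have hρ : Continuous ρ := by fun_prop
  have hρ0 : ∀ ζ ∈ Metric.cthickening (3 * R) unitSegment, 0 ≤ ρ ζ := fun ζ hζ =>
    div_nonneg (sub_nonneg.2 (hsup ζ hζ)) hN0.le
  set K := Metric.cthickening (2 * R) unitSegment
  have hK : IsCompact K := isCompact_unitSegment.cthickening
  have hKm : MeasurableSet K := hK.measurableSet
  have hK3 : K ⊆ Metric.cthickening (3 * R) unitSegment :=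
    Metric.cthickening_mono (by linarith) _
  have hρK : ∀ ζ ∈ K, 0 ≤ ρ ζ := fun ζ hζ => hρ0 ζ (hK3 hζ)
  have hKn : ∀ ζ ∈ K, ‖ζ‖ ≤ 1 + 2 * R := fun ζ hζ => norm_le_of_mem_cthickening (by linarith) hζ
  have hρi : IntegrableOn ρ K := hρ.continuousOn.integrableOn_compact hK
  have haeK : ∀ᵐ ζ ∂volume.restrict K, ζ ∈ K := ae_restrict_mem hKm
  -- the total mass
  have hmass : ∫ ζ in K, ρ ζ ≤ m := by
    -- Testing `ρ` against the cutoff and moving the difference operator onto it gives `O(ε²) ∫ v /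
    -- ∫ logKernel ε`. The reflection `ψ (-z)` fits this into convolution form at the point `0`.
    obtain ⟨i1, i2, i3⟩ := integral_mul_circAvg hv.measurable hC hψn.continuous.measurable
      (hψi.comp_neg) ε 0
    simp only [zero_sub, neg_neg] at i1 i2 i3
    have i4 : Integrable fun ζ => v ζ * ψ ζ :=
      hψi.bdd_mul hv.aestronglyMeasurable (ae_of_all _ hC)
    have i5 : Integrable fun ζ => ρ ζ * ψ ζ := by
      refine ((i4.sub i2).div_const N).congr (ae_of_all _ fun ζ => ?_)
      simp only [Pi.sub_apply, ρ]
      ring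
    have e1 : ∫ ζ, ρ ζ * ψ ζ = (∫ ζ, v ζ * -(circAvg (fun z => ψ (-z)) ε (-ζ) - ψ ζ)) / N := by
      have : ∀ ζ, v ζ * -(circAvg (fun z => ψ (-z)) ε (-ζ) - ψ ζ) =
          v ζ * ψ ζ - v ζ * circAvg (fun z => ψ (-z)) ε (-ζ) := fun ζ => by ring
      simp only [this]
      rw [integral_sub i4 i1, i3, ← integral_sub i4 i2, ← integral_div]
      refine integral_congr_ae (ae_of_all _ fun ζ => ?_)
      simp only [ρ]
      ring
    have e2 : ∫ ζ in K, ρ ζ ≤ ∫ ζ, ρ ζ * ψ ζ := by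
      rw [← integral_indicator hKm]
      refine integral_mono_ae (hρi.integrable_indicator hKm) i5 (ae_of_all _ fun ζ => ?_)
      by_cases hζ : ζ ∈ K
      · simp only [indicator_of_mem hζ, hψ1 ζ hζ, mul_one, le_refl]
      · simp only [indicator_of_notMem hζ]
        by_cases hζ' : ζ ∈ Metric.cthickening (3 * R) unitSegment
        · exact mul_nonneg (hρ0 ζ hζ') (hψ0 ζ)
        · rw [hψz ζ hζ', mul_zero]
    have e3 := abs_integral_mul_le (C := L₁ * ε ^ 2) (g := fun ζ =>
        -(circAvg (fun z => ψ (-z)) ε (-ζ) - ψ ζ)) hvi (ae_of_all _ hv0)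
      (ae_of_all _ fun ζ hζ => by
        have := (h₁ ε hε.le hε1 (-ζ) (by simpa using hvB' ζ hζ)).1
        rw [neg_neg] at this
        simp only [abs_neg]
        exact this)
    calc ∫ ζ in K, ρ ζ ≤ (W * (L₁ * ε ^ 2)) / N := by
          refine e2.trans (e1 ▸ ?_)
          gcongr
          exact (le_abs_self _).trans (e3.trans (by gcongr))
      _ = W * L₁ * (ε ^ 2 / N) := by ring
      _ ≤ W * L₁ * 4 := by gcongr
      _ = m := by ring
  set μ := (volume.restrict K).withDensity fun ζ => ENNReal.ofReal (ρ ζ)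
  have hdm : Measurable fun ζ => ENNReal.ofReal (ρ ζ) := hρ.measurable.ennreal_ofReal
  -- Composing with the projection onto `[0, 1]` makes `H` Lipschitz on all of `ℝ`, although the
  -- estimates hold only on the segment.
  set pr : ℝ → ℝ := fun x => (projIcc (0 : ℝ) 1 zero_le_one x : ℝ)
  have hpr : ∀ x, pr x ∈ Icc (0 : ℝ) 1 := fun x => (projIcc (0 : ℝ) 1 zero_le_one x).2
  have hprl : ∀ x y, |pr x - pr y| ≤ |x - y| := fun x y => abs_projIcc_sub_projIcc zero_le_one
  have hn1 : ∀ x : ℝ, x ∈ Icc (0 : ℝ) 1 → ‖(x : ℂ)‖ ≤ 1 := fun x hx => by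
    rw [Complex.norm_real, Real.norm_of_nonneg hx.1]; exact hx.2
  set S : ℝ → ℝ := fun x => (∫ ζ, v ζ * (circAvg Q ε (x - ζ) - Q (x - ζ))) / N
  set G : ℝ → ℝ := fun x => ∫ ζ in K, ρ ζ * Q (x - ζ)
  have hQc := hQ.continuous
  have haQ := continuous_circAvg hQc ε
  have hGi : ∀ x : ℝ, IntegrableOn (fun ζ => ρ ζ * Q (x - ζ)) K := fun x =>
    (by fun_prop : Continuous fun ζ => ρ ζ * Q (x - ζ)).continuousOn.integrableOn_compact hK
  have hSi : ∀ x : ℝ, Integrable fun ζ => v ζ * (circAvg Q ε (x - ζ) - Q (x - ζ)) := fun x =>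
    Continuous.integrable_of_hasCompactSupport (by fun_prop) hvc.mul_right
  have hballK : ∀ x ∈ Icc (0 : ℝ) 1, ∀ ζ ∈ K, (x : ℂ) - ζ ∈ Metric.closedBall (0 : ℂ) (2 + 2 * R) :=
    fun x hx ζ hζ => by
      rw [mem_closedBall_zero_iff]
      linarith [norm_sub_le (x : ℂ) ζ, hn1 x hx, hKn ζ hζ]
  have hballB : ∀ x ∈ Icc (0 : ℝ) 1, ∀ ζ, v ζ ≠ 0 → (x : ℂ) - ζ ∈ Metric.closedBall (0 : ℂ) (B + 1) :=
    fun x hx ζ hζ => by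
      rw [mem_closedBall_zero_iff]
      linarith [norm_sub_le (x : ℂ) ζ, hn1 x hx, hvB' ζ hζ]
  have hGb : ∀ x ∈ Icc (0 : ℝ) 1, |G x| ≤ m * L₄ := fun x hx => by
    refine (abs_integral_mul_le hρi (haeK.mono hρK) (haeK.mono fun ζ hζ _ =>
      h₄ _ (hballK x hx ζ hζ))).trans ?_
    gcongr
  have hSb : ∀ x ∈ Icc (0 : ℝ) 1, |S x| ≤ 4 * L₂ * W := fun x hx => by
    have := abs_integral_mul_le (C := L₂ * ε ^ 2) hvi (ae_of_all _ hv0) (ae_of_all _ fun ζ hζ =>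
      (h₂ ε hε.le hε1 _ (hballB x hx ζ hζ)).1)
    calc |S x| ≤ (W * (L₂ * ε ^ 2)) / N := by
          simp only [S]
          rw [abs_div, abs_of_pos hN0]
          gcongr
          exact this.trans (by gcongr)
      _ = W * L₂ * (ε ^ 2 / N) := by ring
      _ ≤ W * L₂ * 4 := by gcongr
      _ = 4 * L₂ * W := by ring
  have hGl : ∀ x ∈ Icc (0 : ℝ) 1, ∀ y ∈ Icc (0 : ℝ) 1, |G x - G y| ≤ m * L₃ * |x - y| :=
    fun x hx y hy => by
      have e : G x - G y = ∫ ζ in K, ρ ζ * (Q (x - ζ) - Q (y - ζ)) := by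
        simp only [G]
        rw [← integral_sub (hGi x) (hGi y)]
        simp only [mul_sub]
      rw [e]
      refine (abs_integral_mul_le (C := L₃ * |x - y|) hρi (haeK.mono hρK)
        (haeK.mono fun ζ hζ _ => ?_)).trans ?_
      · have := h₃ _ (hballK x hx ζ hζ) _ (hballK y hy ζ hζ)
        rwa [sub_sub_sub_cancel_right, ← Complex.ofReal_sub, Complex.norm_real, Real.norm_eq_abs,
          Real.norm_eq_abs] at this
      · rw [← mul_assoc]
        gcongr
  have hSl : ∀ x ∈ Icc (0 : ℝ) 1, ∀ y ∈ Icc (0 : ℝ) 1, |S x - S y| ≤ 4 * L₂ * W * |x - y| :=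
    fun x hx y hy => by
      have e : S x - S y = (∫ ζ, v ζ * ((circAvg Q ε (x - ζ) - Q (x - ζ)) -
          (circAvg Q ε (y - ζ) - Q (y - ζ)))) / N := by
        simp only [S]
        rw [← sub_div, ← integral_sub (hSi x) (hSi y)]
        simp only [mul_sub]
      have := abs_integral_mul_le (C := L₂ * |x - y| * ε ^ 2) (g := fun ζ : ℂ =>
          ((circAvg Q ε (x - ζ) - Q (x - ζ)) - (circAvg Q ε (y - ζ) - Q (y - ζ)))) hvi
        (ae_of_all _ hv0) (ae_of_all _ fun ζ hζ => by
          have := (h₂ ε hε.le hε1 _ (hballB y hy ζ hζ)).2 _ (hballB x hx ζ hζ)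
          rwa [sub_sub_sub_cancel_right, ← Complex.ofReal_sub, Complex.norm_real,
            Real.norm_eq_abs] at this)
      rw [e, abs_div, abs_of_pos hN0]
      calc _ ≤ (W * (L₂ * |x - y| * ε ^ 2)) / N := by
            gcongr
            exact this.trans (by gcongr)
        _ = W * L₂ * |x - y| * (ε ^ 2 / N) := by ring
        _ ≤ W * L₂ * |x - y| * 4 := by gcongr
        _ = 4 * L₂ * W * |x - y| := by ring
  refine ⟨μ, fun x => -G (pr x) - S (pr x), ?_, ?_, fun x y => ?_, fun x _ => ?_, fun x hx => ?_⟩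
  · rw [withDensity_apply _ MeasurableSet.univ, Measure.restrict_univ,
      ← ofReal_integral_eq_lintegral_ofReal hρi (haeK.mono hρK)]
    refine ENNReal.ofReal_le_ofReal (hmass.trans ?_)
    have : 0 ≤ (1 + 2 * R) + m * L₃ + 4 * L₂ * W + m * L₄ := by positivity
    linarith
  · refine (withDensity_absolutelyContinuous _ _).ae_le ?_
    have him : ∀ᵐ ζ : ℂ, ζ.im ≠ 0 := by
      rw [ae_iff]
      have h := Measure.addHaar_submodule (volume : Measure ℂ) (LinearMap.ker Complex.imLm) fun h => by
        have : Complex.I ∈ LinearMap.ker Complex.imLm := h ▸ Submodule.mem_top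
        simp at this
      convert h using 2
      ext z
      simp
    filter_upwards [haeK, ae_restrict_of_ae him] with ζ hζ hi
    refine ⟨hi, (hKn ζ hζ).trans ?_⟩
    have : 0 ≤ m + m * L₃ + 4 * L₂ * W + m * L₄ := by positivity
    linarith
  · have h1 := hGl _ (hpr x) _ (hpr y)
    have h2 := hSl _ (hpr x) _ (hpr y)
    have h3 : |(-G (pr x) - S (pr x)) - (-G (pr y) - S (pr y))| ≤
        |G (pr x) - G (pr y)| + |S (pr x) - S (pr y)| := by
      rw [show (-G (pr x) - S (pr x)) - (-G (pr y) - S (pr y)) =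
        -(G (pr x) - G (pr y)) - (S (pr x) - S (pr y)) by ring]
      refine (abs_sub _ _).trans ?_
      rw [abs_neg]
    calc _ ≤ (m * L₃ + 4 * L₂ * W) * |pr x - pr y| := by linarith
      _ ≤ (m + (1 + 2 * R) + m * L₃ + 4 * L₂ * W + m * L₄) * |x - y| := by
        refine mul_le_mul ?_ (hprl x y) (abs_nonneg _) (by positivity)
        have : 0 ≤ m + (1 + 2 * R) + m * L₄ := by positivity
        linarith
  · have h1 := hGb _ (hpr x)
    have h2 := hSb _ (hpr x)
    have h3 : |-G (pr x) - S (pr x)| ≤ |G (pr x)| + |S (pr x)| := by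
      refine (abs_sub _ _).trans ?_
      rw [abs_neg]
    have : 0 ≤ m + (1 + 2 * R) + m * L₃ := by positivity
    linarith
  · have hEx : Integrable fun ζ : ℂ => E (x - ζ) := hE.comp_sub_left (x : ℂ)
    obtain ⟨-, j1, -⟩ := integral_mul_circAvg hv.measurable hC hEm hE ε x
    have j2 : Integrable fun ζ => v ζ * E (x - ζ) :=
      hEx.bdd_mul hv.aestronglyMeasurable (ae_of_all _ hC)
    have j3 : Integrable fun ζ => ρ ζ * E (x - ζ) := by
      refine ((j2.sub j1).div_const N).congr (ae_of_all _ fun ζ => ?_)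
      simp only [Pi.sub_apply, ρ]
      ring
    have j4 : IntegrableOn (fun ζ => ρ ζ * Real.log ‖(x : ℂ) - ζ‖) K := by
      refine (j3.integrableOn.sub (hGi x)).congr (ae_of_all _ fun ζ => ?_)
      simp only [Pi.sub_apply, hlog]
      ring
    have hdt : ∀ᵐ ζ ∂volume.restrict K, ENNReal.ofReal (ρ ζ) < ⊤ :=
      ae_of_all _ fun _ => ENNReal.ofReal_lt_top
    have hsm : (fun ζ => (ENNReal.ofReal (ρ ζ)).toReal • Real.log ‖(x : ℂ) - ζ‖) =ᵐ[volume.restrict K]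
        fun ζ => ρ ζ * Real.log ‖(x : ℂ) - ζ‖ := by
      filter_upwards [haeK] with ζ hζ
      rw [ENNReal.toReal_ofReal (hρK ζ hζ), smul_eq_mul]
    refine ⟨(integrable_withDensity_iff_integrable_smul' hdm hdt).2 (j4.congr hsm.symm), ?_⟩
    have hprx : pr x = x := by
      simp only [pr]
      rw [projIcc_of_mem _ hx]
    beta_reduce
    rw [hprx, integral_withDensity_eq_integral_toReal_smul hdm hdt, integral_congr_ae hsm,
      integral_mul_logKernel hv hvc hQc hEm hE hlog hε x]
    have k1 : ∫ ζ in K, ρ ζ * Real.log ‖(x : ℂ) - ζ‖ = (∫ ζ, ρ ζ * E (x - ζ)) - G x := by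
      simp only [hlog, mul_sub, G]
      rw [integral_sub j3.integrableOn (hGi x), setIntegral_eq_integral_of_forall_compl_eq_zero]
      intro ζ hζ
      rw [hE0, mul_zero]
      by_contra h
      exact hζ (mem_cthickening_unitSegment hx (not_le.1 h).le)
    have k2 : ∫ ζ, ρ ζ * E (x - ζ) = -(∫ ζ, (circAvg v ε ζ - v ζ) * E (x - ζ)) / N := by
      rw [← integral_neg, ← integral_div]
      refine integral_congr_ae (ae_of_all _ fun ζ => ?_)
      simp only [ρ]
      ring
    rw [k1, k2]
    simp only [S]
    ring

/-! ### Continuous regularisation, and approximation from below. -/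

/-- The cone of height one over the disc of radius `ε`. -/
noncomputable def tent (ε : ℝ) (w : ℂ) : ℝ := max 0 (1 - ‖w‖ / ε)

theorem tent_nonneg (ε : ℝ) (w : ℂ) : 0 ≤ tent ε w := le_max_left _ _

theorem continuous_tent (ε : ℝ) : Continuous (tent ε) := by
  unfold tent
  fun_prop

theorem tent_eq_zero {ε : ℝ} (hε : 0 < ε) {w : ℂ} (hw : ε ≤ ‖w‖) : tent ε w = 0 :=
  max_eq_left (sub_nonpos.2 ((one_le_div hε).2 hw))

theorem tent_le_one {ε : ℝ} (hε : 0 < ε) (w : ℂ) : tent ε w ≤ 1 :=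
  max_le zero_le_one (sub_le_self _ (by positivity))

theorem hasCompactSupport_tent {ε : ℝ} (hε : 0 < ε) : HasCompactSupport (tent ε) :=
  HasCompactSupport.of_support_subset_isCompact (isCompact_closedBall 0 ε) fun w hw => by
    rw [mem_closedBall_zero_iff]
    by_contra h
    exact hw (tent_eq_zero hε (not_le.1 h).le)

theorem integrable_tent {ε : ℝ} (hε : 0 < ε) : Integrable (tent ε) :=
  (continuous_tent ε).integrable_of_hasCompactSupport (hasCompactSupport_tent hε)

theorem integral_tent_pos {ε : ℝ} (hε : 0 < ε) : 0 < ∫ w, tent ε w :=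
  (continuous_tent ε).integral_pos_of_hasCompactSupport_nonneg_nonzero (hasCompactSupport_tent hε)
    (tent_nonneg ε) (x := 0) (by simp [tent])

/-- The average of `f` with respect to the weight `tent ε`. -/
noncomputable def tentAvg (f : ℂ → ENNReal) (ε : ℝ) (z : ℂ) : ℝ :=
  (∫ ζ, tent ε (z - ζ) * (f ζ).toReal) / ∫ w, tent ε w

theorem mul_lintegral_le_of_le {k g : ℂ → ENNReal} {z : ℂ} {ε : ℝ} {c : ENNReal}
    (hk : Measurable k) (hk0 : ∀ w, ε ≤ ‖w‖ → k w = 0) (hg : ∀ ζ, ‖z - ζ‖ < ε → c ≤ g ζ) :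
    (∫⁻ w, k w) * c ≤ ∫⁻ ζ, k (z - ζ) * g ζ := by
  rw [← lintegral_sub_left_eq_self k z, ← lintegral_mul_const _ (by fun_prop)]
  refine lintegral_mono fun ζ => ?_
  rcases lt_or_ge ‖z - ζ‖ ε with h | h
  · exact mul_le_mul_right (hg ζ h) _
  · simp only [hk0 _ h, zero_mul, le_refl]

section

variable {f : ℂ → ENNReal} {ε : ℝ}

theorem ofReal_tentAvg_mul (hf : Measurable f) (hft : ∫⁻ z, f z < ⊤) (hε : 0 < ε) (z : ℂ) :
    ENNReal.ofReal (∫ w, tent ε w) * ENNReal.ofReal (tentAvg f ε z) =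
      ∫⁻ ζ, ENNReal.ofReal (tent ε (z - ζ)) * f ζ := by
  have hc := continuous_tent ε
  have hi : Integrable fun ζ => tent ε (z - ζ) * (f ζ).toReal :=
    (integrable_toReal_of_lintegral_ne_top hf.aemeasurable hft.ne).bdd_mul (c := 1)
      (by fun_prop) (ae_of_all _ fun ζ => by
        rw [Real.norm_of_nonneg (tent_nonneg _ _)]; exact tent_le_one hε _)
  rw [tentAvg, ← ENNReal.ofReal_mul (integral_tent_pos hε).le,
    mul_div_cancel₀ _ (integral_tent_pos hε).ne',
    ofReal_integral_eq_lintegral_ofReal hi (ae_of_all _ fun ζ =>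
      mul_nonneg (tent_nonneg _ _) ENNReal.toReal_nonneg)]
  refine lintegral_congr_ae ?_
  filter_upwards [ae_lt_top hf hft.ne] with ζ hζ
  rw [ENNReal.ofReal_mul (tent_nonneg _ _), ENNReal.ofReal_toReal hζ.ne]

theorem tentAvg_nonneg (f : ℂ → ENNReal) (ε : ℝ) (z : ℂ) : 0 ≤ tentAvg f ε z :=
  div_nonneg (integral_nonneg fun _ => mul_nonneg (tent_nonneg _ _) ENNReal.toReal_nonneg)
    (integral_nonneg (tent_nonneg ε))

theorem continuous_tentAvg (hf : Measurable f) (hft : ∫⁻ z, f z < ⊤) (hε : 0 < ε) :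
    Continuous (tentAvg f ε) := by
  have hc := continuous_tent ε
  refine Continuous.div_const (continuous_of_dominated (bound := fun ζ => (f ζ).toReal) ?_ ?_
    (integrable_toReal_of_lintegral_ne_top hf.aemeasurable hft.ne) ?_) _
  · intro z
    exact (Measurable.mul (by fun_prop) hf.ennreal_toReal).aestronglyMeasurable
  · intro z
    refine ae_of_all _ fun ζ => ?_
    rw [norm_mul, Real.norm_of_nonneg (tent_nonneg _ _), Real.norm_of_nonneg ENNReal.toReal_nonneg]
    exact mul_le_of_le_one_left ENNReal.toReal_nonneg (tent_le_one hε _)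
  · exact ae_of_all _ fun ζ => by fun_prop

theorem ofReal_integral_tent_pos (hε : 0 < ε) : ENNReal.ofReal (∫ w, tent ε w) ≠ 0 :=
  (ENNReal.ofReal_pos.2 (integral_tent_pos hε)).ne'

theorem lintegral_tent (hε : 0 < ε) :
    ∫⁻ w, ENNReal.ofReal (tent ε w) = ENNReal.ofReal (∫ w, tent ε w) :=
  (ofReal_integral_eq_lintegral_ofReal (integrable_tent hε) (ae_of_all _ (tent_nonneg ε))).symm

theorem lintegral_tentAvg_le (hf : Measurable f) (hft : ∫⁻ z, f z < ⊤) (hε : 0 < ε) :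
    ∫⁻ z, ENNReal.ofReal (tentAvg f ε z) ≤ ∫⁻ z, f z := by
  have hc := continuous_tent ε
  have hcm : Measurable (tentAvg f ε) := (continuous_tentAvg hf hft hε).measurable
  rw [← ENNReal.mul_le_mul_iff_right (ofReal_integral_tent_pos hε) ENNReal.ofReal_ne_top,
    ← lintegral_const_mul _ hcm.ennreal_ofReal]
  simp only [ofReal_tentAvg_mul hf hft hε]
  have hm : Measurable fun p : ℂ × ℂ => ENNReal.ofReal (tent ε (p.1 - p.2)) * f p.2 :=
    Measurable.mul (by fun_prop) (hf.comp measurable_snd)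
  rw [lintegral_lintegral_swap hm.aemeasurable]
  refine le_of_eq ?_
  have h1 : ∀ ζ, ∫⁻ z, ENNReal.ofReal (tent ε (z - ζ)) * f ζ =
      ENNReal.ofReal (∫ w, tent ε w) * f ζ := fun ζ => by
    rw [lintegral_mul_const _ (by fun_prop),
      lintegral_sub_right_eq_self (fun z => ENNReal.ofReal (tent ε z)) ζ, lintegral_tent hε]
  simp only [h1]
  rw [lintegral_const_mul _ hf]

theorem IsSupermean.ofReal_tentAvg_le {U : Set ℂ} (hf : IsSupermean f U) (hft : ∫⁻ z, f z < ⊤)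
    (hε : 0 < ε) {z : ℂ} (hz : Metric.closedBall z ε ⊆ U) :
    ENNReal.ofReal (tentAvg f ε z) ≤ f z := by
  rw [← ENNReal.mul_le_mul_iff_right (ofReal_integral_tent_pos hε) ENNReal.ofReal_ne_top,
    ofReal_tentAvg_mul hf.measurable hft hε, ← lintegral_tent hε]
  exact hf.lintegral_radial_le (k := fun r => ENNReal.ofReal (max 0 (1 - r / ε))) (by fun_prop)
    (fun r hr => by
      rw [max_eq_left (sub_nonpos.2 ((one_le_div hε).2 hr.le)), ENNReal.ofReal_zero]) hz

theorem le_ofReal_tentAvg (hf : Measurable f) (hft : ∫⁻ z, f z < ⊤) (hε : 0 < ε) {z : ℂ}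
    {c : ENNReal} (h : ∀ ζ, ‖z - ζ‖ < ε → c ≤ f ζ) : c ≤ ENNReal.ofReal (tentAvg f ε z) := by
  have hc := continuous_tent ε
  rw [← ENNReal.mul_le_mul_iff_right (ofReal_integral_tent_pos hε) ENNReal.ofReal_ne_top,
    ofReal_tentAvg_mul hf hft hε, ← lintegral_tent hε]
  exact mul_lintegral_le_of_le (k := fun w => ENNReal.ofReal (tent ε w)) (by fun_prop)
    (fun w hw => by rw [tent_eq_zero hε hw, ENNReal.ofReal_zero]) h

/-- The regularisation is an average of translates of `f`, so by Fubini it inherits the super-mean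
inequality wherever every translated disc stays in `U`. -/
theorem IsSupermean.circAvg_tentAvg_le {U : Set ℂ} (hf : IsSupermean f U) (hft : ∫⁻ z, f z < ⊤)
    (hε : 0 < ε) {z : ℂ} (hz : ∀ w, ‖w‖ < ε → Metric.closedBall (z - w) ε ⊆ U) :
    circAvg (tentAvg f ε) ε z ≤ tentAvg f ε z := by
  have hc := continuous_tent ε
  have hu := continuous_unitPoint
  have hm := hf.measurable
  have hcont := continuous_tentAvg hm hft hε
  have hcm : Measurable fun t : ℝ => ENNReal.ofReal (tentAvg f ε (z + ε * unitPoint t)) := by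
    fun_prop
  rw [← ENNReal.ofReal_le_ofReal_iff (tentAvg_nonneg _ _ _), circAvg,
    ofReal_integral_eq_lintegral_ofReal ?_ (ae_of_all _ fun t => tentAvg_nonneg _ _ _),
    ← ENNReal.mul_le_mul_iff_right (ofReal_integral_tent_pos hε) ENNReal.ofReal_ne_top,
    ← lintegral_const_mul _ hcm]
  · simp only [ofReal_tentAvg_mul hm hft hε]
    have h1 : ∀ y : ℂ, ∫⁻ ζ, ENNReal.ofReal (tent ε (y - ζ)) * f ζ =
        ∫⁻ w, ENNReal.ofReal (tent ε w) * f (y - w) := fun y => by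
      rw [← lintegral_sub_left_eq_self _ y]
      simp only [sub_sub_cancel]
    simp only [h1]
    have hm2 : Measurable fun p : ℝ × ℂ =>
        ENNReal.ofReal (tent ε p.2) * f (z + ε * unitPoint p.1 - p.2) :=
      Measurable.mul (by fun_prop) (hm.comp (by fun_prop))
    rw [lintegral_lintegral_swap hm2.aemeasurable]
    refine lintegral_mono fun w => ?_
    have hm3 : Measurable fun t : ℝ => f (z + ε * unitPoint t - w) := hm.comp (by fun_prop)
    rw [lintegral_const_mul _ hm3]
    rcases lt_or_ge ‖w‖ ε with h | h
    · refine mul_le_mul_right ?_ _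
      have := hf.lintegral_circle_le (z - w) ε hε (hz w h)
      simpa only [add_sub_right_comm] using this
    · simp only [tent_eq_zero hε h, ENNReal.ofReal_zero, zero_mul, le_refl]
  · exact (Continuous.integrableOn_Icc (by fun_prop)).mono_set Ioc_subset_Icc_self

theorem tentAvg_eq_zero (hε : 0 < ε) {z : ℂ} (h : ∀ ζ, ‖z - ζ‖ < ε → f ζ = 0) :
    tentAvg f ε z = 0 := by
  have : ∀ ζ, tent ε (z - ζ) * (f ζ).toReal = 0 := fun ζ => by
    rcases lt_or_ge ‖z - ζ‖ ε with h' | h'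
    · rw [h ζ h', ENNReal.toReal_zero, mul_zero]
    · rw [tent_eq_zero hε h', zero_mul]
  simp only [tentAvg, this, integral_zero, zero_div]

end

/-- Average `f` twice, with the tent for continuity and with `logKernel` to obtain a potential. Both
weights are radial, so the super-mean property keeps the result below `f`, and lower semicontinuity
on the segment makes it converge to `f` there. -/
theorem exists_seq_isLogPotential {R : ℝ} (hR : 0 < R) {f : ℂ → ENNReal}
    (hf : IsSupermean f (Metric.cthickening (5 * R) unitSegment)) (hft : ∫⁻ z, f z < ⊤)
    (hf0 : ∀ z ∉ Metric.cthickening (5 * R) unitSegment, f z = 0)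
    (hlsc : ∀ x ∈ Icc (0 : ℝ) 1, ∀ c < f x, ∃ r > 0, ∀ ζ : ℂ, ‖(x : ℂ) - ζ‖ < r → c ≤ f ζ) :
    ∃ (A : ℝ) (p : ℕ → ℝ → ℝ), 0 < A ∧ (∀ n, IsLogPotential A (p n)) ∧
      (∀ n, ∀ x ∈ Icc (0 : ℝ) 1, 0 ≤ p n x ∧ ENNReal.ofReal (p n x) ≤ f x) ∧
      ∀ x ∈ Icc (0 : ℝ) 1, Filter.Tendsto (fun n => ENNReal.ofReal (p n x)) Filter.atTop
        (nhds (f x)) := by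
  have hm := hf.measurable
  obtain ⟨A, hA, h⟩ := exists_isLogPotential hR (2 + 5 * R) (∫⁻ z, f z).toReal
  -- Scales at most `R` leave room for the tent and the circle around points of the `3
  -- R`-neighbourhood: `3 R + R + R = 5 R`.
  set e : ℕ → ℝ := fun n => min R (1 / ((n : ℝ) + 1))
  have he : ∀ n, 0 < e n := fun n => lt_min hR (by positivity)
  have heR : ∀ n, e n ≤ R := fun n => min_le_left _ _
  have he1 : ∀ n, e n ≤ 1 := fun n => (min_le_right _ _).trans
    (div_le_one_of_le₀ (by linarith [n.cast_nonneg (α := ℝ)]) (by positivity))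
  set p : ℕ → ℝ → ℝ := fun n x =>
    (∫ ζ, tentAvg f (e n) ζ * logKernel (e n) (x - ζ)) / ∫ ζ, logKernel (e n) ζ
  have hNpos : ∀ n, 0 < ∫ ζ, logKernel (e n) ζ := fun n =>
    lt_of_lt_of_le (by have := he n; positivity) (le_integral_logKernel (he n))
  have hp0 : ∀ n x, 0 ≤ p n x := fun n x =>
    div_nonneg (integral_nonneg fun ζ => mul_nonneg (tentAvg_nonneg _ _ _) (logKernel_nonneg _ _))
      (hNpos n).le
  have hv0 : ∀ n z, 2 + 5 * R < ‖z‖ → tentAvg f (e n) z = 0 := fun n z hz => by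
    refine tentAvg_eq_zero (he n) fun ζ hζ => hf0 ζ fun hζK => ?_
    have h1 := norm_le_of_mem_cthickening (by positivity) hζK
    have h2 := norm_sub_norm_le z ζ
    linarith [he1 n]
  have hcont : ∀ n, Continuous (tentAvg f (e n)) := fun n => continuous_tentAvg hm hft (he n)
  have hvc : ∀ n, HasCompactSupport (tentAvg f (e n)) := fun n =>
    HasCompactSupport.of_support_subset_isCompact (isCompact_closedBall (0 : ℂ) (2 + 5 * R))
      fun z hz => by
        rw [mem_closedBall_zero_iff]
        by_contra h
        exact hz (hv0 n z (not_le.1 h))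
  have hpot : ∀ n, IsLogPotential A (p n) := fun n => by
    refine h (e n) (tentAvg f (e n)) (he n) (he1 n) (hcont n) (tentAvg_nonneg _ _) (hv0 n) ?_ ?_
    · rw [integral_eq_lintegral_of_nonneg_ae (ae_of_all _ (tentAvg_nonneg _ _))
        (hcont n).aestronglyMeasurable]
      exact ENNReal.toReal_mono hft.ne (lintegral_tentAvg_le hm hft (he n))
    · intro ζ hζ
      refine hf.circAvg_tentAvg_le hft (he n) fun w hw => ?_
      intro y hy
      rw [mem_closedBall_iff_norm] at hy
      obtain ⟨x, hx, hxζ⟩ := exists_of_mem_cthickening_unitSegment (by positivity) hζ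
      refine mem_cthickening_unitSegment hx ?_
      have h1 : (x : ℂ) - y = (x - ζ) + (w - (y - (ζ - w))) := by ring
      rw [h1]
      refine (norm_add_le _ _).trans ?_
      linarith [norm_sub_le w (y - (ζ - w)), heR n]
  have hpE : ∀ n x, ENNReal.ofReal (∫ ζ, logKernel (e n) ζ) * ENNReal.ofReal (p n x) =
      ∫⁻ ζ : ℂ, ENNReal.ofReal (logKernel (e n) (x - ζ)) * ENNReal.ofReal (tentAvg f (e n) ζ) := by
    intro n x
    obtain ⟨C, hC⟩ := (hcont n).bounded_above_of_compact_support (hvc n)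
    have hi : Integrable fun ζ : ℂ => tentAvg f (e n) ζ * logKernel (e n) (x - ζ) :=
      ((integrable_logKernel (he n)).comp_sub_left (x : ℂ)).bdd_mul
        (hcont n).aestronglyMeasurable (ae_of_all _ hC)
    rw [← ENNReal.ofReal_mul (hNpos n).le, mul_div_cancel₀ _ (hNpos n).ne',
      ofReal_integral_eq_lintegral_ofReal hi (ae_of_all _ fun ζ =>
        mul_nonneg (tentAvg_nonneg _ _ _) (logKernel_nonneg _ _))]
    refine lintegral_congr fun ζ => ?_
    rw [ENNReal.ofReal_mul (tentAvg_nonneg _ _ _), mul_comm]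
  have hNE : ∀ n, ∫⁻ ζ, ENNReal.ofReal (logKernel (e n) ζ) =
      ENNReal.ofReal (∫ ζ, logKernel (e n) ζ) := fun n =>
    (ofReal_integral_eq_lintegral_ofReal (integrable_logKernel (he n))
      (ae_of_all _ (logKernel_nonneg _))).symm
  have hNE0 : ∀ n, ENNReal.ofReal (∫ ζ, logKernel (e n) ζ) ≠ 0 := fun n =>
    (ENNReal.ofReal_pos.2 (hNpos n)).ne'
  have hk0 : ∀ n (w : ℂ), e n ≤ ‖w‖ → ENNReal.ofReal (logKernel (e n) w) = 0 := fun n w hw => by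
    rw [logKernel_eq_zero (he n) hw, ENNReal.ofReal_zero]
  have hkm : ∀ n, Measurable fun w => ENNReal.ofReal (logKernel (e n) w) := fun n =>
    (measurable_logKernel _).ennreal_ofReal
  have hple : ∀ n, ∀ x ∈ Icc (0 : ℝ) 1, ENNReal.ofReal (p n x) ≤ f x := fun n x hx => by
    rw [← ENNReal.mul_le_mul_iff_right (hNE0 n) ENNReal.ofReal_ne_top, hpE, ← hNE]
    refine le_trans (lintegral_mono fun ζ => ?_) (hf.lintegral_radial_le
      (k := fun r => ENNReal.ofReal (Real.posLog (e n / r))) (z := x) (R := e n)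
      (by unfold Real.posLog; fun_prop) (fun r hr => ?_) fun y hy => ?_)
    · rcases lt_or_ge ‖(x : ℂ) - ζ‖ (e n) with h' | h'
      · refine mul_le_mul_right (hf.ofReal_tentAvg_le hft (he n) fun y hy => ?_) _
        rw [mem_closedBall_iff_norm] at hy
        refine mem_cthickening_unitSegment hx ?_
        have := norm_sub_le_norm_sub_add_norm_sub (x : ℂ) ζ y
        rw [norm_sub_rev ζ y] at this
        linarith [heR n]
      · simp only [hk0 n _ h', zero_mul, zero_le]
    · have := hk0 n (r : ℂ) (by
        rw [Complex.norm_real, Real.norm_of_nonneg ((he n).le.trans hr.le)]; exact hr.le)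
      rwa [logKernel, Complex.norm_real, Real.norm_of_nonneg ((he n).le.trans hr.le)] at this
    · rw [mem_closedBall_iff_norm, norm_sub_rev] at hy
      exact mem_cthickening_unitSegment hx (by linarith [heR n])
  refine ⟨A, p, hA, hpot, fun n x hx => ⟨hp0 n x, hple n x hx⟩, fun x hx => ?_⟩
  refine tendsto_order.2 ⟨fun c hc => ?_, fun c hc => ?_⟩
  · obtain ⟨c', hcc', hc'⟩ := exists_between hc
    obtain ⟨r, hr, hball⟩ := hlsc x hx c' hc'
    have hlim : Filter.Tendsto (fun n : ℕ => 1 / ((n : ℝ) + 1)) Filter.atTop (nhds 0) :=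
      tendsto_one_div_add_atTop_nhds_zero_nat
    filter_upwards [(tendsto_order.1 hlim).2 (r / 2) (by positivity)] with n hn
    have hen : e n < r / 2 := (min_le_right _ _).trans_lt hn
    refine hcc'.trans_le ?_
    rw [← ENNReal.mul_le_mul_iff_right (hNE0 n) ENNReal.ofReal_ne_top, hpE, ← hNE]
    refine mul_lintegral_le_of_le (hkm n) (hk0 n) fun ζ hζ => ?_
    refine le_ofReal_tentAvg hm hft (he n) fun y hy => hball y ?_
    have := norm_sub_le_norm_sub_add_norm_sub (x : ℂ) ζ y
    linarith
  · exact Filter.Eventually.of_forall fun n => (hple n x hx).trans_lt hc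

theorem IsLogPotential.exists_measurable {A : ℝ} {p : ℝ → ℝ} (hp : IsLogPotential A p)
    (hA : 0 ≤ A) : ∃ p' : ℝ → ℝ, Measurable p' ∧ ∀ x ∈ Icc (0 : ℝ) 1, p x = p' x := by
  obtain ⟨μ, H, hμ, -, hH, -, hp⟩ := hp
  have hfin : IsFiniteMeasure μ := ⟨hμ.trans_lt ENNReal.ofReal_lt_top⟩
  have hcont : Continuous H := by
    have : LipschitzWith (Real.toNNReal A) H := LipschitzWith.of_dist_le_mul fun x y => by
      rw [Real.dist_eq, Real.dist_eq, Real.coe_toNNReal _ hA]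
      exact hH x y
    exact this.continuous
  have hm : Measurable fun z : ℝ × ℂ => Real.log ‖(z.1 : ℂ) - z.2‖ := by fun_prop
  exact ⟨_, hcont.measurable.sub (hm.stronglyMeasurable.integral_prod_right' (ν := μ)).measurable,
    fun x hx => (hp x hx).2⟩

theorem IsLogPotential.setIntegral_le {A : ℝ} {p : ℝ → ℝ} (hp : IsLogPotential A p)
    (hA : 0 ≤ A) : ∫ x in Ico (0 : ℝ) 1, p x ≤ A + A * (Real.log (A + 1) + 8) := by
  obtain ⟨μ, H, hμ, hζ, hH, hHA, hp⟩ := hp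
  have hfin : IsFiniteMeasure μ := ⟨hμ.trans_lt ENNReal.ofReal_lt_top⟩
  have hint := integrable_log_norm_sub_prod hζ
  have hcont : Continuous H := by
    have : LipschitzWith (Real.toNNReal A) H := LipschitzWith.of_dist_le_mul fun x y => by
      rw [Real.dist_eq, Real.dist_eq, Real.coe_toNNReal _ hA]
      exact hH x y
    exact this.continuous
  have hlog : 0 ≤ Real.log (A + 1) + 8 := by
    have := Real.log_nonneg (x := A + 1) (by linarith)
    linarith
  have hi2 : Integrable (fun x : ℝ => ∫ ζ, Real.log ‖(x : ℂ) - ζ‖ ∂μ)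
    (volume.restrict (Ico (0 : ℝ) 1)) := hint.integral_prod_left
  have hi1 : IntegrableOn H (Ico (0 : ℝ) 1) := hcont.integrableOn_Ico_zero_one
  have e1 : ∫ x in Ico (0 : ℝ) 1, p x = (∫ x in Ico (0 : ℝ) 1, H x) -
      ∫ x in Ico (0 : ℝ) 1, ∫ ζ, Real.log ‖(x : ℂ) - ζ‖ ∂μ := by
    rw [← integral_sub hi1 hi2]
    exact setIntegral_congr_fun measurableSet_Ico fun x hx => (hp x (Ico_subset_Icc_self hx)).2
  have e2 : ∫ x in Ico (0 : ℝ) 1, H x ≤ A := by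
    have := setIntegral_mono_on hi1 (integrableOn_const (C := A) (by simp)) measurableSet_Ico
      fun x hx => (abs_le.1 (hHA x (Ico_subset_Icc_self hx))).2
    simpa using this
  have e3 : |∫ x in Ico (0 : ℝ) 1, ∫ ζ, Real.log ‖(x : ℂ) - ζ‖ ∂μ| ≤
      A * (Real.log (A + 1) + 8) := by
    have hs : ∫ x in Ico (0 : ℝ) 1, ∫ ζ, Real.log ‖(x : ℂ) - ζ‖ ∂μ =
        ∫ ζ, (∫ x in Ico (0 : ℝ) 1, Real.log ‖(x : ℂ) - ζ‖) ∂μ := integral_integral_swap hint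
    have hb : ∀ᵐ ζ ∂μ, ‖∫ x in Ico (0 : ℝ) 1, Real.log ‖(x : ℂ) - ζ‖‖ ≤ Real.log (A + 1) + 8 := by
      filter_upwards [hζ] with ζ hζ
      refine (norm_integral_le_lintegral_norm _).trans ?_
      refine ENNReal.toReal_le_of_le_ofReal hlog ?_
      exact lintegral_abs_log_norm_sub_le hζ.1 hζ.2
    rw [hs, ← Real.norm_eq_abs]
    refine (norm_integral_le_of_norm_le_const hb).trans ?_
    rw [mul_comm]
    gcongr
    exact ENNReal.toReal_le_of_le_ofReal hA hμ
  linarith [neg_abs_le (∫ x in Ico (0 : ℝ) 1, ∫ ζ, Real.log ‖(x : ℂ) - ζ‖ ∂μ)]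

/-! ### Deviation bounds for limits of potentials, and for subharmonic functions. -/

/-- Limits from below of logarithmic potentials with uniformly bounded data. -/
structure IsLogPotentialLimit (A : ℝ) (f : ℝ → ENNReal) (p : ℕ → ℝ → ℝ) : Prop where
  pos : 0 < A
  measurable : Measurable f
  isLogPotential : ∀ n, IsLogPotential A (p n)
  nonneg : ∀ n, ∀ x ∈ Icc (0 : ℝ) 1, 0 ≤ p n x
  le : ∀ n, ∀ x ∈ Icc (0 : ℝ) 1, ENNReal.ofReal (p n x) ≤ f x
  tendsto : ∀ x ∈ Icc (0 : ℝ) 1,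
    Filter.Tendsto (fun n => ENNReal.ofReal (p n x)) Filter.atTop (nhds (f x))

theorem fract_mem_Icc (t : ℝ) : Int.fract t ∈ Icc (0 : ℝ) 1 :=
  ⟨Int.fract_nonneg _, (Int.fract_lt_one _).le⟩

namespace IsLogPotentialLimit

variable {A : ℝ} {f : ℝ → ENNReal} {p : ℕ → ℝ → ℝ}

/-- Fatou's lemma applied to the uniform bound `IsLogPotential.setIntegral_le`. This is the source
of the integrability of `u` on the segment, which local integrability in the plane does not give. -/
theorem setLIntegral_lt_top (h : IsLogPotentialLimit A f p) : ∫⁻ x in Ico (0 : ℝ) 1, f x < ⊤ := by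
  have hb : ∀ n, ∫⁻ x in Ico (0 : ℝ) 1, ENNReal.ofReal (p n x) ≤
      ENNReal.ofReal (A + A * (Real.log (A + 1) + 8)) := fun n => by
    have hi := ((h.isLogPotential n).integrableOn h.pos.le).1
    rw [← ofReal_integral_eq_lintegral_ofReal hi ((ae_restrict_mem measurableSet_Ico).mono
      fun x hx => h.nonneg n x (Ico_subset_Icc_self hx))]
    exact ENNReal.ofReal_le_ofReal ((h.isLogPotential n).setIntegral_le h.pos.le)
  calc ∫⁻ x in Ico (0 : ℝ) 1, f x
      = ∫⁻ x in Ico (0 : ℝ) 1, Filter.liminf (fun n => ENNReal.ofReal (p n x)) Filter.atTop :=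
        setLIntegral_congr_fun measurableSet_Ico fun x hx =>
          (h.tendsto x (Ico_subset_Icc_self hx)).liminf_eq.symm
    _ ≤ Filter.liminf (fun n => ∫⁻ x in Ico (0 : ℝ) 1, ENNReal.ofReal (p n x)) Filter.atTop :=
        lintegral_liminf_le' fun n =>
          (((h.isLogPotential n).integrableOn h.pos.le).1).aemeasurable.ennreal_ofReal
    _ ≤ ENNReal.ofReal (A + A * (Real.log (A + 1) + 8)) := by
        refine Filter.liminf_le_of_le (by isBoundedDefault) fun b hb' => ?_
        obtain ⟨n, hn⟩ := hb'.exists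
        exact hn.trans (hb n)
    _ < ⊤ := ENNReal.ofReal_lt_top

theorem integrableOn (h : IsLogPotentialLimit A f p) :
    IntegrableOn (fun x => (f x).toReal) (Ico (0 : ℝ) 1) :=
  integrable_toReal_of_lintegral_ne_top h.measurable.aemeasurable h.setLIntegral_lt_top.ne

theorem ae_lt_top (h : IsLogPotentialLimit A f p) :
    ∀ᵐ x ∂volume.restrict (Ico (0 : ℝ) 1), f x < ⊤ :=
  MeasureTheory.ae_lt_top h.measurable h.setLIntegral_lt_top.ne

theorem tendsto_toReal (h : IsLogPotentialLimit A f p) {x : ℝ} (hx : x ∈ Icc (0 : ℝ) 1)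
    (hfx : f x < ⊤) : Filter.Tendsto (fun n => p n x) Filter.atTop (nhds (f x).toReal) := by
  have := (ENNReal.tendsto_toReal hfx.ne).comp (h.tendsto x hx)
  refine this.congr fun n => ?_
  rw [Function.comp_apply, ENNReal.toReal_ofReal (h.nonneg n x hx)]

theorem tendsto_integral (h : IsLogPotentialLimit A f p) :
    Filter.Tendsto (fun n => ∫ x in Ico (0 : ℝ) 1, p n x) Filter.atTop
      (nhds (∫ x in Ico (0 : ℝ) 1, (f x).toReal)) := by
  refine tendsto_integral_of_dominated_convergence (fun x => (f x).toReal)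
    (fun n => (((h.isLogPotential n).integrableOn h.pos.le).1).aestronglyMeasurable)
    h.integrableOn (fun n => ?_) ?_
  · filter_upwards [h.ae_lt_top, ae_restrict_mem measurableSet_Ico] with x hx hx'
    have hx' := Ico_subset_Icc_self hx'
    rw [Real.norm_of_nonneg (h.nonneg n x hx')]
    exact (ENNReal.ofReal_le_iff_le_toReal hx.ne).1 (h.le n x hx')
  · filter_upwards [h.ae_lt_top, ae_restrict_mem measurableSet_Ico] with x hx hx'
    exact h.tendsto_toReal (Ico_subset_Icc_self hx') hx

theorem ae_orbit_lt_top (h : IsLogPotentialLimit A f p) (ω c : ℝ) :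
    ∀ᵐ x ∂volume.restrict (Ico (0 : ℝ) 1), ∀ k : ℕ, f (Int.fract (x + c + k * ω)) < ⊤ := by
  rw [ae_all_iff]
  intro k
  refine MeasureTheory.ae_lt_top (h.measurable.comp (measurable_orbit ω c k)) ?_
  rw [setLIntegral_orbit f ω c k]
  exact h.setLIntegral_lt_top.ne

/-- The bound does not depend on the approximant, so Fatou's lemma passes it to the limit. For
almost every `x` all orbit values are finite and converge, and the means converge by domination by
`f`. -/
theorem lintegral_exp_le (h : IsLogPotentialLimit A f p) {ω D η : ℝ} {N : ℕ}
    (hD : HasDiscrepancy ω N D) (hsep : IsOrbitSeparated ω N η) (hη : 0 < η) (hη1 : η ≤ 1)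
    (hN : N * η ≤ 1) (c : ℝ) :
    ∫⁻ x in Ico (0 : ℝ) 1, ENNReal.ofReal (Real.exp
      (|∑ k ∈ Finset.range N, (f (Int.fract (x + c + k * ω))).toReal -
        N * ∫ y in Ico (0 : ℝ) 1, (f y).toReal| / (2 * A))) ≤
      ENNReal.ofReal (5 * Real.exp (D * (Real.log (A + 1) + 3 - Real.log η) / 2 + 4)) := by
  choose p' hp'm hp' using fun n => (h.isLogPotential n).exists_measurable h.pos.le
  set g : ℕ → ℝ → ENNReal := fun n x => ENNReal.ofReal (Real.exp
      (|∑ k ∈ Finset.range N, p n (Int.fract (x + c + k * ω)) - N * ∫ y in Ico (0 : ℝ) 1, p n y| /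
        (2 * A)))
  have hgm : ∀ n, Measurable (g n) := fun n => by
    have e : g n = fun x => ENNReal.ofReal (Real.exp
      (|∑ k ∈ Finset.range N, p' n (Int.fract (x + c + k * ω)) -
        N * ∫ y in Ico (0 : ℝ) 1, p n y| / (2 * A))) := by
      ext x
      simp only [g, hp' n _ (fract_mem_Icc _)]
    rw [e]
    have h1 : ∀ k ∈ Finset.range N, Measurable fun x : ℝ => p' n (Int.fract (x + c + k * ω)) :=
      fun k _ => (hp'm n).comp (measurable_orbit ω c k)
    have h2 := Finset.measurable_fun_sum _ h1
    exact (Real.measurable_exp.comp ((h2.sub_const _).abs.div_const _)).ennreal_ofReal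
  calc _ ≤ ∫⁻ x in Ico (0 : ℝ) 1, Filter.liminf (fun n => g n x) Filter.atTop := by
        refine lintegral_mono_ae ?_
        filter_upwards [h.ae_orbit_lt_top ω c] with x hx
        have h1 : Filter.Tendsto (fun n => ∑ k ∈ Finset.range N, p n (Int.fract (x + c + k * ω)))
            Filter.atTop (nhds (∑ k ∈ Finset.range N, (f (Int.fract (x + c + k * ω))).toReal)) :=
          tendsto_finsetSum _ fun k _ => h.tendsto_toReal (fract_mem_Icc _) (hx k)
        have h2 := ((h1.sub (h.tendsto_integral.const_mul (N : ℝ))).abs.div_const (2 * A))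
        have h3 := ENNReal.tendsto_ofReal ((Real.continuous_exp.tendsto _).comp h2)
        exact h3.liminf_eq.ge
    _ ≤ Filter.liminf (fun n => ∫⁻ x in Ico (0 : ℝ) 1, g n x) Filter.atTop :=
        lintegral_liminf_le hgm
    _ ≤ _ := by
        refine Filter.liminf_le_of_le (by isBoundedDefault) fun b hb => ?_
        obtain ⟨n, hn⟩ := hb.exists
        exact hn.trans ((h.isLogPotential n).lintegral_exp_le h.pos hD hsep hη hη1 hN c)

theorem volume_lt_abs_sum_le (h : IsLogPotentialLimit A f p) {ω D η : ℝ} {N : ℕ}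
    (hD : HasDiscrepancy ω N D) (hsep : IsOrbitSeparated ω N η) (hη : 0 < η) (hη1 : η ≤ 1)
    (hN : N * η ≤ 1) (c t : ℝ) :
    volume {x ∈ Ico (0 : ℝ) 1 | t < |∑ k ∈ Finset.range N, (f (Int.fract (x + c + k * ω))).toReal -
        N * ∫ y in Ico (0 : ℝ) 1, (f y).toReal|} ≤
      ENNReal.ofReal (5 * Real.exp (D * (Real.log (A + 1) + 3 - Real.log η) / 2 + 4 -
        t / (2 * A))) := by
  have hA := h.pos
  set g : ℝ → ℝ := fun x => |∑ k ∈ Finset.range N, (f (Int.fract (x + c + k * ω))).toReal -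
        N * ∫ y in Ico (0 : ℝ) 1, (f y).toReal|
  have hgm : Measurable g := by
    have h1 : ∀ k ∈ Finset.range N, Measurable fun x : ℝ => (f (Int.fract (x + c + k * ω))).toReal :=
      fun k _ => (h.measurable.comp (measurable_orbit ω c k)).ennreal_toReal
    exact ((Finset.measurable_fun_sum _ h1).sub_const _).abs
  have hgm' : Measurable fun x => ENNReal.ofReal (Real.exp (g x / (2 * A))) :=
    (Real.measurable_exp.comp (hgm.div_const _)).ennreal_ofReal
  have hmark := mul_meas_ge_le_lintegral (μ := volume.restrict (Ico (0 : ℝ) 1)) hgm'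
    (ENNReal.ofReal (Real.exp (t / (2 * A))))
  have hle := hmark.trans (h.lintegral_exp_le hD hsep hη hη1 hN c)
  have hset : volume {x ∈ Ico (0 : ℝ) 1 | t < g x} ≤ (volume.restrict (Ico (0 : ℝ) 1))
      {x | ENNReal.ofReal (Real.exp (t / (2 * A))) ≤ ENNReal.ofReal (Real.exp (g x / (2 * A)))} := by
    rw [Measure.restrict_apply' measurableSet_Ico]
    refine measure_mono fun x hx => ⟨?_, hx.1⟩
    refine ENNReal.ofReal_le_ofReal (Real.exp_le_exp.2 ?_)
    have := hx.2.le
    gcongr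
  refine hset.trans ?_
  rw [Real.exp_sub, ← mul_div_assoc, ENNReal.ofReal_div_of_pos (Real.exp_pos _),
    ENNReal.le_div_iff_mul_le (Or.inl (by simp [Real.exp_pos])) (Or.inl ENNReal.ofReal_ne_top),
    mul_comm]
  exact hle

end IsLogPotentialLimit

/-- Take `M` to be an upper bound of `u` on a compact neighbourhood of the segment; there `M - u` is
nonnegative, integrable, lower semicontinuous and super-mean, as `exists_seq_isLogPotential`
requires. -/
theorem IsSubharmonicOn.exists_isLogPotentialLimit {Ω : Set ℂ} {u : ℂ → EReal}
    (hu : IsSubharmonicOn u Ω) (hΩ : IsOpen Ω) (hΩc : IsPreconnected Ω)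
    (hseg : unitSegment ⊆ Ω) :
    ∃ (A M : ℝ) (f : ℝ → ENNReal) (p : ℕ → ℝ → ℝ), IsLogPotentialLimit A f p ∧
      LowerSemicontinuousOn f (Icc 0 1) ∧
      ∀ x ∈ Icc (0 : ℝ) 1, u x ≤ M ∧ f x = defect M (u x) := by
  obtain ⟨S, hS, hSΩ⟩ := isCompact_unitSegment.exists_cthickening_subset_open hΩ hseg
  set R := S / 5
  have hR : 0 < R := by positivity
  set K := Metric.cthickening (5 * R) unitSegment
  have hKS : K ⊆ Ω := by
    have : 5 * R = S := by simp only [R]; ring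
    simpa only [K, this] using hSΩ
  have hK : IsCompact K := isCompact_unitSegment.cthickening
  obtain ⟨M, hM, hle⟩ := hu.exists_le_of_isCompact hK hKS
  set g : ℂ → ENNReal := K.indicator fun z => defect M (u z)
  have hg : IsSupermean g K := hu.isSupermean hΩ hK hKS hM hle
  have hxK : ∀ x ∈ Icc (0 : ℝ) 1, (x : ℂ) ∈ K := fun x hx =>
    mem_cthickening_unitSegment hx (by simp only [sub_self, norm_zero]; positivity)
  have hgx : ∀ x ∈ Icc (0 : ℝ) 1, g x = defect M (u x) := fun x hx =>
    indicator_of_mem (hxK x hx) _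
  have hlsc : ∀ x ∈ Icc (0 : ℝ) 1, ∀ c < g x, ∃ r > 0, ∀ ζ : ℂ, ‖(x : ℂ) - ζ‖ < r → c ≤ g ζ := by
    intro x hx c hc
    rw [hgx x hx] at hc
    have hnhds : ∀ᶠ y in nhds (u x), c < defect M y :=
      (continuous_defect M).continuousAt.eventually_const_lt hc
    have hev : ∀ᶠ ζ in nhds (x : ℂ), c ≤ defect M (u ζ) := by
      have hxΩ : (x : ℂ) ∈ Ω := hKS (hxK x hx)
      by_cases htop : ∃ y, u x < y
      · obtain ⟨y, hy, hyc⟩ := (mem_nhdsGE_iff_exists_Ico_subset' htop.choose_spec).1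
          (mem_nhdsWithin_of_mem_nhds hnhds)
        have h1 := hu.upperSemicontinuousOn x hxΩ y hy
        rw [hΩ.nhdsWithin_eq hxΩ] at h1
        filter_upwards [h1] with ζ hζ
        rcases le_total (u x) (u ζ) with h | h
        · exact (hyc ⟨h, hζ⟩).le
        · exact hc.le.trans (antitone_defect M h)
      · push Not at htop
        exact absurd (top_le_iff.1 (htop ⊤)) (hu.ne_top _ hxΩ)
    have hKn : K ∈ nhds (x : ℂ) := by
      refine Filter.mem_of_superset (Metric.closedBall_mem_nhds _ (by positivity : 0 < 5 * R)) ?_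
      intro ζ hζ
      rw [mem_closedBall_iff_norm, norm_sub_rev] at hζ
      exact mem_cthickening_unitSegment hx hζ
    obtain ⟨r, hr, hball⟩ := Metric.mem_nhds_iff.1 (hev.and hKn)
    refine ⟨r, hr, fun ζ hζ => ?_⟩
    have h2 := hball (show ζ ∈ Metric.ball (x : ℂ) r by
      rwa [mem_ball_iff_norm, norm_sub_rev])
    have h3 : g ζ = defect M (u ζ) := indicator_of_mem (s := K) h2.2 _
    exact h2.1.trans h3.ge
  obtain ⟨A, p, hA, hp, hpb, hpt⟩ := exists_seq_isLogPotential hR hg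
    (hu.lintegral_indicator_defect_lt_top hΩ hΩc hK hKS M)
    (fun z hz => indicator_of_notMem hz _) hlsc
  refine ⟨A, M, fun x => g x, p, ⟨hA, hg.measurable.comp Complex.measurable_ofReal, hp,
    fun n x hx => (hpb n x hx).1, fun n x hx => (hpb n x hx).2, hpt⟩, ?_, fun x hx =>
    ⟨hle _ (hxK x hx), hgx x hx⟩⟩
  intro x hx c hc
  obtain ⟨c', hcc', hc'⟩ := exists_between hc
  obtain ⟨r, hr, hball⟩ := hlsc x hx c' hc'
  refine mem_nhdsWithin_of_mem_nhds ?_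
  filter_upwards [Metric.ball_mem_nhds x hr] with y hy
  refine hcc'.trans_le (hball y ?_)
  rwa [Metric.mem_ball, dist_comm, Real.dist_eq, ← Real.norm_eq_abs, ← Complex.norm_real,
    Complex.ofReal_sub] at hy

section

variable {u : ℂ → EReal} {A M : ℝ} {f : ℝ → ENNReal} {p : ℕ → ℝ → ℝ}

theorem coe_finsetSum_eReal {ι : Type*} (s : Finset ι) (g : ι → ℝ) :
    ((∑ i ∈ s, g i : ℝ) : EReal) = ∑ i ∈ s, (g i : EReal) :=
  map_sum (⟨⟨Real.toEReal, EReal.coe_zero⟩, EReal.coe_add⟩ : ℝ →+ EReal) g s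

theorem eq_coe_sub_toReal_of_defect_lt_top {M : ℝ} {y : EReal} (hy : y ≤ M)
    (h : defect M y < ⊤) : y = ((M - (defect M y).toReal : ℝ) : EReal) := by
  induction y with
  | bot => simp [defect_bot] at h
  | top => exact absurd hy (by simp)
  | coe a =>
    have ha : a ≤ M := by exact_mod_cast hy
    rw [defect_coe, ENNReal.toReal_ofReal (by linarith), sub_sub_cancel]

theorem IsLogPotentialLimit.toReal_ae_eq (h : IsLogPotentialLimit A f p)
    (hu : ∀ x ∈ Icc (0 : ℝ) 1, u x ≤ M ∧ f x = defect M (u x)) :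
    (fun x : ℝ => (u x).toReal) =ᵐ[volume.restrict (Ico (0 : ℝ) 1)] fun x => M - (f x).toReal := by
  filter_upwards [h.ae_lt_top, ae_restrict_mem measurableSet_Ico] with x hx hx'
  obtain ⟨h1, h2⟩ := hu x (Ico_subset_Icc_self hx')
  rw [h2] at hx ⊢
  conv_lhs => rw [eq_coe_sub_toReal_of_defect_lt_top h1 hx]
  rw [EReal.toReal_coe]

theorem IsLogPotentialLimit.integrableOn_toReal (h : IsLogPotentialLimit A f p)
    (hu : ∀ x ∈ Icc (0 : ℝ) 1, u x ≤ M ∧ f x = defect M (u x)) :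
    IntegrableOn (fun x : ℝ => (u x).toReal) (Ico 0 1) := by
  have h1 : IntegrableOn (fun _ : ℝ => M) (Ico (0 : ℝ) 1) := integrableOn_const (by simp)
  exact (h1.sub h.integrableOn).congr (h.toReal_ae_eq hu).symm

theorem IsLogPotentialLimit.torusMean_eq (h : IsLogPotentialLimit A f p)
    (hu : ∀ x ∈ Icc (0 : ℝ) 1, u x ≤ M ∧ f x = defect M (u x)) :
    torusMean u = M - ∫ x in Ico (0 : ℝ) 1, (f x).toReal := by
  have h1 : IntegrableOn (fun _ : ℝ => M) (Ico (0 : ℝ) 1) := integrableOn_const (by simp)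
  rw [torusMean, integral_congr_ae (h.toReal_ae_eq hu), integral_sub h1 h.integrableOn]
  simp

/-- Outside a null set no orbit point hits a pole of `u`, so the extended-real sum is the real one.
Starting the orbit at `x + ω` turns the indices `1, …, n` into `0, …, n - 1`. -/
theorem IsLogPotentialLimit.volume_deviationSet_le (h : IsLogPotentialLimit A f p)
    (hu : ∀ x ∈ Icc (0 : ℝ) 1, u x ≤ M ∧ f x = defect M (u x)) (ω : ℝ) (n : ℕ) (δ : ℝ) :
    volume (deviationSet u ω n δ) ≤
      volume {x ∈ Ico (0 : ℝ) 1 | δ * n < |∑ k ∈ Finset.range n,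
        (f (Int.fract (x + ω + k * ω))).toReal - n * ∫ y in Ico (0 : ℝ) 1, (f y).toReal|} := by
  refine measure_mono_ae ?_
  have hae := (ae_restrict_iff' measurableSet_Ico).1 (h.ae_orbit_lt_top ω ω)
  filter_upwards [hae] with x hx hdev
  obtain ⟨hx01, hdev⟩ := hdev
  refine ⟨hx01, ?_⟩
  have hx := hx hx01
  have hsum : ∑ k ∈ Finset.Icc 1 n, u ((Int.fract (x + k * ω) : ℝ) : ℂ) =
      ((n * M - ∑ k ∈ Finset.range n, (f (Int.fract (x + ω + k * ω))).toReal : ℝ) : EReal) := by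
    have e1 : (n * M - ∑ k ∈ Finset.range n, (f (Int.fract (x + ω + k * ω))).toReal : ℝ) =
        ∑ k ∈ Finset.range n, (M - (f (Int.fract (x + ω + k * ω))).toReal) := by
      rw [Finset.sum_sub_distrib]; simp
    have e2 : Finset.Icc 1 n = Finset.Ico 1 (n + 1) := by
      ext; simp
    rw [e1, coe_finsetSum_eReal, e2, Finset.sum_Ico_eq_sum_range, Nat.add_sub_cancel]
    refine Finset.sum_congr rfl fun k _ => ?_
    have e3 : x + ((1 + k : ℕ) : ℝ) * ω = x + ω + k * ω := by push_cast; ring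
    rw [e3]
    obtain ⟨h1, h2⟩ := hu _ (fract_mem_Icc (x + ω + k * ω))
    have h3 := hx k
    rw [h2] at h3 ⊢
    exact eq_coe_sub_toReal_of_defect_lt_top h1 h3
  rw [hsum, h.torusMean_eq hu, ← EReal.coe_sub, EReal.abs_def] at hdev
  rw [abs_sub_comm]
  have e4 : ∀ S I : ℝ, n * M - S - n * (M - I) = n * I - S := fun S I => by ring
  rw [e4] at hdev
  rw [EReal.coe_ennreal_ofReal, max_eq_left (abs_nonneg _)] at hdev
  exact EReal.coe_lt_coe_iff.1 hdev

end

/-! ### One-sided averages of logarithmic potentials. -/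

/-- `Real.log` is even, so the integrand is `log |ρ - t|` even when `r` passes the singularity. The
left-hand side equals `r + (ρ - r) (log |ρ - r| - log ρ)` exactly. -/
theorem mul_log_sub_integral_log_le {ρ r : ℝ} (hρ : 0 < ρ) (hr : 0 < r) :
    r * Real.log ρ - ∫ t in (0 : ℝ)..r, Real.log (ρ - t) ≤ 2 * r ∧
    (r < ρ → r * Real.log ρ - ∫ t in (0 : ℝ)..r, Real.log (ρ - t) ≤ r ^ 2 / ρ) := by
  have e : r * Real.log ρ - ∫ t in (0 : ℝ)..r, Real.log (ρ - t) =
      r + (ρ - r) * (Real.log (ρ - r) - Real.log ρ) := by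
    rw [intervalIntegral.integral_comp_sub_left (fun t => Real.log t), sub_zero, integral_log]
    ring
  rw [e]
  have key : r < ρ → r + (ρ - r) * (Real.log (ρ - r) - Real.log ρ) ≤ r ^ 2 / ρ := fun h => by
    have h1 : 0 < ρ - r := by linarith
    rw [← Real.log_div h1.ne' hρ.ne']
    have h2 := Real.log_le_sub_one_of_pos (div_pos h1 hρ)
    calc r + (ρ - r) * Real.log ((ρ - r) / ρ) ≤ r + (ρ - r) * ((ρ - r) / ρ - 1) := by gcongr
      _ = r ^ 2 / ρ := by field_simp; ring
  refine ⟨?_, key⟩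
  rcases lt_trichotomy r ρ with h | h | h
  · refine (key h).trans ?_
    rw [div_le_iff₀ hρ]
    nlinarith
  · subst h
    simp only [sub_self, zero_mul]
    linarith
  · have h1 : 0 < r - ρ := by linarith
    have h3 : Real.log (ρ - r) = Real.log (r - ρ) := by rw [← Real.log_neg_eq_log, neg_sub]
    rw [h3]
    have h2 := Real.log_le_sub_one_of_pos (div_pos hρ h1)
    rw [Real.log_div hρ.ne' h1.ne'] at h2
    have h4 : (r - ρ) * (Real.log ρ - Real.log (r - ρ)) ≤ (r - ρ) * (ρ / (r - ρ) - 1) := by gcongr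
    have h5 : (r - ρ) * (ρ / (r - ρ) - 1) = 2 * ρ - r := by field_simp; ring
    nlinarith

/-- If `ρ ≥ 2 r / τ`, the error `r² / ρ` is at most `r τ`. Otherwise the smallness of `r` makes `ρ`
so small that `τ log (1 / ρ) ≥ 2` absorbs the crude bound `2 r`. Thus `r` is restricted by `τ` only,
uniformly in `ρ`, which permits integration over the measure. -/
theorem mul_log_sub_integral_log_le_mul {ρ r τ : ℝ} (hρ : 0 < ρ) (hr : 0 < r) (hτ : 0 < τ)
    (hτ1 : τ ≤ 1) (hrτ : r ≤ τ / 2 * Real.exp (-2 / τ)) :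
    r * Real.log ρ - ∫ t in (0 : ℝ)..r, Real.log (ρ - t) ≤ r * (τ * (1 + Real.posLog ρ⁻¹)) := by
  obtain ⟨h1, h2⟩ := mul_log_sub_integral_log_le hρ hr
  have h0 : 0 ≤ Real.posLog ρ⁻¹ := Real.posLog_nonneg
  rcases le_or_gt (2 * r / τ) ρ with h | h
  · have h3 : 2 * r ≤ ρ * τ := (div_le_iff₀ hτ).1 h
    refine (h2 (by nlinarith)).trans ?_
    rw [div_le_iff₀ hρ]
    have h4 : 0 ≤ r * τ * Real.posLog ρ⁻¹ * ρ := by positivity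
    nlinarith
  · have h3 : ρ < Real.exp (-2 / τ) := by
      refine h.trans_le ?_
      rw [div_le_iff₀ hτ]
      linarith
    have h4 : 2 / τ ≤ Real.posLog ρ⁻¹ := by
      have h5 : Real.log ρ < -2 / τ := (Real.log_lt_iff_lt_exp hρ).2 h3
      have h6 : Real.log ρ⁻¹ ≤ Real.posLog ρ⁻¹ := le_max_right _ _
      rw [Real.log_inv] at h6
      have h7 : -2 / τ = -(2 / τ) := by ring
      linarith
    have h5 : 2 ≤ τ * Real.posLog ρ⁻¹ := by
      rw [div_le_iff₀ hτ] at h4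
      linarith
    nlinarith

/-- One-sided averages of logarithmic potentials. -/
theorem IsLogPotential.setIntegral_Ioo_le {A x a b τ : ℝ} {p : ℝ → ℝ} (hp : IsLogPotential A p)
    (hA : 0 ≤ A) (hx : x ∈ Icc (0 : ℝ) 1) (hab : a < b) (hab01 : Ioo a b ⊆ Ico 0 1)
    (hxab : x = a ∨ x = b) (hτ : 0 < τ) (hτ1 : τ ≤ 1)
    (hr : b - a ≤ τ / 2 * Real.exp (-2 / τ)) :
    ∫ y in Ioo a b, p y ≤ (b - a) * (p x + A * (b - a) +
      τ * (2 * A + A * Real.log (A + 1) + p x)) := by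
  obtain ⟨μ, H, hμ, hζ, hH, hHA, hp⟩ := hp
  have hfin : IsFiniteMeasure μ := ⟨hμ.trans_lt ENNReal.ofReal_lt_top⟩
  have hba : 0 < b - a := sub_pos.2 hab
  have hcont : Continuous H := by
    have : LipschitzWith (Real.toNNReal A) H := LipschitzWith.of_dist_le_mul fun x y => by
      rw [Real.dist_eq, Real.dist_eq, Real.coe_toNNReal _ hA]
      exact hH x y
    exact this.continuous
  have hint : Integrable (fun z : ℝ × ℂ => Real.log ‖(z.1 : ℂ) - z.2‖)
      ((volume.restrict (Ioo a b)).prod μ) :=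
    (integrable_log_norm_sub_prod hζ).mono_measure
      (Measure.prod_mono (Measure.restrict_mono hab01 le_rfl) le_rfl)
  have hi2 : Integrable (fun y : ℝ => ∫ ζ, Real.log ‖(y : ℂ) - ζ‖ ∂μ)
    (volume.restrict (Ioo a b)) := hint.integral_prod_left
  have hi1 : IntegrableOn H (Ioo a b) := hcont.integrableOn_Ico_zero_one.mono_set hab01
  have hi3 : Integrable (fun ζ => ∫ y in Ioo a b, Real.log ‖(y : ℂ) - ζ‖) μ :=
    hint.integral_prod_right
  obtain ⟨hxi, hpx⟩ := hp x hx
  have hvol : volume.real (Ioo a b) = b - a := by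
    rw [Real.volume_real_Ioo_of_le hab.le]
  have e1 : ∫ y in Ioo a b, p y = (∫ y in Ioo a b, H y) -
      ∫ ζ, (∫ y in Ioo a b, Real.log ‖(y : ℂ) - ζ‖) ∂μ := by
    have : ∫ ζ, (∫ y in Ioo a b, Real.log ‖(y : ℂ) - ζ‖) ∂μ =
        ∫ y in Ioo a b, ∫ ζ, Real.log ‖(y : ℂ) - ζ‖ ∂μ := (integral_integral_swap hint).symm
    rw [this, ← integral_sub hi1 hi2]
    exact setIntegral_congr_fun measurableSet_Ioo fun y hy =>
      (hp y (Ico_subset_Icc_self (hab01 hy))).2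
  have e2 : ∫ y in Ioo a b, H y ≤ (b - a) * (H x + A * (b - a)) := by
    have := setIntegral_mono_on hi1 (integrableOn_const (C := H x + A * (b - a)) (by simp))
      measurableSet_Ioo fun y hy => by
        have h1 := (abs_le.1 (hH y x)).2
        have h2 : |y - x| ≤ b - a := by
          rw [abs_le]
          rcases hxab with rfl | rfl <;> constructor <;> linarith [hy.1, hy.2]
        nlinarith
    rw [setIntegral_const, hvol, smul_eq_mul] at this
    exact this
  -- the pointwise comparison
  have hpt : ∀ᵐ ζ ∂μ, (b - a) * Real.log ‖(x : ℂ) - ζ‖ - ∫ y in Ioo a b, Real.log ‖(y : ℂ) - ζ‖ ≤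
      (b - a) * (τ * (1 + Real.log (A + 1) - Real.log ‖(x : ℂ) - ζ‖)) := by
    filter_upwards [hζ] with ζ hζ
    set ρ := ‖(x : ℂ) - ζ‖
    have hρ : 0 < ρ := norm_ofReal_sub_pos hζ.1 x
    have hρA : ρ ≤ A + 1 := by
      refine (norm_sub_le _ _).trans ?_
      rw [Complex.norm_real, Real.norm_of_nonneg hx.1]
      linarith [hx.2, hζ.2]
    -- Moving from `x` to `y` changes the distance to `ζ` by at most `|y - x|`, so `|y - ζ| ≥ |ρ -
    -- |y - x||`: the worst case has `ζ` on the line.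
    have hlower : ∫ t in (0 : ℝ)..(b - a), Real.log (ρ - t) ≤
        ∫ y in Ioo a b, Real.log ‖(y : ℂ) - ζ‖ := by
      have hlc := continuous_log_norm_sub hζ.1
      have e3 : ∫ t in (0 : ℝ)..(b - a), Real.log (ρ - t) =
          ∫ y in Ioo a b, Real.log (ρ - |y - x|) := by
        rw [← integral_Ioc_eq_integral_Ioo, ← intervalIntegral.integral_of_le hab.le]
        rcases hxab with rfl | rfl
        · have := intervalIntegral.integral_comp_sub_right (a := x) (b := b)
            (fun t => Real.log (ρ - t)) x
          rw [sub_self] at this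
          rw [← this]
          refine intervalIntegral.integral_congr fun y hy => ?_
          rw [uIcc_of_le hab.le] at hy
          simp only [abs_of_nonneg (sub_nonneg.2 hy.1)]
        · have := intervalIntegral.integral_comp_sub_left (a := a) (b := x)
            (fun t => Real.log (ρ - t)) x
          rw [sub_self] at this
          rw [← this]
          refine intervalIntegral.integral_congr fun y hy => ?_
          rw [uIcc_of_le hab.le] at hy
          simp only [abs_of_nonpos (sub_nonpos.2 hy.2), neg_sub]
      rw [e3]
      refine integral_mono_ae ?_ (hlc.continuousOn.integrableOn_compact
        isCompact_Icc |>.mono_set Ioo_subset_Icc_self) ?_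
      · have h1 : IntervalIntegrable (fun t => Real.log (ρ - t)) volume 0 (b - a) :=
          (intervalIntegral.intervalIntegrable_log' (a := ρ - 0) (b := ρ - (b - a))).comp_sub_left ρ
            |> fun h => by simpa using h
        have h2 : IntervalIntegrable (fun y => Real.log (ρ - |y - x|)) volume a b := by
          rcases hxab with rfl | rfl
          · have h3 := h1.comp_sub_right x
            rw [zero_add, sub_add_cancel] at h3
            refine h3.congr fun y hy => ?_
            rw [uIoc_of_le hab.le] at hy
            simp only [abs_of_nonneg (sub_nonneg.2 hy.1.le)]
          · have h3 := (h1.comp_sub_left x).symm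
            rw [sub_zero, sub_sub_cancel] at h3
            refine h3.congr fun y hy => ?_
            rw [uIoc_of_le hab.le] at hy
            simp only [abs_of_nonpos (sub_nonpos.2 hy.2), neg_sub]
        exact ((intervalIntegrable_iff_integrableOn_Ioc_of_le hab.le).1 h2).mono_set
          Ioo_subset_Ioc_self
      · have hne : ∀ᵐ y ∂volume.restrict (Ioo a b), y ∉ ({x - ρ, x + ρ} : Set ℝ) :=
          ae_restrict_of_ae (measure_eq_zero_iff_ae_notMem.1
            ((Set.toFinite ({x - ρ, x + ρ} : Set ℝ)).measure_zero _))
        filter_upwards [hne] with y hy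
        have h1 : |(ρ - |y - x|)| ≤ ‖(y : ℂ) - ζ‖ := by
          have h2 := abs_norm_sub_norm_le ((x : ℂ) - ζ) ((x : ℂ) - y)
          rw [sub_sub_sub_cancel_left, ← Complex.ofReal_sub x y, Complex.norm_real,
            Real.norm_eq_abs, abs_sub_comm x y] at h2
          exact h2
        rw [← Real.log_abs]
        refine Real.log_le_log (abs_pos.2 fun h => hy ?_) h1
        have h3 : |y - x| = ρ := by linarith
        rcases abs_eq hρ.le |>.1 h3 with h4 | h4
        · right
          rw [mem_singleton_iff]; linarith
        · left; linarith
    have hmain := mul_log_sub_integral_log_le_mul hρ hba hτ hτ1 hr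
    -- Bounding `log⁺ (1 / ρ)` by an expression affine in `log ρ` makes its integral over `μ`
    -- computable from `p x` itself.
    have hpl : Real.posLog ρ⁻¹ ≤ Real.log (A + 1) - Real.log ρ := by
      have h1 := Real.posLog_sub_posLog_inv (x := ρ)
      have h2 : Real.posLog ρ ≤ Real.log (A + 1) := by
        refine max_le (Real.log_nonneg (by linarith)) (Real.log_le_log hρ hρA)
      linarith
    calc _ ≤ (b - a) * Real.log ρ - ∫ t in (0 : ℝ)..(b - a), Real.log (ρ - t) := by linarith
      _ ≤ (b - a) * (τ * (1 + Real.posLog ρ⁻¹)) := hmain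
      _ ≤ (b - a) * (τ * (1 + Real.log (A + 1) - Real.log ρ)) := by
        gcongr
        linarith
  have hμr : μ.real univ ≤ A := ENNReal.toReal_le_of_le_ofReal hA hμ
  have e4 : (b - a) * (∫ ζ, Real.log ‖(x : ℂ) - ζ‖ ∂μ) -
      ∫ ζ, (∫ y in Ioo a b, Real.log ‖(y : ℂ) - ζ‖) ∂μ ≤
      (b - a) * (τ * (μ.real univ * (1 + Real.log (A + 1)) - ∫ ζ, Real.log ‖(x : ℂ) - ζ‖ ∂μ)) := by
    have hi4 : Integrable (fun ζ : ℂ => (b - a) * Real.log ‖(x : ℂ) - ζ‖) μ := hxi.const_mul _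
    have hi5 : Integrable (fun ζ : ℂ => 1 + Real.log (A + 1) - Real.log ‖(x : ℂ) - ζ‖) μ :=
      (integrable_const _).sub hxi
    have := integral_mono_ae (hi4.sub hi3) ((hi5.const_mul τ).const_mul (b - a)) hpt
    simp only [Pi.sub_apply] at this
    rw [integral_sub hi4 hi3, integral_const_mul, integral_const_mul, integral_const_mul,
      integral_sub (integrable_const _) hxi, integral_const, smul_eq_mul] at this
    exact this
  have hHx := (abs_le.1 (hHA x hx)).1
  have hlog : 0 ≤ 1 + Real.log (A + 1) := by
    have := Real.log_nonneg (x := A + 1) (by linarith)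
    linarith
  set J := ∫ ζ, Real.log ‖(x : ℂ) - ζ‖ ∂μ
  have e5 : μ.real univ * (1 + Real.log (A + 1)) - J ≤ 2 * A + A * Real.log (A + 1) + p x := by
    have : μ.real univ * (1 + Real.log (A + 1)) ≤ A * (1 + Real.log (A + 1)) := by gcongr
    rw [hpx]
    linarith
  have e6 : (b - a) * (τ * (μ.real univ * (1 + Real.log (A + 1)) - J)) ≤
      (b - a) * (τ * (2 * A + A * Real.log (A + 1) + p x)) := by gcongr
  rw [e1]
  have e7 : (b - a) * (p x + A * (b - a) + τ * (2 * A + A * Real.log (A + 1) + p x)) =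
    (b - a) * (H x + A * (b - a)) - (b - a) * J +
      (b - a) * (τ * (2 * A + A * Real.log (A + 1) + p x)) := by
    rw [show p x = H x - J from hpx]
    ring
  rw [e7]
  linarith

/-- The admissible length depends on `A`, `κ` and `f x` only, not on the approximant, because `p n x
≤ f x`; Fatou's lemma then applies. -/
theorem IsLogPotentialLimit.exists_setLIntegral_Ioo_le {A x κ : ℝ} {f : ℝ → ENNReal}
    {p : ℕ → ℝ → ℝ} (h : IsLogPotentialLimit A f p) (hx : x ∈ Icc (0 : ℝ) 1) (hfx : f x < ⊤)
    (hκ : 0 < κ) : ∃ r > 0, ∀ a b, a < b → b - a < r → Ioo a b ⊆ Ico 0 1 → (x = a ∨ x = b) →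
      ∫⁻ y in Ioo a b, f y ≤ ENNReal.ofReal ((b - a) * ((f x).toReal + κ)) := by
  have hA := h.pos
  set Φ := (f x).toReal
  have hΦ : 0 ≤ Φ := ENNReal.toReal_nonneg
  have hlog : 0 ≤ Real.log (A + 1) := Real.log_nonneg (by linarith)
  set S := 2 * A + A * Real.log (A + 1) + Φ
  have hS : 0 < S := by positivity
  set τ := min 1 (κ / (2 * S))
  have hτ : 0 < τ := lt_min one_pos (by positivity)
  have hτS : τ * S ≤ κ / 2 := by
    calc τ * S ≤ κ / (2 * S) * S := by gcongr; exact min_le_right _ _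
      _ = κ / 2 := by field_simp
  refine ⟨min (κ / (2 * A)) (τ / 2 * Real.exp (-2 / τ)), by positivity,
    fun a b hab hr hsub hxab => ?_⟩
  have hba : 0 < b - a := sub_pos.2 hab
  have hr1 : A * (b - a) ≤ κ / 2 := by
    calc A * (b - a) ≤ A * (κ / (2 * A)) := by
          gcongr
          exact hr.le.trans (min_le_left _ _)
      _ = κ / 2 := by field_simp
  have hpn : ∀ n, p n x ≤ Φ := fun n =>
    (ENNReal.ofReal_le_iff_le_toReal hfx.ne).1 (h.le n x hx)
  have hb : ∀ n, ∫⁻ y in Ioo a b, ENNReal.ofReal (p n y) ≤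
      ENNReal.ofReal ((b - a) * (Φ + κ)) := fun n => by
    have hi := ((h.isLogPotential n).integrableOn hA.le).1.mono_set hsub
    rw [← ofReal_integral_eq_lintegral_ofReal hi ((ae_restrict_mem measurableSet_Ioo).mono
      fun y hy => h.nonneg n y (Ico_subset_Icc_self (hsub hy)))]
    refine ENNReal.ofReal_le_ofReal (((h.isLogPotential n).setIntegral_Ioo_le hA.le hx hab hsub hxab
      hτ (min_le_left _ _) (hr.le.trans (min_le_right _ _))).trans ?_)
    have h1 : τ * (2 * A + A * Real.log (A + 1) + p n x) ≤ τ * S := by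
      have := hpn n
      simp only [S]
      gcongr
    refine mul_le_mul_of_nonneg_left ?_ hba.le
    linarith [hpn n]
  calc ∫⁻ y in Ioo a b, f y
      = ∫⁻ y in Ioo a b, Filter.liminf (fun n => ENNReal.ofReal (p n y)) Filter.atTop :=
        setLIntegral_congr_fun measurableSet_Ioo fun y hy =>
          (h.tendsto y (Ico_subset_Icc_self (hsub hy))).liminf_eq.symm
    _ ≤ Filter.liminf (fun n => ∫⁻ y in Ioo a b, ENNReal.ofReal (p n y)) Filter.atTop :=
        lintegral_liminf_le' fun n =>
          (((h.isLogPotential n).integrableOn hA.le).1.mono_set hsub).aemeasurable.ennreal_ofReal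
    _ ≤ ENNReal.ofReal ((b - a) * (Φ + κ)) := by
        refine Filter.liminf_le_of_le (by isBoundedDefault) fun c hc => ?_
        obtain ⟨n, hn⟩ := hc.exists
        exact hn.trans (hb n)

/-! ### Deviation sets never have full measure. -/

/-- At every point where `F` is finite, the averages of `F` over short intervals to the right of
the point do not essentially exceed the value at the point. -/
def HasRightMeanLE (F : ℝ → ENNReal) : Prop :=
  ∀ x, F x < ⊤ → ∀ κ : ℝ, 0 < κ → ∀ᶠ r in nhdsWithin (0 : ℝ) (Ioi 0),
    ∫⁻ y in Ioo x (x + r), F y ≤ ENNReal.ofReal r * (F x + ENNReal.ofReal κ)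

theorem setLIntegral_Ioo_add (F : ℝ → ENNReal) (a b c : ℝ) :
    ∫⁻ y in Ioo a b, F (y + c) = ∫⁻ y in Ioo (a + c) (b + c), F y := by
  have := (measurePreserving_add_right volume c).setLIntegral_comp_preimage_emb
    (MeasurableEquiv.addRight c).measurableEmbedding F (Ioo (a + c) (b + c))
  rw [preimage_add_const_Ioo, add_sub_cancel_right, add_sub_cancel_right] at this
  exact this

theorem HasRightMeanLE.comp_add {F : ℝ → ENNReal} (h : HasRightMeanLE F) (c : ℝ) :
    HasRightMeanLE fun x => F (x + c) := by
  intro x hx κ hκ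
  filter_upwards [h (x + c) hx κ hκ] with r hr
  rw [setLIntegral_Ioo_add]
  rwa [add_right_comm]

theorem HasRightMeanLE.sum {ι : Type*} {s : Finset ι} {F : ι → ℝ → ENNReal}
    (h : ∀ i ∈ s, HasRightMeanLE (F i)) (hm : ∀ i ∈ s, Measurable (F i)) :
    HasRightMeanLE fun x => ∑ i ∈ s, F i x := by
  intro x hx κ hκ
  rcases s.eq_empty_or_nonempty with rfl | hne
  · simp
  have hcard : (0 : ℝ) < s.card := by exact_mod_cast hne.card_pos
  have h1 : ∀ᶠ r in nhdsWithin (0 : ℝ) (Ioi 0), ∀ i ∈ s, ∫⁻ y in Ioo x (x + r), F i y ≤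
      ENNReal.ofReal r * (F i x + ENNReal.ofReal (κ / s.card)) := by
    rw [Filter.eventually_all_finset]
    exact fun i hi => h i hi x (lt_of_le_of_lt (Finset.single_le_sum (f := fun i => F i x)
      (fun _ _ => zero_le) hi) hx) _ (div_pos hκ hcard)
  filter_upwards [h1] with r hr
  rw [lintegral_finsetSum _ hm]
  refine (Finset.sum_le_sum hr).trans (le_of_eq ?_)
  rw [← Finset.mul_sum, Finset.sum_add_distrib, Finset.sum_const, nsmul_eq_mul,
    ← ENNReal.ofReal_natCast, ← ENNReal.ofReal_mul hcard.le, mul_div_cancel₀ _ hcard.ne']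

/-- A substitute for the intermediate value theorem. If `F` avoided the open window of half-width
`κ` about its mean `m`, then `P = {F ≤ m - κ}`, closed by semicontinuity, would be neither empty nor
everything. Just to the right of the right end of a piece of `P`, `F` would be at least `m + κ`
almost everywhere, while its right averages at that end are at most `m - κ` plus an arbitrarily
small error. -/
theorem Function.Periodic.not_ae_far_from_mean {F : ℝ → ENNReal} (hper : Function.Periodic F 1)
    (hlsc : LowerSemicontinuous F) (hmean : HasRightMeanLE F)
    (hfin : ∫⁻ x in Ico (0 : ℝ) 1, F x < ⊤) {κ : ℝ} (hκ : 0 < κ) :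
    ¬ ∀ᵐ x, F x + ENNReal.ofReal κ ≤ ∫⁻ y in Ico (0 : ℝ) 1, F y ∨
      (∫⁻ y in Ico (0 : ℝ) 1, F y) + ENNReal.ofReal κ ≤ F x := by
  set m := ∫⁻ y in Ico (0 : ℝ) 1, F y with hm
  intro hae
  have hκ' : ENNReal.ofReal κ ≠ 0 := (ENNReal.ofReal_pos.2 hκ).ne'
  have hmκ : ¬ m + ENNReal.ofReal κ ≤ m := not_le.2 (ENNReal.lt_add_right hfin.ne hκ')
  set P := {x | F x + ENNReal.ofReal κ ≤ m}
  have hPmem : ∀ x, x ∈ P ↔ F x + ENNReal.ofReal κ ≤ m := fun x => Iff.rfl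
  have hP : IsClosed P := by
    have : LowerSemicontinuous fun x => F x + ENNReal.ofReal κ :=
      hlsc.add lowerSemicontinuous_const
    exact this.isClosed_preimage m
  have hPper : ∀ x ∈ P, ∀ j : ℤ, x + j ∈ P := fun x hx j => by
    rw [hPmem] at hx ⊢
    have := hper.int_mul j x
    rw [mul_one] at this
    rwa [this]
  have hconst : ∀ c : ENNReal, ∫⁻ _ in Ico (0 : ℝ) 1, c = c := fun c => by simp
  have hPne : P.Nonempty := by
    by_contra hP0
    rw [not_nonempty_iff_eq_empty] at hP0
    refine hmκ ?_
    calc m + ENNReal.ofReal κ = ∫⁻ _ in Ico (0 : ℝ) 1, (m + ENNReal.ofReal κ) := (hconst _).symm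
      _ ≤ ∫⁻ x in Ico (0 : ℝ) 1, F x := by
        refine lintegral_mono_ae ?_
        filter_upwards [ae_restrict_of_ae hae] with x hx
        refine hx.resolve_left fun h => ?_
        have : x ∈ P := h
        rw [hP0] at this
        exact this
      _ = m := hm.symm
  have hPne' : ∃ y, y ∉ P := by
    by_contra! hall
    refine hmκ ?_
    calc m + ENNReal.ofReal κ = ∫⁻ x in Ico (0 : ℝ) 1, (F x + ENNReal.ofReal κ) := by
          rw [lintegral_add_right _ measurable_const, hconst]
      _ ≤ ∫⁻ _ in Ico (0 : ℝ) 1, m := lintegral_mono fun x => hall x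
      _ = m := hconst m
  obtain ⟨y, hy⟩ := hPne'
  obtain ⟨q, hq⟩ := hPne
  have hne : (P ∩ Iic y).Nonempty := by
    refine ⟨q + (⌊y - q⌋ : ℤ), hPper q hq _, ?_⟩
    rw [mem_Iic]
    linarith [Int.floor_le (y - q)]
  have hbdd : BddAbove (P ∩ Iic y) := ⟨y, fun _ h => h.2⟩
  -- The last point of `P` before `y`; it belongs to `P` by closedness, and `(b, y)` misses `P`.
  set b := sSup (P ∩ Iic y)
  have hb : b ∈ P ∩ Iic y := (hP.inter isClosed_Iic).csSup_mem hne hbdd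
  have hby : b < y := lt_of_le_of_ne hb.2 fun h => hy (h ▸ hb.1)
  have hbP : F b + ENNReal.ofReal κ ≤ m := hb.1
  have hFb : F b < ⊤ := lt_of_le_of_lt (le_self_add.trans hbP) hfin
  have hsmall : ∀ᶠ r in nhdsWithin (0 : ℝ) (Ioi 0), r ∈ Ioo (0 : ℝ) (y - b) :=
    Ioo_mem_nhdsGT (sub_pos.2 hby)
  obtain ⟨r, hr, hr0, hry⟩ := ((hmean b hFb κ hκ).and hsmall).exists
  have hlow : ENNReal.ofReal r * (m + ENNReal.ofReal κ) ≤ ∫⁻ x in Ioo b (b + r), F x := by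
    calc ENNReal.ofReal r * (m + ENNReal.ofReal κ)
        = ∫⁻ _ in Ioo b (b + r), (m + ENNReal.ofReal κ) := by
          rw [lintegral_const, Measure.restrict_apply_univ, Real.volume_Ioo, add_sub_cancel_left,
            mul_comm]
      _ ≤ _ := by
        refine lintegral_mono_ae ?_
        filter_upwards [ae_restrict_of_ae hae, ae_restrict_mem measurableSet_Ioo] with x hx hx'
        refine hx.resolve_left fun h => ?_
        have hxP : x ∈ P ∩ Iic y := ⟨h, mem_Iic.2 (by linarith [hx'.2])⟩
        exact absurd (le_csSup hbdd hxP) (not_le.2 hx'.1)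
  have h1 := hlow.trans hr
  rw [ENNReal.mul_le_mul_iff_right (ENNReal.ofReal_pos.2 hr0).ne' ENNReal.ofReal_ne_top] at h1
  exact hmκ (h1.trans hbP)

theorem setLIntegral_periodic_add {g : ℝ → ENNReal} (hper : Function.Periodic g 1) (c : ℝ) :
    ∫⁻ x in Ico (0 : ℝ) 1, g (x + c) = ∫⁻ x in Ico (0 : ℝ) 1, g x := by
  have h1 : ∀ z : ℝ, g (Int.fract z) = g z := fun z => by
    have := hper.sub_int_mul_eq (x := z) ⌊z⌋
    rwa [mul_one] at this
  have := setLIntegral_fract_add g c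
  simpa only [h1] using this

theorem Function.Periodic.not_ae_lt_abs_sum_sub {g : ℝ → ENNReal} (hper : Function.Periodic g 1)
    (hlsc : LowerSemicontinuous g) (hmean : HasRightMeanLE g)
    (hfin : ∫⁻ x in Ico (0 : ℝ) 1, g x < ⊤) (ω c : ℝ) (n : ℕ) {κ : ℝ} (hκ : 0 < κ) :
    ¬ ∀ᵐ x : ℝ, κ < |∑ k ∈ Finset.range n, (g (x + c + k * ω)).toReal -
      n * ∫ y in Ico (0 : ℝ) 1, (g y).toReal| := by
  intro hae
  have hgm : Measurable g := hlsc.measurable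
  set F : ℝ → ENNReal := fun x => ∑ k ∈ Finset.range n, g (x + (c + k * ω))
  have hFper : Function.Periodic F 1 := fun x => Finset.sum_congr rfl fun k _ => by
    rw [add_right_comm]
    exact hper _
  have hFm : ∀ k ∈ Finset.range n, Measurable fun x : ℝ => g (x + (c + k * ω)) := fun k _ =>
    hgm.comp (measurable_add_const _)
  have hFlsc : LowerSemicontinuous F := lowerSemicontinuous_sum fun k _ =>
    hlsc.comp (continuous_add_const _)
  have hFmean : HasRightMeanLE F := HasRightMeanLE.sum (fun k _ => hmean.comp_add _) hFm
  have hFint : ∫⁻ x in Ico (0 : ℝ) 1, F x = n * ∫⁻ x in Ico (0 : ℝ) 1, g x := by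
    simp only [F]
    rw [lintegral_finsetSum _ hFm]
    simp only [setLIntegral_periodic_add hper]
    simp
  set I := ∫⁻ x in Ico (0 : ℝ) 1, g x
  have hI : ∫ y in Ico (0 : ℝ) 1, (g y).toReal = I.toReal :=
    integral_toReal hgm.aemeasurable (MeasureTheory.ae_lt_top hgm hfin.ne)
  have hnI : n * I < ⊤ := ENNReal.mul_lt_top (ENNReal.natCast_lt_top n) hfin
  refine hFper.not_ae_far_from_mean hFlsc hFmean (hFint ▸ hnI) hκ ?_
  rw [hFint]
  have hg_top : ∀ᵐ x : ℝ, ∀ k ∈ Finset.range n, g (x + (c + k * ω)) < ⊤ := by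
    have hgt : ∀ᵐ x : ℝ, g x < ⊤ := by
      have hset : {x | ¬ g x < ⊤} ⊆ ⋃ j : ℤ, (fun x : ℝ => x + j) ⁻¹' ({x | ¬ g x < ⊤} ∩ Ico 0 1) := by
        intro x hx
        refine mem_iUnion.2 ⟨-⌊x⌋, ?_, ?_, ?_⟩
        · have := hper.int_mul (-⌊x⌋) x
          rw [mul_one] at this
          simpa only [mem_ofPred_eq, this] using hx
        · have := Int.fract_nonneg x
          push_cast
          linarith [Int.self_sub_floor x]
        · have := Int.fract_lt_one x
          push_cast
          linarith [Int.self_sub_floor x]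
      rw [ae_iff]
      refine measure_mono_null hset (measure_iUnion_null fun j => ?_)
      rw [measure_preimage_add_right]
      have := MeasureTheory.ae_lt_top hgm hfin.ne
      rw [ae_iff, Measure.restrict_apply' measurableSet_Ico] at this
      exact this
    rw [Filter.eventually_all_finset]
    intro k _
    exact (quasiMeasurePreserving_add_right volume (c + k * ω)).ae hgt
  filter_upwards [hae, hg_top] with x hx hxt
  have hF : F x = ENNReal.ofReal (∑ k ∈ Finset.range n, (g (x + c + k * ω)).toReal) := by
    rw [ENNReal.ofReal_sum_of_nonneg fun _ _ => ENNReal.toReal_nonneg]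
    refine Finset.sum_congr rfl fun k hk => ?_
    rw [add_assoc, ENNReal.ofReal_toReal (hxt k hk).ne]
  have hIr : (n : ENNReal) * I = ENNReal.ofReal (n * I.toReal) := by
    rw [ENNReal.ofReal_mul (Nat.cast_nonneg _), ENNReal.ofReal_natCast,
      ENNReal.ofReal_toReal hfin.ne]
  rw [hI] at hx
  set S := ∑ k ∈ Finset.range n, (g (x + c + k * ω)).toReal
  have hS : 0 ≤ S := Finset.sum_nonneg fun _ _ => ENNReal.toReal_nonneg
  have hnI0 : 0 ≤ n * I.toReal := by positivity
  rw [hF, hIr, ← ENNReal.ofReal_add hS hκ.le, ← ENNReal.ofReal_add hnI0 hκ.le]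
  rcases lt_abs.1 hx with h | h
  · exact Or.inr (ENNReal.ofReal_le_ofReal (by linarith))
  · exact Or.inl (ENNReal.ofReal_le_ofReal (by linarith))

/-- At an integer the periodic extension takes the value `f 0`, but its values from the left are
those of `f` near `1`; semicontinuity there needs `f 0 ≤ f 1`. -/
theorem lowerSemicontinuous_comp_fract {f : ℝ → ENNReal} (hf : LowerSemicontinuousOn f (Icc 0 1))
    (h01 : f 0 ≤ f 1) : LowerSemicontinuous fun x => f (Int.fract x) := by
  intro x c hc
  beta_reduce at hc
  have hfr := fract_mem_Icc x
  have hloc := hf _ hfr c hc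
  by_cases hx : Int.fract x = 0
  · rw [hx] at hc hloc
    have h1 := hf 1 (by simp) c (hc.trans_le h01)
    have hxfl : x = ⌊x⌋ := by linarith [Int.self_sub_floor x]
    obtain ⟨U, hU, hUs⟩ := mem_nhdsWithin_iff_exists_mem_nhds_inter.1 hloc
    obtain ⟨V, hV, hVs⟩ := mem_nhdsWithin_iff_exists_mem_nhds_inter.1 h1
    obtain ⟨e₁, he₁, hU'⟩ := Metric.mem_nhds_iff.1 hU
    obtain ⟨e₂, he₂, hV'⟩ := Metric.mem_nhds_iff.1 hV
    filter_upwards [Metric.ball_mem_nhds x (lt_min one_pos (lt_min he₁ he₂))] with y hy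
    rw [Metric.mem_ball, Real.dist_eq, abs_lt] at hy
    have hy1 := min_le_left 1 (min e₁ e₂)
    have hy2 := (min_le_right 1 (min e₁ e₂)).trans (min_le_left e₁ e₂)
    have hy3 := (min_le_right 1 (min e₁ e₂)).trans (min_le_right e₁ e₂)
    rcases le_or_gt x y with h | h
    · have hfl : Int.fract y = y - x := by
        rw [Int.fract_eq_iff]
        exact ⟨by linarith, by linarith, ⌊x⌋, by linarith⟩
      refine hUs ⟨hU' ?_, fract_mem_Icc y⟩
      rw [Metric.mem_ball, Real.dist_eq, hfl, abs_lt]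
      constructor <;> linarith
    · have hfl : Int.fract y = y - x + 1 := by
        rw [Int.fract_eq_iff]
        exact ⟨by linarith, by linarith, ⌊x⌋ - 1, by push_cast; linarith⟩
      refine hVs ⟨hV' ?_, fract_mem_Icc y⟩
      rw [Metric.mem_ball, Real.dist_eq, hfl, abs_lt]
      constructor <;> linarith
  · have hcont : ContinuousAt (Int.fract : ℝ → ℝ) x := continuousAt_fract fun h => hx (by
      rw [Int.fract]; exact sub_eq_zero.2 h)
    obtain ⟨U, hU, hUs⟩ := mem_nhdsWithin_iff_exists_mem_nhds_inter.1 hloc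
    filter_upwards [hcont hU] with y hy
    exact hUs ⟨hy, fract_mem_Icc y⟩

theorem hasRightMeanLE_comp_fract {f : ℝ → ENNReal}
    (h : ∀ x ∈ Ico (0 : ℝ) 1, f x < ⊤ → ∀ κ : ℝ, 0 < κ → ∀ᶠ r in nhdsWithin (0 : ℝ) (Ioi 0),
      ∫⁻ y in Ioo x (x + r), f y ≤ ENNReal.ofReal r * (f x + ENNReal.ofReal κ)) :
    HasRightMeanLE fun x => f (Int.fract x) := by
  intro x hx κ hκ
  have hfr : Int.fract x ∈ Ico (0 : ℝ) 1 := ⟨Int.fract_nonneg _, Int.fract_lt_one _⟩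
  have hsmall : ∀ᶠ r in nhdsWithin (0 : ℝ) (Ioi 0), r ∈ Ioo (0 : ℝ) (1 - Int.fract x) :=
    Ioo_mem_nhdsGT (sub_pos.2 hfr.2)
  filter_upwards [h _ hfr hx κ hκ, hsmall] with r hr hr1
  refine le_trans (le_of_eq ?_) hr
  have h1 := setLIntegral_Ioo_add (fun y => f (Int.fract y)) (Int.fract x) (Int.fract x + r) ⌊x⌋
  rw [Int.fract_add_floor, add_right_comm, Int.fract_add_floor] at h1
  rw [← h1]
  refine setLIntegral_congr_fun measurableSet_Ioo fun y hy => ?_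
  simp only [Int.fract_add_intCast]
  rw [Int.fract_eq_self.2 ⟨by linarith [hy.1, hfr.1], by linarith [hy.2, hr1.2]⟩]

theorem setIntegral_Ico_one_sub {E : Type*} [NormedAddCommGroup E] [NormedSpace ℝ E] (F : ℝ → E) :
    ∫ x in Ico (0 : ℝ) 1, F (1 - x) = ∫ x in Ico (0 : ℝ) 1, F x := by
  rw [integral_Ico_eq_integral_Ioc, integral_Ico_eq_integral_Ioc,
    ← intervalIntegral.integral_of_le zero_le_one, ← intervalIntegral.integral_of_le zero_le_one,
    intervalIntegral.integral_comp_sub_left, sub_self, sub_zero]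

theorem setLIntegral_Ioo_sub_left (F : ℝ → ENNReal) (a b c : ℝ) :
    ∫⁻ y in Ioo a b, F (c - y) = ∫⁻ y in Ioo (c - b) (c - a), F y := by
  have := (Measure.measurePreserving_sub_left volume c).setLIntegral_comp_preimage_emb
    (MeasurableEquiv.subLeft c).measurableEmbedding F (Ioo (c - b) (c - a))
  rw [preimage_const_sub_Ioo, sub_sub_cancel, sub_sub_cancel] at this
  exact this

namespace IsLogPotentialLimit

variable {A : ℝ} {f : ℝ → ENNReal} {p : ℕ → ℝ → ℝ}

theorem eventually_setLIntegral_right_le (h : IsLogPotentialLimit A f p) {x : ℝ}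
    (hx : x ∈ Ico (0 : ℝ) 1) (hfx : f x < ⊤) {κ : ℝ} (hκ : 0 < κ) :
    ∀ᶠ r in nhdsWithin (0 : ℝ) (Ioi 0),
      ∫⁻ y in Ioo x (x + r), f y ≤ ENNReal.ofReal r * (f x + ENNReal.ofReal κ) := by
  obtain ⟨r₀, hr₀, hmain⟩ := h.exists_setLIntegral_Ioo_le (Ico_subset_Icc_self hx) hfx hκ
  filter_upwards [Ioo_mem_nhdsGT (lt_min hr₀ (sub_pos.2 hx.2))] with r hr
  obtain ⟨h1, h2⟩ := lt_min_iff.1 hr.2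
  have := hmain x (x + r) (by linarith [hr.1]) (by linarith) (fun y hy =>
    ⟨by linarith [hy.1, hx.1], by linarith [hy.2]⟩) (Or.inl rfl)
  rwa [add_sub_cancel_left, ENNReal.ofReal_mul hr.1.le,
    ENNReal.ofReal_add ENNReal.toReal_nonneg hκ.le, ENNReal.ofReal_toReal hfx.ne] at this

theorem eventually_setLIntegral_left_le (h : IsLogPotentialLimit A f p) {x : ℝ}
    (hx : x ∈ Ioc (0 : ℝ) 1) (hfx : f x < ⊤) {κ : ℝ} (hκ : 0 < κ) :
    ∀ᶠ r in nhdsWithin (0 : ℝ) (Ioi 0),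
      ∫⁻ y in Ioo (x - r) x, f y ≤ ENNReal.ofReal r * (f x + ENNReal.ofReal κ) := by
  obtain ⟨r₀, hr₀, hmain⟩ := h.exists_setLIntegral_Ioo_le (Ioc_subset_Icc_self hx) hfx hκ
  filter_upwards [Ioo_mem_nhdsGT (lt_min hr₀ hx.1)] with r hr
  obtain ⟨h1, h2⟩ := lt_min_iff.1 hr.2
  have := hmain (x - r) x (by linarith [hr.1]) (by linarith) (fun y hy =>
    ⟨by linarith [hy.1], by linarith [hy.2, hx.2]⟩) (Or.inr rfl)
  rwa [sub_sub_cancel, ENNReal.ofReal_mul hr.1.le,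
    ENNReal.ofReal_add ENNReal.toReal_nonneg hκ.le, ENNReal.ofReal_toReal hfx.ne] at this

/-- If `f 0 ≤ f 1`, the periodic extension is lower semicontinuous with right mean bounds. Otherwise
reflect by `x ↦ 1 - x` and `ω ↦ -ω`, which swaps the endpoints and turns left mean bounds into right
ones. -/
theorem not_ae_lt_abs_sum_sub (h : IsLogPotentialLimit A f p)
    (hlsc : LowerSemicontinuousOn f (Icc 0 1)) (ω : ℝ) (n : ℕ) {t : ℝ} (ht : 0 < t) :
    ¬ ∀ᵐ x : ℝ, t < |∑ k ∈ Finset.range n, (f (Int.fract (x + ω + k * ω))).toReal -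
        n * ∫ y in Ico (0 : ℝ) 1, (f y).toReal| := by
  have hfr : ∀ x ∈ Ico (0 : ℝ) 1, Int.fract x = x := fun x hx => Int.fract_eq_self.2 hx
  rcases le_total (f 0) (f 1) with h01 | h01
  · have hg : ∫⁻ x in Ico (0 : ℝ) 1, f (Int.fract x) = ∫⁻ x in Ico (0 : ℝ) 1, f x :=
      setLIntegral_congr_fun measurableSet_Ico fun x hx => by simp only [hfr x hx]
    have hg' : ∫ x in Ico (0 : ℝ) 1, (f (Int.fract x)).toReal = ∫ x in Ico (0 : ℝ) 1, (f x).toReal :=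
      setIntegral_congr_fun measurableSet_Ico fun x hx => by simp only [hfr x hx]
    have := Function.Periodic.not_ae_lt_abs_sum_sub (g := fun x => f (Int.fract x))
      (fun x => by simp only [Int.fract_add_one]) (lowerSemicontinuous_comp_fract hlsc h01)
      (hasRightMeanLE_comp_fract fun x hx hfx κ hκ => h.eventually_setLIntegral_right_le hx hfx hκ)
      (hg ▸ h.setLIntegral_lt_top) ω ω n ht
    rwa [hg'] at this
  · intro hae
    set f' : ℝ → ENNReal := fun x => f (1 - x)
    have hlsc' : LowerSemicontinuousOn f' (Icc 0 1) := by
      refine hlsc.comp (g := fun x : ℝ => 1 - x) (by fun_prop) fun x hx => ?_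
      exact ⟨by linarith [hx.2], by linarith [hx.1]⟩
    have hmean : HasRightMeanLE fun x => f' (Int.fract x) := by
      refine hasRightMeanLE_comp_fract fun x hx hfx κ hκ => ?_
      filter_upwards [h.eventually_setLIntegral_left_le (x := 1 - x)
        ⟨by linarith [hx.2], by linarith [hx.1]⟩ hfx hκ] with r hr
      simp only [f']
      rw [setLIntegral_Ioo_sub_left f]
      rwa [← sub_sub]
    have hg : ∫⁻ x in Ico (0 : ℝ) 1, f' (Int.fract x) < ⊤ := by
      have e1 : ∫⁻ x in Ico (0 : ℝ) 1, f' (Int.fract x) = ∫⁻ x in Ico (0 : ℝ) 1, f (1 - x) :=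
        setLIntegral_congr_fun measurableSet_Ico fun x hx => by simp only [hfr x hx, f']
      rw [e1, setLIntegral_congr Ioo_ae_eq_Ico.symm, setLIntegral_Ioo_sub_left, sub_self, sub_zero,
        setLIntegral_congr Ioo_ae_eq_Ico]
      exact h.setLIntegral_lt_top
    have hg' : ∫ x in Ico (0 : ℝ) 1, (f' (Int.fract x)).toReal =
        ∫ x in Ico (0 : ℝ) 1, (f x).toReal := by
      rw [← setIntegral_Ico_one_sub fun x => (f x).toReal]
      exact setIntegral_congr_fun measurableSet_Ico fun x hx => by simp only [hfr x hx, f']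
    have hmain := Function.Periodic.not_ae_lt_abs_sum_sub (g := fun x => f' (Int.fract x))
      (fun x => by simp only [Int.fract_add_one])
      (lowerSemicontinuous_comp_fract hlsc' (by simpa [f'] using h01)) hmean hg (-ω) (-ω) n ht
    refine hmain ?_
    have hae' := (Measure.measurePreserving_neg (volume : Measure ℝ)).quasiMeasurePreserving.ae hae
    -- `fract (-y) = 1 - fract y` fails exactly at integers, so the orbits through integers are
    -- discarded.
    have hni : ∀ᵐ x : ℝ, ∀ k ∈ Finset.range n, Int.fract (x + -ω + k * -ω) ≠ 0 := by
      rw [Filter.eventually_all_finset]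
      intro k _
      rw [ae_iff]
      refine (Set.Countable.mono (s₂ := range fun j : ℤ => (j : ℝ) + ω + k * ω) ?_
        (countable_range _)).measure_zero _
      intro x hx
      simp only [ne_eq, not_not, mem_ofPred_eq] at hx
      refine ⟨⌊x + -ω + k * -ω⌋, ?_⟩
      simp only
      rw [Int.fract] at hx
      linarith
    filter_upwards [hae', hni] with x hx hxn
    rw [hg']
    have e2 : ∑ k ∈ Finset.range n, (f' (Int.fract (x + -ω + k * -ω))).toReal =
        ∑ k ∈ Finset.range n, (f (Int.fract (-x + ω + k * ω))).toReal := by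
      refine Finset.sum_congr rfl fun k hk => ?_
      simp only [f']
      rw [← Int.fract_neg (hxn k hk)]
      congr 4
      ring
    rw [e2]
    exact hx

theorem volume_lt_abs_sum_lt_one (h : IsLogPotentialLimit A f p)
    (hlsc : LowerSemicontinuousOn f (Icc 0 1)) (ω : ℝ) (n : ℕ) {t : ℝ} (ht : 0 < t) :
    volume {x ∈ Ico (0 : ℝ) 1 | t < |∑ k ∈ Finset.range n,
      (f (Int.fract (x + ω + k * ω))).toReal - n * ∫ y in Ico (0 : ℝ) 1, (f y).toReal|} < 1 := by
  set φ : ℝ → ℝ := fun x => |∑ k ∈ Finset.range n, (f (Int.fract (x + ω + k * ω))).toReal -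
    n * ∫ y in Ico (0 : ℝ) 1, (f y).toReal|
  have hφm : Measurable φ := by
    have h1 : ∀ k ∈ Finset.range n, Measurable fun x : ℝ => (f (Int.fract (x + ω + k * ω))).toReal :=
      fun k _ => (h.measurable.comp (measurable_orbit ω ω k)).ennreal_toReal
    exact ((Finset.measurable_fun_sum _ h1).sub_const _).abs
  have hφper : ∀ (x : ℝ) (j : ℤ), φ (x + j) = φ x := fun x j => by
    have : ∀ k : ℕ, x + j + ω + k * ω = x + ω + k * ω + j := fun k => by ring
    simp only [φ, this, Int.fract_add_intCast]
  set S := {x ∈ Ico (0 : ℝ) 1 | t < φ x}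
  have hSm : MeasurableSet S := measurableSet_Ico.inter (measurableSet_lt measurable_const hφm)
  by_contra hge
  rw [not_lt] at hge
  refine h.not_ae_lt_abs_sum_sub hlsc ω n ht ?_
  have hnull : volume (Ico (0 : ℝ) 1 \ S) = 0 := by
    have hSsub : S ⊆ Ico (0 : ℝ) 1 := fun x hx => hx.1
    have hSfin : volume S ≠ ⊤ :=
      (lt_of_le_of_lt (measure_mono hSsub) (by simp : volume (Ico (0 : ℝ) 1) < ⊤)).ne
    rw [measure_sdiff hSsub hSm.nullMeasurableSet hSfin, Real.volume_Ico, sub_zero,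
      ENNReal.ofReal_one]
    exact tsub_eq_zero_of_le hge
  rw [ae_iff]
  have hset : {x | ¬ t < φ x} ⊆ ⋃ j : ℤ, (fun x : ℝ => x + j) ⁻¹' (Ico (0 : ℝ) 1 \ S) := by
    intro x hx
    refine mem_iUnion.2 ⟨-⌊x⌋, ⟨?_, ?_⟩, fun hxS => hx ?_⟩
    · have := Int.fract_nonneg x
      push_cast
      linarith [Int.self_sub_floor x]
    · have := Int.fract_lt_one x
      push_cast
      linarith [Int.self_sub_floor x]
    · have := hxS.2
      rwa [hφper] at this
  refine measure_mono_null hset (measure_iUnion_null fun j => ?_)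
  rw [measure_preimage_add_right]
  exact hnull

end IsLogPotentialLimit

/-! ### Block structure of orbits of Brjuno–Rüssmann rotations. -/

theorem IsOrbitSeparated.of_forall {ω η : ℝ} {N : ℕ}
    (h : ∀ k : ℕ, 0 < k → k < N → ∀ l : ℤ, 2 * η ≤ |k * ω - l|) : IsOrbitSeparated ω N η := by
  have key : ∀ (x : ℝ) (i j : ℕ), j < N → i < j →
      2 * η ≤ |Int.fract (x + i * ω) - Int.fract (x + j * ω)| := by
    intro x i j hj hij
    have h1 := h (j - i) (Nat.sub_pos_of_lt hij) (by omega) (⌊x + j * ω⌋ - ⌊x + i * ω⌋)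
    rw [Nat.cast_sub hij.le, Int.cast_sub] at h1
    rw [abs_sub_comm, Int.fract, Int.fract]
    refine h1.trans (le_of_eq ?_)
    congr 1
    ring
  intro x i hi j hj hij
  rcases lt_or_gt_of_ne hij with h1 | h1
  · exact key x i j hj h1
  · rw [abs_sub_comm]
    exact key x j i hi h1

theorem IsBrjunoRussmann.const_lt {ω Cω : ℝ} {Δ : ℝ → ℝ} (h : IsBrjunoRussmann ω Δ Cω) :
    Cω < 1 / 2 := by
  have h1 := h.lt_dist 1 one_pos
  rw [Nat.cast_one, h.map_one, div_one] at h1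
  exact h1.trans_le (abs_sub_round _)

theorem HypothesisH1.monotoneOn_div {Δ : ℝ → ℝ} (h : HypothesisH1 Δ) :
    MonotoneOn (fun t => Δ t / t) (Ici 1) := by
  have hd : ∀ t : ℝ, 1 < t → HasDerivAt Δ (derivWithin Δ (Ici 1) t) t := fun t ht =>
    ((h.differentiableOn t (mem_Ici.2 ht.le)).hasDerivWithinAt).hasDerivAt (Ici_mem_nhds ht)
  refine monotoneOn_of_deriv_nonneg (convex_Ici 1) ?_ ?_ ?_
  · exact h.differentiableOn.continuousOn.div continuousOn_id fun t ht => by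
      have := mem_Ici.1 ht
      exact (zero_lt_one.trans_le this).ne'
  · rw [interior_Ici]
    intro t ht
    have ht' := mem_Ioi.1 ht
    have h0 : t ≠ 0 := by linarith
    exact ((hd t ht').div (hasDerivAt_id t) h0).differentiableAt.differentiableWithinAt
  · rw [interior_Ici]
    intro t ht
    have ht' := mem_Ioi.1 ht
    have h0 : t ≠ 0 := by linarith
    have := ((hd t ht').div (hasDerivAt_id t) h0).deriv
    simp only [id] at this
    rw [show (fun t => Δ t / t) = Δ / id from rfl, this]
    have h1 := h.le_mul_deriv t ht'.le
    apply div_nonneg _ (sq_nonneg t)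
    linarith

theorem IsBrjunoRussmann.le_map {ω Cω : ℝ} {Δ : ℝ → ℝ} (h : IsBrjunoRussmann ω Δ Cω)
    (h1 : HypothesisH1 Δ) {t : ℝ} (ht : 1 ≤ t) : t ≤ Δ t := by
  rcases eq_or_lt_of_le ht with rfl | ht'
  · exact h.map_one.ge
  · have h2 := h1.lt_map t ht'
    have h3 := Real.log_nonneg ht
    nlinarith

/-- For `N ≤ n`, rotation by `ω` nearly closes up after some `q ≤ N` steps, where
`N ≤ (n / Δ⁻¹(Cω n)) q`. -/
theorem IsBrjunoRussmann.exists_step {ω Cω : ℝ} {Δ : ℝ → ℝ} (h : IsBrjunoRussmann ω Δ Cω)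
    (h1 : HypothesisH1 Δ) {n : ℕ} (hn : 1 ≤ Cω * n) {N : ℕ} (hN : 0 < N) (hNn : N ≤ n) :
    ∃ q : ℕ, 0 < q ∧ q ≤ N ∧ HasDiscrepancy ω q 6 ∧ (N : ℝ) ≤ n / deltaInv Δ (Cω * n) * q := by
  obtain ⟨hT, hΔT⟩ := deltaInv_spec h h1 hn
  set T := deltaInv Δ (Cω * n)
  obtain ⟨q, p, hq, hqN, hpq, hap, hΔ⟩ := h.exists_approx hN
  refine ⟨q, hq, hqN, hasDiscrepancy_of_approx hq hqN hpq hap, ?_⟩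
  have hT0 : 0 < T := by linarith
  have hq1 : (1 : ℝ) ≤ q := by exact_mod_cast hq
  have hNn' : (N : ℝ) ≤ n := by exact_mod_cast hNn
  rw [div_mul_eq_mul_div, le_div_iff₀ hT0]
  rcases le_or_gt T q with hTq | hTq
  · exact mul_le_mul hNn' hTq hT0.le (Nat.cast_nonneg _)
  · have h2 := h1.monotoneOn_div (mem_Ici.2 hq1) (mem_Ici.2 hT) hTq.le
    simp only [hΔT] at h2
    rw [div_le_div_iff₀ (by linarith) hT0] at h2
    have hC := h.const_pos
    have h3 : Cω * (N * T) ≤ Cω * (n * q) := by nlinarith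
    exact le_of_mul_le_mul_left h3 hC

/-- An orbit of length `n` splits into `b` blocks of length `q`, along which rotation by `ω` nearly
closes up, and a remainder; both parts are separated and have small discrepancy. -/
theorem IsBrjunoRussmann.exists_blocks {ω Cω : ℝ} {Δ : ℝ → ℝ} (hB : IsBrjunoRussmann ω Δ Cω)
    (h1 : HypothesisH1 Δ) {n : ℕ} (hn : 1 ≤ Cω * n) (hTe : Real.exp 1 ≤ deltaInv Δ (Cω * n))
    (hTC : 2 / Cω ≤ deltaInv Δ (Cω * n)) :
    ∃ (q b r : ℕ) (D η₁ η₂ : ℝ), deltaInv Δ (Cω * n) < q ∧ q ≤ n ∧ b * q + r = n ∧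
      (HasDiscrepancy ω (b * q) (b * 6) ∧ IsOrbitSeparated ω (b * q) η₁ ∧ 0 < η₁ ∧ η₁ ≤ 1 ∧
        (b * q : ℕ) * η₁ ≤ 1 ∧ -Real.log η₁ ≤ 3 * Real.log (Δ q)) ∧
      (HasDiscrepancy ω r D ∧ IsOrbitSeparated ω r η₂ ∧ 0 < η₂ ∧ η₂ ≤ 1 ∧ r * η₂ ≤ 1 ∧
        -Real.log η₂ ≤ 3 * Real.log n ∧ 0 ≤ D ∧
        D * Real.log n ≤ n / deltaInv Δ (Cω * n) *
          (18 * Real.log n + 24 * Real.log (deltaInv Δ (Cω * n)) ^ 2)) := by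
  obtain ⟨hT1, hΔT⟩ := deltaInv_spec hB h1 hn
  have hC := hB.const_pos
  have hC2 := hB.const_lt
  have hstep : ∀ N : ℕ, 0 < N → N ≤ n → ∃ q : ℕ, 0 < q ∧ q ≤ N ∧ HasDiscrepancy ω q 6 ∧
      (N : ℝ) ≤ n / deltaInv Δ (Cω * n) * q := fun N hN hNn => hB.exists_step h1 hn hN hNn
  set T := deltaInv Δ (Cω * n)
  have hT0 : 0 < T := by linarith
  have hn0 : 0 < n := by
    rcases Nat.eq_zero_or_pos n with rfl | h0
    · norm_num at hn
    · exact h0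
  have hn0' : (0 : ℝ) < n := by exact_mod_cast hn0
  have hTn : T ≤ n := by
    have := hB.le_map h1 hT1
    rw [hΔT] at this
    nlinarith
  obtain ⟨q, a, hq, hqn, hpq, hap, hΔq⟩ := hB.exists_approx hn0
  have hq0 : (0 : ℝ) < q := by exact_mod_cast hq
  have hq1 : (1 : ℝ) ≤ q := by exact_mod_cast hq
  have hqn' : (q : ℝ) ≤ n := by exact_mod_cast hqn
  have hTq : T < q := by
    by_contra hle
    have := hB.monotoneOn (mem_Ici.2 hq1) (mem_Ici.2 hT1) (not_lt.1 hle)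
    rw [hΔT] at this
    nlinarith
  have hqΔ : (q : ℝ) ≤ Δ q := hB.le_map h1 hq1
  have hΔ0 : 0 < Δ q := hq0.trans_le hqΔ
  have hlogq : 1 ≤ Real.log q := by
    rw [Real.le_log_iff_exp_le hq0]
    linarith
  have hlogΔ : 1 ≤ Real.log (Δ q) := hlogq.trans (Real.log_le_log hq0 hqΔ)
  have hlogqn : Real.log q ≤ Real.log n := Real.log_le_log hq0 hqn'
  have hlogn : 1 ≤ Real.log n := hlogq.trans hlogqn
  -- separation of the whole orbit
  set η₁ := Cω / (2 * Δ q ^ 2)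
  have hη₁ : 0 < η₁ := by positivity
  have hsep₁ : ∀ N : ℕ, N ≤ n → IsOrbitSeparated ω N η₁ := fun N hN =>
    IsOrbitSeparated.of_forall fun k hk hkN l => by
      -- Both candidates are at least `Cω / Δ(q)²`: the first by `Cω (n + 1) < Δ(q)` and `q ≤ Δ(q)`,
      -- the second by the Diophantine condition at `q`.
      refine le_trans (le_min ?_ ?_) (le_abs_mul_sub_of_approx hq hap hk (by omega) hpq l)
      · rw [show 2 * η₁ = Cω / Δ q ^ 2 by simp only [η₁]; field_simp, div_le_div_iff₀ (by positivity)
          (by positivity)]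
        nlinarith [mul_le_mul hΔq.le hqΔ hq0.le hΔ0.le]
      · refine le_trans ?_ (hB.lt_dist q hq).le
        rw [show 2 * η₁ = Cω / Δ q ^ 2 by simp only [η₁]; field_simp]
        gcongr
        nlinarith
  have hη₁n : n * η₁ ≤ 1 := by
    rw [← mul_div_assoc, div_le_one (by positivity)]
    nlinarith
  have hη₁1 : η₁ ≤ 1 := by
    have : (1 : ℝ) ≤ n := by exact_mod_cast hn0
    nlinarith
  have hlogη₁ : -Real.log η₁ ≤ 3 * Real.log (Δ q) := by
    -- The factor `2 / Cω` is absorbed into a third power of `Δ(q)`, which keeps the final constant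
    -- independent of `ω`.
    have h2 : 2 / Cω ≤ Δ q := by linarith
    rw [← Real.log_inv, show (3 : ℝ) * Real.log (Δ q) = Real.log (Δ q ^ 3) by
      rw [Real.log_pow]; norm_num]
    refine Real.log_le_log (inv_pos.2 hη₁) ?_
    rw [inv_div]
    calc 2 * Δ q ^ 2 / Cω = 2 / Cω * Δ q ^ 2 := by ring
      _ ≤ Δ q * Δ q ^ 2 := by gcongr
      _ = Δ q ^ 3 := by ring
  -- separation of a short orbit
  set η₂ := 1 / (2 * (q : ℝ) ^ 2)
  have hη₂ : 0 < η₂ := by positivity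
  have hsep₂ : ∀ N : ℕ, N < q → IsOrbitSeparated ω N η₂ := fun N hN =>
    IsOrbitSeparated.of_forall fun k hk hkN l => by
      refine le_trans (le_of_eq ?_) (le_abs_mul_sub_of_lt hqn hap hk (by omega) hpq l)
      simp only [η₂]
      field_simp
  have hη₂q : q * η₂ ≤ 1 := by
    rw [← mul_div_assoc, mul_one, div_le_one (by positivity)]
    nlinarith
  have hη₂1 : η₂ ≤ 1 := by nlinarith
  have hlogη₂ : -Real.log η₂ ≤ 3 * Real.log n := by
    rw [← Real.log_inv, inv_div, div_one, Real.log_mul (by norm_num) (by positivity), Real.log_pow]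
    have := Real.log_two_lt_d9
    push_cast
    linarith
  set b := n / q
  set r := n % q
  have hnbr : b * q + r = n := Nat.div_add_mod' n q
  have hrq : r < q := Nat.mod_lt n hq
  have hbq : b * q ≤ n := by omega
  have hbn : (b : ℝ) * q ≤ n := by exact_mod_cast hbq
  have hD₁ : HasDiscrepancy ω (b * q) (b * 6) := (hasDiscrepancy_of_approx hq hqn hpq hap).mul b
  obtain ⟨D, hD0, hD₂, hDlog⟩ := exists_hasDiscrepancy_mul_log_le hT1 hTn hstep r
    (by omega)
  refine ⟨q, b, r, D, η₁, η₂, hTq, hqn, hnbr, ⟨hD₁, hsep₁ _ hbq, hη₁, hη₁1, ?_, hlogη₁⟩, hD₂,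
    hsep₂ _ hrq, hη₂, hη₂1, ?_, hlogη₂, hD0, hDlog⟩
  · refine le_trans ?_ hη₁n
    gcongr
  · refine le_trans ?_ hη₂q
    gcongr

/-! ### Large `n`: exponential decay at a rate independent of `ω`. -/

theorem sub_le_add_mul {a l x : ℝ} (ha : 0 ≤ a) (hx : 1 ≤ x) (hl : -l ≤ 3 * x) :
    a - l ≤ (a + 3) * x := by
  nlinarith

/-- Half of the exponent pays for the moment constant `E` and for the factor `10`, as `10 exp (-3) ≤
1`. The remaining factor one half lets two such bounds be added. -/
theorem five_mul_exp_le {E s : ℝ} (h : E + 3 ≤ s / 2) :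
    5 * Real.exp (E - s) ≤ Real.exp (-(s / 2)) / 2 := by
  have h1 : Real.exp (E - s) ≤ Real.exp (-(s / 2)) * Real.exp (-3) := by
    rw [← Real.exp_add]
    exact Real.exp_le_exp.2 (by linarith)
  have h2 : 10 * Real.exp (-3) ≤ 1 := by
    rw [Real.exp_neg, ← div_eq_mul_inv, div_le_one (Real.exp_pos _)]
    have h3 : Real.exp 3 = Real.exp 1 ^ 3 := by rw [← Real.exp_nat_mul]; norm_num
    have h4 := Real.exp_one_gt_d9
    rw [h3]
    nlinarith [sq_nonneg (Real.exp 1 - 2.7)]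
  have h5 := Real.exp_pos (-(s / 2))
  nlinarith

namespace IsLogPotentialLimit

variable {A : ℝ} {f : ℝ → ENNReal} {p : ℕ → ℝ → ℝ}

theorem volume_lt_abs_sum_add_le (f : ℝ → ENNReal) (ω c t : ℝ) (m r : ℕ) :
    volume {x ∈ Ico (0 : ℝ) 1 | t < |∑ k ∈ Finset.range (m + r),
        (f (Int.fract (x + c + k * ω))).toReal -
        (m + r : ℕ) * ∫ y in Ico (0 : ℝ) 1, (f y).toReal|} ≤
      volume {x ∈ Ico (0 : ℝ) 1 | t / 2 < |∑ k ∈ Finset.range m,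
        (f (Int.fract (x + c + k * ω))).toReal - m * ∫ y in Ico (0 : ℝ) 1, (f y).toReal|} +
      volume {x ∈ Ico (0 : ℝ) 1 | t / 2 < |∑ k ∈ Finset.range r,
        (f (Int.fract (x + (c + m * ω) + k * ω))).toReal -
        r * ∫ y in Ico (0 : ℝ) 1, (f y).toReal|} := by
  refine (measure_mono fun x hx => ?_).trans (measure_union_le _ _)
  obtain ⟨hx01, hx⟩ := hx
  rw [Finset.sum_range_add] at hx
  have e : ∀ k : ℕ, x + c + ((m + k : ℕ) : ℝ) * ω = x + (c + m * ω) + k * ω := fun k => by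
    push_cast; ring
  simp only [e] at hx
  by_contra hnot
  simp only [mem_union, mem_ofPred_eq, not_or, not_and, not_lt] at hnot
  have h1 := hnot.1 hx01
  have h2 := hnot.2 hx01
  set I := ∫ y in Ico (0 : ℝ) 1, (f y).toReal
  have h3 := abs_add_le (∑ k ∈ Finset.range m, (f (Int.fract (x + c + k * ω))).toReal - m * I)
    (∑ k ∈ Finset.range r, (f (Int.fract (x + (c + m * ω) + k * ω))).toReal - r * I)
  have e2 : ∑ k ∈ Finset.range m, (f (Int.fract (x + c + k * ω))).toReal +
      ∑ k ∈ Finset.range r, (f (Int.fract (x + (c + m * ω) + k * ω))).toReal - (m + r : ℕ) * I =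
      (∑ k ∈ Finset.range m, (f (Int.fract (x + c + k * ω))).toReal - m * I) +
      (∑ k ∈ Finset.range r, (f (Int.fract (x + (c + m * ω) + k * ω))).toReal - r * I) := by
    push_cast; ring
  rw [e2] at hx
  linarith

/-- The deviation is shared equally between the blocks and the remainder. Their exponents are of
order `b log Δ(q) ≤ n log Δ(q) / q` and `D log n`, of order `n (log n + log² T) / T`; both are
beaten by `δ n` once `δ` exceeds the stated multiple. The number `K` depends on `A` only, and `q`
does not depend on `δ`. -/
theorem exists_volume_le_of_large (h : IsLogPotentialLimit A f p) : ∃ K : ℝ, 0 < K ∧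
    ∀ (ω Cω : ℝ) (Δ : ℝ → ℝ), IsBrjunoRussmann ω Δ Cω → HypothesisH1 Δ → ∀ n : ℕ, 1 ≤ Cω * n →
      Real.exp 1 ≤ deltaInv Δ (Cω * n) → 2 / Cω ≤ deltaInv Δ (Cω * n) →
      ∃ q : ℝ, deltaInv Δ (Cω * n) < q ∧ q ≤ n ∧ ∀ δ : ℝ,
        K * (Real.log (Δ q) / q + (Real.log n + Real.log (deltaInv Δ (Cω * n)) ^ 2) /
          deltaInv Δ (Cω * n)) ≤ δ →
        volume {x ∈ Ico (0 : ℝ) 1 | δ * n < |∑ k ∈ Finset.range n,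
          (f (Int.fract (x + ω + k * ω))).toReal - n * ∫ y in Ico (0 : ℝ) 1, (f y).toReal|} ≤
        ENNReal.ofReal (Real.exp (-(1 / (8 * A)) * δ * n)) := by
  have hA := h.pos
  set L := Real.log (A + 1) + 3
  have hL : 3 ≤ L := by
    have := Real.log_nonneg (x := A + 1) (by linarith)
    simp only [L]
    linarith
  -- `384 = 48 * 8`: the rate to be kept is `1 / (8 A)`, and `48` generously covers the coefficients
  -- `3` and `12` of the two exponents and the additive constants.
  refine ⟨384 * A * (L + 3), by positivity, fun ω Cω Δ hB h1 n hn hTe hTC => ?_⟩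
  obtain ⟨hT1, hΔT⟩ := deltaInv_spec hB h1 hn
  have hC2 := hB.const_lt
  obtain ⟨q, b, r, D, η₁, η₂, hTq, hqn, hnbr, ⟨hD₁, hsep₁, hη₁, hη₁1, hη₁n, hlogη₁⟩, hD₂, hsep₂,
    hη₂, hη₂1, hη₂r, hlogη₂, hD0, hDlog⟩ := hB.exists_blocks h1 hn hTe hTC
  set T := deltaInv Δ (Cω * n)
  have hT0 : 0 < T := by linarith
  have hq0 : (0 : ℝ) < q := hT0.trans hTq
  have hqn' : (q : ℝ) ≤ n := by exact_mod_cast hqn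
  have hn0' : (0 : ℝ) < n := hq0.trans_le hqn'
  have hTn : T ≤ n := hTq.le.trans hqn'
  have hqΔ : (q : ℝ) ≤ Δ q := hB.le_map h1 (hT1.trans hTq.le)
  have hΔ0 : 0 < Δ q := hq0.trans_le hqΔ
  have hlogq : 1 ≤ Real.log q := by
    rw [Real.le_log_iff_exp_le hq0]
    linarith
  have hlogΔ : 1 ≤ Real.log (Δ q) := hlogq.trans (Real.log_le_log hq0 hqΔ)
  have hlogn : 1 ≤ Real.log n := hlogq.trans (Real.log_le_log hq0 hqn')
  have hbn : (b : ℝ) * q ≤ n := by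
    have : b * q ≤ n := by omega
    exact_mod_cast this
  refine ⟨q, hTq, hqn', fun δ hδ => ?_⟩
  set S := (Real.log n + Real.log T ^ 2) / T
  have hS : 0 ≤ S := by positivity
  have hSn : 1 ≤ S * n := by
    rw [div_mul_eq_mul_div, le_div_iff₀ hT0]
    nlinarith [sq_nonneg (Real.log T)]
  have hR : 0 ≤ Real.log (Δ q) / q := by positivity
  have hδn : 384 * A * (L + 3) * (Real.log (Δ q) / q * n + S * n) ≤ δ * n := by
    calc _ = 384 * A * (L + 3) * (Real.log (Δ q) / q + S) * n := by ring
      _ ≤ δ * n := by gcongr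
  have hscale : 48 * ((L + 3) * (Real.log (Δ q) / q * n)) + 48 * ((L + 3) * (S * n)) ≤
      δ * n / (4 * A) / 2 := by
    rw [div_div, le_div_iff₀ (by positivity)]
    linarith
  have hRn : 0 ≤ Real.log (Δ q) / q * n := by positivity
  have hb' : (b : ℝ) * Real.log (Δ q) ≤ Real.log (Δ q) / q * n := by
    have : (b : ℝ) ≤ n / q := by rwa [le_div_iff₀ hq0]
    calc (b : ℝ) * Real.log (Δ q) ≤ n / q * Real.log (Δ q) := by gcongr
      _ = _ := by ring
  have hV₁ := h.volume_lt_abs_sum_le hD₁ hsep₁ hη₁ hη₁1 hη₁n ω (δ * n / 2)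
  have hV₂ := h.volume_lt_abs_sum_le hD₂ hsep₂ hη₂ hη₂1 hη₂r (ω + (b * q : ℕ) * ω) (δ * n / 2)
  have hsum := volume_lt_abs_sum_add_le f ω ω (δ * n) (b * q) r
  rw [hnbr] at hsum
  have ht : δ * n / 2 / (2 * A) = δ * n / (4 * A) := by field_simp; ring
  rw [ht] at hV₁ hV₂
  have hE₁ : b * 6 * (Real.log (A + 1) + 3 - Real.log η₁) / 2 + 4 + 3 ≤ δ * n / (4 * A) / 2 := by
    have e1 : (b : ℝ) * (L - Real.log η₁) ≤ b * ((L + 3) * Real.log (Δ q)) := by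
      gcongr
      exact sub_le_add_mul (by linarith) hlogΔ hlogη₁
    have e2 : (b : ℝ) * ((L + 3) * Real.log (Δ q)) ≤ (L + 3) * (Real.log (Δ q) / q * n) := by
      calc (b : ℝ) * ((L + 3) * Real.log (Δ q)) = (L + 3) * (b * Real.log (Δ q)) := by ring
        _ ≤ _ := by gcongr
    have e3 : (L + 3) * 1 ≤ (L + 3) * (S * n) := by gcongr
    have e4 : 0 ≤ (L + 3) * (Real.log (Δ q) / q * n) := by positivity
    have e5 : b * 6 * (Real.log (A + 1) + 3 - Real.log η₁) / 2 = 3 * (b * (L - Real.log η₁)) := by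
      simp only [L]; ring
    rw [e5]
    linarith
  have hE₂ : D * (Real.log (A + 1) + 3 - Real.log η₂) / 2 + 4 + 3 ≤ δ * n / (4 * A) / 2 := by
    have e1 : D * (L - Real.log η₂) ≤ D * ((L + 3) * Real.log n) := by
      gcongr
      exact sub_le_add_mul (by linarith) hlogn hlogη₂
    have e2 : n / T * (18 * Real.log n + 24 * Real.log T ^ 2) ≤ 24 * (S * n) := by
      calc n / T * (18 * Real.log n + 24 * Real.log T ^ 2)
          ≤ n / T * (24 * Real.log n + 24 * Real.log T ^ 2) := by
            gcongr
            linarith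
        _ = 24 * (S * n) := by simp only [S]; ring
    have e3 : D * ((L + 3) * Real.log n) ≤ (L + 3) * (24 * (S * n)) := by
      calc D * ((L + 3) * Real.log n) = (L + 3) * (D * Real.log n) := by ring
        _ ≤ _ := by
          have := hDlog.trans e2
          gcongr
    have e4 : 0 ≤ (L + 3) * (Real.log (Δ q) / q * n) := by positivity
    have e5 : (L + 3) * 1 ≤ (L + 3) * (S * n) := by gcongr
    have e6 : D * (Real.log (A + 1) + 3 - Real.log η₂) / 2 = D * (L - Real.log η₂) / 2 := by
      simp only [L]
    rw [e6]
    linarith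
  refine hsum.trans ((add_le_add hV₁ hV₂).trans ?_)
  rw [← ENNReal.ofReal_add (by positivity) (by positivity)]
  refine ENNReal.ofReal_le_ofReal ?_
  have f1 := five_mul_exp_le hE₁
  have f2 := five_mul_exp_le hE₂
  have e : -(1 / (8 * A)) * δ * n = -(δ * n / (4 * A) / 2) := by field_simp; ring
  rw [e]
  linarith

end IsLogPotentialLimit

/-! ### Small `n`: a rate for each `n`, and a common rate. -/

/-- For fixed `n` the trivial discrepancy `n` and any positive separation give exponential decay
once `δ n` exceeds some `W`. Below `W` the deviation set sits inside the one for `d`, whose measure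
`θ` is less than one, and a small rate suffices. -/
theorem IsLogPotentialLimit.exists_rate_of_pos {A ω Cω : ℝ} {f : ℝ → ENNReal} {p : ℕ → ℝ → ℝ}
    {Δ : ℝ → ℝ} (h : IsLogPotentialLimit A f p) (hlsc : LowerSemicontinuousOn f (Icc 0 1))
    (hB : IsBrjunoRussmann ω Δ Cω) {n : ℕ} (hn : 0 < n) {d : ℝ} (hd : 0 < d) :
    ∃ c : ℝ, 0 < c ∧ ∀ δ : ℝ, d < δ →
      volume {x ∈ Ico (0 : ℝ) 1 | δ * n < |∑ k ∈ Finset.range n,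
        (f (Int.fract (x + ω + k * ω))).toReal - n * ∫ y in Ico (0 : ℝ) 1, (f y).toReal|} ≤
      ENNReal.ofReal (Real.exp (-c * δ * n)) := by
  have hA := h.pos
  have hn' : (0 : ℝ) < n := by exact_mod_cast hn
  obtain ⟨q, a, hq, hqn, hpq, hap, -⟩ := hB.exists_approx hn
  have hq0 : (0 : ℝ) < q := by exact_mod_cast hq
  have hΔq : 0 < Δ q := by
    have h1 : (1 : ℝ) ≤ q := by exact_mod_cast hq
    have := hB.monotoneOn self_mem_Ici (mem_Ici.2 h1) h1
    rw [hB.map_one] at this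
    linarith
  have hqω : 0 < |(q : ℝ) * ω - round ((q : ℝ) * ω)| :=
    (div_pos hB.const_pos hΔq).trans (hB.lt_dist q hq)
  set e := min (1 / (((n : ℝ) + 1) * q)) |(q : ℝ) * ω - round ((q : ℝ) * ω)|
  have he : 0 < e := lt_min (by positivity) hqω
  set η := min (e / 2) (1 / (n : ℝ))
  have hη : 0 < η := lt_min (by positivity) (by positivity)
  have hnη : n * η ≤ 1 := by
    calc n * η ≤ n * (1 / (n : ℝ)) := by gcongr; exact min_le_right _ _
      _ = 1 := by field_simp
  have hη1 : η ≤ 1 := by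
    have : (1 : ℝ) ≤ n := by exact_mod_cast hn
    nlinarith
  have hsep : IsOrbitSeparated ω n η := IsOrbitSeparated.of_forall fun k hk hkn l => by
    refine le_trans ?_ (le_abs_mul_sub_of_approx hq hap hk hkn.le hpq l)
    linarith [min_le_left (e / 2) (1 / (n : ℝ))]
  have hV := fun t => h.volume_lt_abs_sum_le (HasDiscrepancy.self ω n) hsep hη hη1 hnη ω t
  set C := n * (Real.log (A + 1) + 3 - Real.log η) / 2 + 4
  set W := 4 * A * (|C| + 3)
  have hW : 0 < W := by positivity
  have hθ := h.volume_lt_abs_sum_lt_one hlsc ω n (t := d * n) (by positivity)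
  set θ := volume {x ∈ Ico (0 : ℝ) 1 | d * n < |∑ k ∈ Finset.range n,
        (f (Int.fract (x + ω + k * ω))).toReal - n * ∫ y in Ico (0 : ℝ) 1, (f y).toReal|}
  -- The maximum with `1 / 2` keeps the logarithm meaningful when `θ` is zero.
  set θ' := max θ.toReal (1 / 2)
  have hθ'0 : 0 < θ' := lt_max_of_lt_right (by norm_num)
  have hθ'1 : θ' < 1 := by
    refine max_lt ?_ (by norm_num)
    have := (ENNReal.toReal_lt_toReal hθ.ne_top ENNReal.one_ne_top).2 hθ
    rwa [ENNReal.toReal_one] at this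
  have hlogθ : 0 < -Real.log θ' := neg_pos.2 (Real.log_neg hθ'0 hθ'1)
  refine ⟨min (1 / (4 * A)) (-Real.log θ' / W), lt_min (by positivity) (by positivity),
    fun δ hδ => ?_⟩
  set c := min (1 / (4 * A)) (-Real.log θ' / W)
  have hδ0 : 0 < δ := hd.trans hδ
  have hc0 : 0 < c := lt_min (by positivity) (by positivity)
  rcases le_or_gt W (δ * n) with hbig | hsmall
  · refine (hV (δ * n)).trans (ENNReal.ofReal_le_ofReal ?_)
    have h1 : C + 3 ≤ δ * n / (2 * A) / 2 := by
      rw [div_div, le_div_iff₀ (by positivity)]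
      have := le_abs_self C
      simp only [W] at hbig
      nlinarith
    refine (five_mul_exp_le h1).trans ?_
    refine (half_le_self (Real.exp_pos _).le).trans (Real.exp_le_exp.2 ?_)
    have h2 : c * (δ * n) ≤ 1 / (4 * A) * (δ * n) := by
      gcongr
      exact min_le_left _ _
    have h3 : 1 / (4 * A) * (δ * n) = δ * n / (2 * A) / 2 := by field_simp; ring
    linarith
  · calc _ ≤ θ := by
          refine measure_mono fun x hx => ⟨hx.1, lt_trans ?_ hx.2⟩
          gcongr
      _ = ENNReal.ofReal θ.toReal := (ENNReal.ofReal_toReal hθ.ne_top).symm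
      _ ≤ ENNReal.ofReal (Real.exp (-c * δ * n)) := by
          refine ENNReal.ofReal_le_ofReal ((le_max_left _ (1 / 2 : ℝ)).trans ?_)
          rw [← Real.log_le_iff_le_exp hθ'0]
          have h2 : c * (δ * n) ≤ -Real.log θ' / W * W :=
            mul_le_mul (min_le_right _ _) hsmall.le (by positivity) (by positivity)
          rw [div_mul_cancel₀ _ hW.ne'] at h2
          linarith

/-- Only finitely many `n ≤ N` need their own rate. Allowing every `c' ≤ c` lets the three
hypotheses share one constant at the end. -/
theorem exists_uniform_rate {V : ℕ → ℝ → ENNReal} {valid : ℕ → Prop} {d : ℕ → ℝ} {N : ℕ} {c₀ : ℝ}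
    (hc₀ : 0 < c₀) (hd : ∀ n, valid n → 0 < d n)
    (hlarge : ∀ n, N < n → valid n → ∀ δ, d n < δ →
      V n δ ≤ ENNReal.ofReal (Real.exp (-c₀ * δ * n)))
    (hsmall : ∀ n, valid n → ∃ c : ℝ, 0 < c ∧ ∀ δ, d n < δ →
      V n δ ≤ ENNReal.ofReal (Real.exp (-c * δ * n))) :
    ∃ c : ℝ, 0 < c ∧ ∀ c', c' ≤ c → ∀ n, valid n → ∀ δ, d n < δ →
      V n δ ≤ ENNReal.ofReal (Real.exp (-c' * δ * n)) := by
  have hsmall' : ∀ n, ∃ c : ℝ, 0 < c ∧ (valid n → ∀ δ, d n < δ →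
      V n δ ≤ ENNReal.ofReal (Real.exp (-c * δ * n))) := fun n => by
    by_cases hn : valid n
    · obtain ⟨c, hc, h⟩ := hsmall n hn
      exact ⟨c, hc, fun _ => h⟩
    · exact ⟨1, one_pos, fun h => absurd h hn⟩
  choose c hc h using hsmall'
  have hne : (Finset.range (N + 1)).Nonempty := ⟨0, by simp⟩
  have hmono : ∀ {c₁ c₂ δ : ℝ} {n : ℕ}, 0 ≤ δ → c₁ ≤ c₂ →
      ENNReal.ofReal (Real.exp (-c₂ * δ * n)) ≤ ENNReal.ofReal (Real.exp (-c₁ * δ * n)) := by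
    intro c₁ c₂ δ n hδ hc
    refine ENNReal.ofReal_le_ofReal (Real.exp_le_exp.2 ?_)
    gcongr
  refine ⟨min c₀ ((Finset.range (N + 1)).inf' hne c), lt_min hc₀
    ((Finset.lt_inf'_iff hne).2 fun n _ => hc n), fun c' hc' n hn δ hδ => ?_⟩
  have hδ0 : 0 ≤ δ := ((hd n hn).trans hδ).le
  rcases lt_or_ge N n with hNn | hNn
  · exact (hlarge n hNn hn δ hδ).trans (hmono hδ0 (hc'.trans (min_le_left _ _)))
  · refine (h n hn δ hδ).trans (hmono hδ0 (hc'.trans ((min_le_right _ _).trans ?_)))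
    exact Finset.inf'_le _ (Finset.mem_range.2 (Nat.lt_succ_of_le hNn))

/-! ### Comparison with the three thresholds. -/

/-- The power `T ^ ε` given up in the threshold pays for one factor `log T`, through `log T ≤ T ^ ε
/ ε`; the other factor is bounded by `X`. -/
theorem add_log_sq_div_le {T ε X Y Z : ℝ} (hT : Real.exp 1 ≤ T) (hε : 0 < ε) (hY : Y ≤ X / T)
    (hZ : Z ≤ 2 * X) (hX : Real.log T ≤ X) :
    Y + (Z + Real.log T ^ 2) / T ≤ (3 + 1 / ε) * X / T ^ (1 - ε) := by
  have hT0 : 0 < T := (Real.exp_pos 1).trans_le hT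
  have hT1 : 1 ≤ T := by linarith [Real.add_one_le_exp 1]
  have hlog : 0 ≤ Real.log T := Real.log_nonneg hT1
  have hX0 : 0 ≤ X := hlog.trans hX
  have hsplit : T = T ^ ε * T ^ (1 - ε) := by
    rw [← Real.rpow_add hT0, add_sub_cancel, Real.rpow_one]
  have hp : 0 < T ^ (1 - ε) := Real.rpow_pos_of_pos hT0 _
  have hpε : 1 ≤ T ^ ε := Real.one_le_rpow hT1 hε.le
  have h1 : X / T ≤ X / T ^ (1 - ε) := by
    refine div_le_div_of_nonneg_left hX0 hp ?_
    nlinarith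
  have h2 : Real.log T ^ 2 / T ≤ 1 / ε * (X / T ^ (1 - ε)) := by
    have h3 := Real.log_le_rpow_div hT0.le hε
    calc Real.log T ^ 2 / T = Real.log T * Real.log T / T := by rw [sq]
      _ ≤ X * (T ^ ε / ε) / T := by gcongr
      _ = X * (T ^ ε / ε) / (T ^ ε * T ^ (1 - ε)) := by rw [← hsplit]
      _ = 1 / ε * (X / T ^ (1 - ε)) := by field_simp
  calc Y + (Z + Real.log T ^ 2) / T ≤ X / T + (2 * X + Real.log T ^ 2) / T := by gcongr
    _ = 3 * (X / T) + Real.log T ^ 2 / T := by ring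
    _ ≤ 3 * (X / T ^ (1 - ε)) + 1 / ε * (X / T ^ (1 - ε)) := by gcongr
    _ = _ := by ring

theorem log_cube_le {T : ℝ} (hT : 1 ≤ T) : Real.log T ^ 3 ≤ 27 * T := by
  have hT0 : 0 < T := by linarith
  have h1 := Real.log_le_rpow_div hT0.le (ε := 1 / 3) (by norm_num)
  calc Real.log T ^ 3 ≤ (T ^ (1 / 3 : ℝ) / (1 / 3)) ^ 3 :=
        pow_le_pow_left₀ (Real.log_nonneg hT) h1 3
    _ = 27 * (T ^ (1 / 3 : ℝ)) ^ 3 := by ring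
    _ = 27 * T := by
      rw [← Real.rpow_natCast, ← Real.rpow_mul hT0.le]
      norm_num

theorem add_log_sq_div_le_of_log {T ε Y Z : ℝ} (hT : Real.exp 1 ≤ T) (hε : 0 < ε)
    (hY : Y ≤ 1 / Real.log T) (hZ : Z ≤ 2 * (T / Real.log T)) :
    Y + (Z + Real.log T ^ 2) / T ≤ 30 / Real.log T ^ (1 - ε) := by
  have hT0 : 0 < T := (Real.exp_pos 1).trans_le hT
  have hT1 : 1 ≤ T := by linarith [Real.add_one_le_exp 1]
  have hlog : 1 ≤ Real.log T := (Real.le_log_iff_exp_le hT0).2 hT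
  have hlog0 : 0 < Real.log T := by linarith
  have h1 : Real.log T ^ 2 / T ≤ 27 / Real.log T := by
    rw [div_le_div_iff₀ hT0 hlog0]
    calc Real.log T ^ 2 * Real.log T = Real.log T ^ 3 := by ring
      _ ≤ 27 * T := log_cube_le hT1
  have h2 : Real.log T ^ (1 - ε) ≤ Real.log T := by
    calc Real.log T ^ (1 - ε) ≤ Real.log T ^ (1 : ℝ) :=
          Real.rpow_le_rpow_of_exponent_le hlog (by linarith)
      _ = _ := Real.rpow_one _
  calc Y + (Z + Real.log T ^ 2) / T
      ≤ 1 / Real.log T + (2 * (T / Real.log T) + Real.log T ^ 2) / T := by gcongr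
    _ = 3 / Real.log T + Real.log T ^ 2 / T := by field_simp; ring
    _ ≤ 3 / Real.log T + 27 / Real.log T := by gcongr
    _ = 30 / Real.log T := by ring
    _ ≤ _ := by
      have := Real.rpow_pos_of_pos hlog0 (1 - ε)
      gcongr

/-- Turns each requirement that `Δ⁻¹(Cω n)` be large into a lower bound on `n`; the exceptional `n`
are left to the small case. -/
theorem IsBrjunoRussmann.exists_lt_deltaInv {ω Cω : ℝ} {Δ : ℝ → ℝ} (h : IsBrjunoRussmann ω Δ Cω)
    (h1 : HypothesisH1 Δ) {T₀ : ℝ} (hT₀ : 1 ≤ T₀) :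
    ∃ N : ℕ, ∀ n : ℕ, N < n → 1 ≤ Cω * n → T₀ < deltaInv Δ (Cω * n) := by
  refine ⟨⌈Δ T₀ / Cω⌉₊, fun n hn hCn => ?_⟩
  obtain ⟨hT, hΔT⟩ := deltaInv_spec h h1 hCn
  by_contra hle
  have h2 := h.monotoneOn (mem_Ici.2 hT) (mem_Ici.2 hT₀) (not_lt.1 hle)
  rw [hΔT] at h2
  have h3 : Δ T₀ / Cω < n := (Nat.le_ceil _).trans_lt (by exact_mod_cast hn)
  rw [div_lt_iff₀ h.const_pos] at h3
  linarith

/-- `1 / Cω ≤ T ≤ Δ(T) = Cω n`, hence `n ≤ (Cω n)²`. -/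
theorem IsBrjunoRussmann.log_le_two_mul {ω Cω : ℝ} {Δ : ℝ → ℝ} (h : IsBrjunoRussmann ω Δ Cω)
    (h1 : HypothesisH1 Δ) {n : ℕ} (hn : 1 ≤ Cω * n) (hTC : 2 / Cω ≤ deltaInv Δ (Cω * n)) :
    Real.log n ≤ 2 * Real.log (Cω * n) := by
  obtain ⟨hT, hΔT⟩ := deltaInv_spec h h1 hn
  have hC := h.const_pos
  have hn0 : (0 : ℝ) < n := by
    rcases (Nat.cast_nonneg n : (0 : ℝ) ≤ n).lt_or_eq with h0 | h0
    · exact h0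
    · rw [← h0, mul_zero] at hn; linarith
  have h2 := h.le_map h1 hT
  rw [hΔT] at h2
  have h3 : Cω⁻¹ ≤ Cω * n := by
    have : Cω⁻¹ ≤ 2 / Cω := by
      rw [inv_eq_one_div]
      gcongr
      norm_num
    linarith
  have h4 := Real.log_le_log (inv_pos.2 hC) h3
  rw [Real.log_inv, Real.log_mul hC.ne' hn0.ne'] at h4
  rw [Real.log_mul hC.ne' hn0.ne']
  linarith

section

variable {A ω Cω ε K : ℝ} {Δ : ℝ → ℝ} {n : ℕ} {q : ℝ}

/-- Only `T < q ≤ n` and monotonicity are available, so `log Δ(q) / q` is bounded by `log Δ(n) / T`.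
-/
theorem IsBrjunoRussmann.le_deltaH1 (hB : IsBrjunoRussmann ω Δ Cω) (h1 : HypothesisH1 Δ)
    (hε : 0 < ε) (hK : 0 ≤ K) (hn : 1 ≤ Cω * n) (hTe : Real.exp 1 ≤ deltaInv Δ (Cω * n))
    (hTq : deltaInv Δ (Cω * n) < q) (hqn : q ≤ n) :
    K * (Real.log (Δ q) / q + (Real.log n + Real.log (deltaInv Δ (Cω * n)) ^ 2) /
      deltaInv Δ (Cω * n)) ≤ deltaH1 Δ Cω ε (K * (30 + 1 / ε)) n := by
  obtain ⟨hT, -⟩ := deltaInv_spec hB h1 hn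
  set T := deltaInv Δ (Cω * n)
  have hT0 : 0 < T := by linarith
  have hq0 : 0 < q := hT0.trans hTq
  have hq1 : 1 ≤ q := hT.trans hTq.le
  have hΔq : q ≤ Δ q := hB.le_map h1 hq1
  have hΔn : (n : ℝ) ≤ Δ n := hB.le_map h1 (hq1.trans hqn)
  have hX : 0 ≤ Real.log (Δ n) := Real.log_nonneg (by linarith)
  have hY : Real.log (Δ q) / q ≤ Real.log (Δ n) / T := by
    have := Real.log_le_log (hq0.trans_le hΔq) (hB.monotoneOn (mem_Ici.2 hq1)
      (mem_Ici.2 (hq1.trans hqn)) hqn)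
    gcongr
  have hZ : Real.log n ≤ 2 * Real.log (Δ n) := by
    have := Real.log_le_log (hq0.trans_le hqn) hΔn
    linarith
  have hlT : Real.log T ≤ Real.log (Δ n) := Real.log_le_log hT0 (by linarith)
  have hp : 0 < T ^ (1 - ε) := Real.rpow_pos_of_pos hT0 _
  refine (mul_le_mul_of_nonneg_left (add_log_sq_div_le hTe hε hY hZ hlT) hK).trans ?_
  rw [deltaH1, ← mul_div_assoc, ← mul_assoc]
  gcongr
  norm_num

/-- The growth bound gives `log Δ(q) / q ≤ 1 / log q ≤ 1 / log T` and, at `T` itself, `log (Cω n) ≤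
T / log T`. -/
theorem IsBrjunoRussmann.le_deltaH2 (hB : IsBrjunoRussmann ω Δ Cω) (h2 : HypothesisH2 Δ)
    (hε : 0 < ε) (hK : 0 ≤ K) (hn : 1 ≤ Cω * n) (hTe : Real.exp 1 ≤ deltaInv Δ (Cω * n))
    (hTC : 2 / Cω ≤ deltaInv Δ (Cω * n)) (hTq : deltaInv Δ (Cω * n) < q) :
    K * (Real.log (Δ q) / q + (Real.log n + Real.log (deltaInv Δ (Cω * n)) ^ 2) /
      deltaInv Δ (Cω * n)) ≤ deltaH2 Δ Cω ε (K * (30 + 1 / ε)) n := by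
  have h1 := h2.toHypothesisH1
  obtain ⟨hT, hΔT⟩ := deltaInv_spec hB h1 hn
  have hlog := hB.log_le_two_mul h1 hn hTC
  set T := deltaInv Δ (Cω * n)
  have hT0 : 0 < T := by linarith
  have hT1 : 1 < T := by linarith [Real.add_one_le_exp 1]
  have hlT : 0 < Real.log T := Real.log_pos hT1
  have hlog' : ∀ t, 1 < t → Real.log (Δ t) ≤ t / Real.log t := fun t ht => by
    have h3 := hB.le_map h1 ht.le
    rw [Real.log_le_iff_le_exp (by linarith)]
    exact (h2.map_lt t ht).le
  have hY : Real.log (Δ q) / q ≤ 1 / Real.log T := by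
    have hq0 : 0 < q := hT0.trans hTq
    calc Real.log (Δ q) / q ≤ q / Real.log q / q := by
          have := hlog' q (hT1.trans hTq)
          gcongr
      _ = 1 / Real.log q := by field_simp
      _ ≤ 1 / Real.log T := by gcongr
  have hZ : Real.log n ≤ 2 * (T / Real.log T) := by
    have := hlog' T hT1
    rw [hΔT] at this
    linarith
  have hp : 0 < Real.log T ^ (1 - ε) := Real.rpow_pos_of_pos hlT _
  refine (mul_le_mul_of_nonneg_left (add_log_sq_div_le_of_log hTe hε hY hZ) hK).trans ?_
  rw [deltaH2, ← mul_div_assoc]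
  gcongr
  have : 0 ≤ 1 / ε := by positivity
  linarith

/-- Monotonicity of `log Δ(t) / t` past `t₀` moves the quotient from `q` back to `T`, where `Δ(T) =
Cω n`. -/
theorem IsBrjunoRussmann.le_deltaH3 (hB : IsBrjunoRussmann ω Δ Cω) (h1 : HypothesisH1 Δ)
    (hε : 0 < ε) (hK : 0 ≤ K) (hn : 1 ≤ Cω * n) (hTe : Real.exp 1 ≤ deltaInv Δ (Cω * n))
    (hTC : 2 / Cω ≤ deltaInv Δ (Cω * n)) {t₀ : ℝ}
    (hanti : AntitoneOn (fun t : ℝ => Real.log (Δ t) / t) (Ici t₀))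
    (ht₀ : t₀ ≤ deltaInv Δ (Cω * n)) (hTq : deltaInv Δ (Cω * n) < q) :
    K * (Real.log (Δ q) / q + (Real.log n + Real.log (deltaInv Δ (Cω * n)) ^ 2) /
      deltaInv Δ (Cω * n)) ≤ deltaH3 Δ Cω ε (K * (30 + 1 / ε)) n := by
  obtain ⟨hT, hΔT⟩ := deltaInv_spec hB h1 hn
  have hZ := hB.log_le_two_mul h1 hn hTC
  set T := deltaInv Δ (Cω * n)
  have hT0 : 0 < T := by linarith
  have hY : Real.log (Δ q) / q ≤ Real.log (Cω * n) / T := by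
    have := hanti (mem_Ici.2 ht₀) (mem_Ici.2 (ht₀.trans hTq.le)) hTq.le
    simp only [hΔT] at this
    exact this
  have hX : 0 ≤ Real.log (Cω * n) := Real.log_nonneg hn
  have hlT : Real.log T ≤ Real.log (Cω * n) := by
    have := hB.le_map h1 hT
    rw [hΔT] at this
    exact Real.log_le_log hT0 this
  have hp : 0 < T ^ (1 - ε) := Real.rpow_pos_of_pos hT0 _
  refine (mul_le_mul_of_nonneg_left (add_log_sq_div_le hTe hε hY hZ hlT) hK).trans ?_
  rw [deltaH3, ← mul_div_assoc, ← mul_assoc]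
  gcongr
  norm_num

theorem IsBrjunoRussmann.pos_of_one_le (hB : IsBrjunoRussmann ω Δ Cω) (hn : 1 ≤ Cω * n) :
    (1 : ℝ) < n := by
  have h1 := hB.const_lt
  have h2 := hB.const_pos
  by_contra h
  have : (n : ℝ) ≤ 1 := not_lt.1 h
  nlinarith

theorem IsBrjunoRussmann.deltaH1_pos (hB : IsBrjunoRussmann ω Δ Cω) (h1 : HypothesisH1 Δ)
    (hK : 0 < K) (hn : 1 ≤ Cω * n) : 0 < deltaH1 Δ Cω ε K n := by
  obtain ⟨hT, -⟩ := deltaInv_spec hB h1 hn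
  have hn1 := hB.pos_of_one_le hn
  have h2 := hB.le_map h1 hn1.le
  exact div_pos (mul_pos hK (Real.log_pos (by linarith))) (Real.rpow_pos_of_pos (by linarith) _)

theorem IsBrjunoRussmann.deltaH2_pos (hB : IsBrjunoRussmann ω Δ Cω) (h1 : HypothesisH1 Δ)
    (hK : 0 < K) (hn : 1 < Cω * n) : 0 < deltaH2 Δ Cω ε K n := by
  obtain ⟨hT, hΔT⟩ := deltaInv_spec hB h1 hn.le
  have hT1 : 1 < deltaInv Δ (Cω * n) := by
    refine lt_of_le_of_ne hT fun h => ?_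
    rw [← h, hB.map_one] at hΔT
    linarith
  exact div_pos hK (Real.rpow_pos_of_pos (Real.log_pos hT1) _)

theorem IsBrjunoRussmann.deltaH3_pos (hB : IsBrjunoRussmann ω Δ Cω) (h1 : HypothesisH1 Δ)
    (hK : 0 < K) (hn : 1 < Cω * n) : 0 < deltaH3 Δ Cω ε K n := by
  obtain ⟨hT, -⟩ := deltaInv_spec hB h1 hn.le
  exact div_pos (mul_pos hK (Real.log_pos hn)) (Real.rpow_pos_of_pos (by linarith) _)

end

/-! ### Assembly. -/

theorem theorem1p4 (Ω Ω' : Set ℂ) (hΩ : IsOpen Ω) (hΩc : IsConnected Ω)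
    (hΩ' : IsOpen Ω') (hcpt : IsCompact (closure Ω')) (hsub : closure Ω' ⊆ Ω)
    (hT : ∀ x ∈ Set.Ico (0 : ℝ) 1, (x : ℂ) ∈ Ω')
    (u : ℂ → EReal) (hu : IsSubharmonicOn u Ω) :
    MeasureTheory.IntegrableOn (fun x : ℝ => (u (x : ℂ)).toReal) (Set.Ico 0 1) ∧
    ∀ ε : ℝ, 0 < ε → ε < 1 → ∃ B : ℝ, 0 < B ∧
      ∀ (ω Cω : ℝ) (Δ : ℝ → ℝ), IsBrjunoRussmann ω Δ Cω → ∃ c : ℝ, 0 < c ∧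
        (HypothesisH1 Δ → ∀ n : ℕ, 1 ≤ Cω * n → ∀ δ : ℝ, deltaH1 Δ Cω ε B n < δ →
          MeasureTheory.volume (deviationSet u ω n δ) ≤ ENNReal.ofReal (Real.exp (-c * δ * n))) ∧
        (HypothesisH2 Δ → ∀ n : ℕ, 1 < Cω * n → ∀ δ : ℝ, deltaH2 Δ Cω ε B n < δ →
          MeasureTheory.volume (deviationSet u ω n δ) ≤ ENNReal.ofReal (Real.exp (-c * δ * n))) ∧
        (HypothesisH3 Δ → ∀ n : ℕ, 1 < Cω * n → ∀ δ : ℝ, deltaH3 Δ Cω ε B n < δ →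
          MeasureTheory.volume (deviationSet u ω n δ) ≤ ENNReal.ofReal (Real.exp (-c * δ * n))) := by
  have hseg : unitSegment ⊆ Ω := by
    -- The endpoint `1` is not among the assumed points of `Ω'`; it is reached as a limit and lies
    -- in the closure of `Ω'`, hence in `Ω`.
    rintro _ ⟨x, hx, rfl⟩
    have hmaps : MapsTo (fun x : ℝ => (x : ℂ)) (Ico 0 1) Ω' := hT
    have hcl := hmaps.closure Complex.continuous_ofReal
    rw [closure_Ico zero_ne_one] at hcl
    exact hsub (hcl hx)
  obtain ⟨A, M, f, p, h, hlsc, huf⟩ :=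
    hu.exists_isLogPotentialLimit hΩ hΩc.isPreconnected hseg
  refine ⟨h.integrableOn_toReal huf, fun ε hε hε1 => ?_⟩
  obtain ⟨K, hK, hlarge⟩ := h.exists_volume_le_of_large
  have hA := h.pos
  have hKε : 0 < K * (30 + 1 / ε) := by positivity
  -- One constant for all three hypotheses: H.1 and H.3 need `3 + 1 / ε`, H.2 needs `30`. It is
  -- fixed before `ω`.
  refine ⟨K * (30 + 1 / ε), hKε, fun ω Cω Δ hB => ?_⟩
  have hc₀ : 0 < 1 / (8 * A) := by positivity
  have hdev := fun (n : ℕ) (δ : ℝ) => h.volume_deviationSet_le huf ω n δ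
  have hsmall : ∀ (n : ℕ) (d : ℝ), 1 ≤ Cω * n → 0 < d → ∃ c : ℝ, 0 < c ∧ ∀ δ, d < δ →
      volume (deviationSet u ω n δ) ≤ ENNReal.ofReal (Real.exp (-c * δ * n)) := by
    intro n d hn hd
    have hn0 : 0 < n := by
      have : (0 : ℝ) < n := by linarith [hB.pos_of_one_le hn]
      exact_mod_cast this
    obtain ⟨c, hc, hcδ⟩ := h.exists_rate_of_pos hlsc hB hn0 hd
    exact ⟨c, hc, fun δ hδ => (hdev n δ).trans (hcδ δ hδ)⟩
  have hthreshold : ∀ {T₀ : ℝ}, HypothesisH1 Δ → ∃ N : ℕ, ∀ n : ℕ, N < n → 1 ≤ Cω * n →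
      Real.exp 1 ≤ deltaInv Δ (Cω * n) ∧ 2 / Cω ≤ deltaInv Δ (Cω * n) ∧
      T₀ ≤ deltaInv Δ (Cω * n) := by
    intro T₀ h1
    obtain ⟨N, hN⟩ := hB.exists_lt_deltaInv h1 (T₀ := max (Real.exp 1) (max (2 / Cω) T₀))
      (le_max_of_le_left (by linarith [Real.add_one_le_exp 1]))
    refine ⟨N, fun n hn hCn => ?_⟩
    have := (hN n hn hCn).le
    rw [max_le_iff, max_le_iff] at this
    exact this
  have hrate : ∀ (hyp : Prop) (valid : ℕ → Prop) (d : ℕ → ℝ),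
      (∀ n, valid n → 1 ≤ Cω * n) → (hyp → ∀ n, valid n → 0 < d n) →
      (hyp → ∃ N : ℕ, ∀ n, N < n → valid n → ∀ δ, d n < δ →
        volume (deviationSet u ω n δ) ≤ ENNReal.ofReal (Real.exp (-(1 / (8 * A)) * δ * n))) →
      ∃ c : ℝ, 0 < c ∧ ∀ c', c' ≤ c → hyp → ∀ n, valid n → ∀ δ, d n < δ →
        volume (deviationSet u ω n δ) ≤ ENNReal.ofReal (Real.exp (-c' * δ * n)) := by
    intro hyp valid d hv hd hl
    by_cases hh : hyp
    · obtain ⟨N, hN⟩ := hl hh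
      obtain ⟨c, hc, hcn⟩ := exists_uniform_rate hc₀ (hd hh) hN
        fun n hn => hsmall n (d n) (hv n hn) (hd hh n hn)
      exact ⟨c, hc, fun c' hc' _ => hcn c' hc'⟩
    · exact ⟨1, one_pos, fun _ _ h => absurd h hh⟩
  obtain ⟨c₁, hc₁, hr₁⟩ := hrate (HypothesisH1 Δ) (fun n => 1 ≤ Cω * n)
    (deltaH1 Δ Cω ε (K * (30 + 1 / ε))) (fun _ => id)
    (fun h1 n hn => hB.deltaH1_pos h1 hKε hn) fun h1 => by
      obtain ⟨N, hN⟩ := hthreshold (T₀ := 1) h1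
      refine ⟨N, fun n hNn hn δ hδ => (hdev n δ).trans ?_⟩
      obtain ⟨hTe, hTC, -⟩ := hN n hNn hn
      obtain ⟨q, hTq, hqn, hq⟩ := hlarge ω Cω Δ hB h1 n hn hTe hTC
      exact hq δ ((hB.le_deltaH1 h1 hε hK.le hn hTe hTq hqn).trans hδ.le)
  obtain ⟨c₂, hc₂, hr₂⟩ := hrate (HypothesisH2 Δ) (fun n => 1 < Cω * n)
    (deltaH2 Δ Cω ε (K * (30 + 1 / ε))) (fun _ => le_of_lt)
    (fun h2 n hn => hB.deltaH2_pos h2.toHypothesisH1 hKε hn) fun h2 => by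
      obtain ⟨N, hN⟩ := hthreshold (T₀ := 1) h2.toHypothesisH1
      refine ⟨N, fun n hNn hn δ hδ => (hdev n δ).trans ?_⟩
      obtain ⟨hTe, hTC, -⟩ := hN n hNn hn.le
      obtain ⟨q, hTq, -, hq⟩ := hlarge ω Cω Δ hB h2.toHypothesisH1 n hn.le hTe hTC
      exact hq δ ((hB.le_deltaH2 h2 hε hK.le hn.le hTe hTC hTq).trans hδ.le)
  obtain ⟨c₃, hc₃, hr₃⟩ := hrate (HypothesisH3 Δ) (fun n => 1 < Cω * n)
    (deltaH3 Δ Cω ε (K * (30 + 1 / ε))) (fun _ => le_of_lt)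
    (fun h3 n hn => hB.deltaH3_pos h3.toHypothesisH1 hKε hn) fun h3 => by
      obtain ⟨t₀, -, hanti⟩ := h3.antitoneOn
      obtain ⟨N, hN⟩ := hthreshold (T₀ := t₀) h3.toHypothesisH1
      refine ⟨N, fun n hNn hn δ hδ => (hdev n δ).trans ?_⟩
      obtain ⟨hTe, hTC, ht₀⟩ := hN n hNn hn.le
      obtain ⟨q, hTq, -, hq⟩ := hlarge ω Cω Δ hB h3.toHypothesisH1 n hn.le hTe hTC
      exact hq δ ((hB.le_deltaH3 h3.toHypothesisH1 hε hK.le hn.le hTe hTC hanti ht₀ hTq).trans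
        hδ.le)
  exact ⟨min c₁ (min c₂ c₃), lt_min hc₁ (lt_min hc₂ hc₃), hr₁ _ (min_le_left _ _),
    hr₂ _ ((min_le_right _ _).trans (min_le_left _ _)),
    hr₃ _ ((min_le_right _ _).trans (min_le_right _ _))⟩
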